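/- Let $V$ be a vector space of finite dimension $n\ge 1$ over an arbitrary field $\mathbb F$, let $G\subset \mathrm{GL}(V)$ be a finite group, and let $S=S(V^*)$ be the symmetric algebra of $V^*$, identified with $\mathbb F[x_1,\dots,x_n]$ for a basis $x_1,\dots,x_n$ of $V^*$. Let $G$ act on $V^*$ by the dual action, on $S$ by the induced algebra automorphisms, and diagonally on $S\otimes\wedge^kV^*\otimes V$ (tensor products over $\mathbb F$); then $(S\otimes\wedge^kV^*\otimes V)^G$ is a module over the ring of invariants $S^G$. An element of $S_d\otimes\wedge^kV^*\otimes V$ is called homogeneous of degree $d$. Let $\mathcal F(S)$ be the fraction field of $S$. Let $\mathcal A$ be the (possibly empty) set of reflecting hyperplanes of $G$, i.e. hyperplanes $H$ of $V$ fixed pointwise by some nonidentity element of $G$ (a reflection about $H$). For each $H\in\mathcal A$ fix a linear form $\ell_H\in V^*$ with $\ker \ell_H=H$, and put - $G_H=\{g\in G: g|_H=1\}$, $K_H=\ker(\det:G_H\to\mathbb F^\times)$ (the identity and the transvections in $G$ about $H$), and $e_H=|G_H:K_H|$; - $b_H=\dim_{\mathbb F}(\mathcal R_H\cap H)$, where $\mathcal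 R_H\subset V$ is spanned by the images $\mathrm{Im}(s-1)$ of all reflections $s\in G$ about $H$; - $\delta_H=1$ if $G_H$ consists of the identity and exactly one transvection, and $\delta_H=0$ otherwise; - $a_{H,k}=(n-\delta_H)\left(\binom{n-1}{k}-\binom{n-b_H-1}{k}\right)+\binom{n-1}{k-1}-\binom{n-b_H-1}{k-1}$, where $\binom{a}{b}=0$ if $a<b$ or $b<0$. Set $$Q=\prod_{H\in\mathcal A}\ell_H,\qquad Q_{\det}=\prod_{H\in\mathcal A}\ell_H^{\,e_H-1},\qquad Q_k=\prod_{H\in\mathcal A}\ell_H^{\,e_Ha_{H,k}}.$$ Let $k\ge 0$, and let $\mathcal B=\{\eta_1,\dots,\eta_N\}$ be $N=n\binom nk$ homogeneous elements of $(S\otimes\wedge^kV^*\otimes V)^G$. Let $\mathrm{Coef}(\mathcal B)=(f_{ij})\in M_{N\times N}(S)$ be their coefficient matrix with respect to any ordered $\mathbb F$-basis $z_1,\dots,z_N$ of $\wedge^kV^*\otimes V$, so that $\eta_i=\sum_j f_{ij}\otimes z_j$. Then the following are equivalent: a) $(S\otimes\wedge^kV^*\otimes V)^G$ is a free $S^G$-module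 with basis $\mathcal B$. b) $\det\mathrm{Coef}(\mathcal B)=c\;Q^{\binom{n-1}{k}}\,Q_{\det}^{(n-1)\binom{n-1}{k-1}}\,Q_k$ for some $c\in\mathbb F^\times$. c) $\mathcal B$ is linearly independent over $\mathcal F(S)$ and $$\sum_{\eta\in\mathcal B}\deg\eta=\sum_{H\in\mathcal A}\left[\binom{n-1}{k}+(e_H-1)(n-1)\binom{n-1}{k-1}+e_H\,a_{H,k}\right].$$ -/

import Mathlib

open scoped TensorProduct

noncomputable section

namespace DiffDer

open Module

section Polynomials

variable (F : Type*) [Field F] (V : Type*) [AddCommGroup V] [Module F V]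

/-- The polynomial ring `S = S(V*)`, the symmetric algebra of the dual space of `V`. -/
abbrev Poly : Type _ := SymmetricAlgebra F (Dual F V)

/-- A linear form on `V`, viewed as a polynomial of degree one. -/
abbrev linForm : Dual F V →ₗ[F] Poly F V := SymmetricAlgebra.ι F (Dual F V)

/-- The homogeneous component `S_d` of degree `d` of `S`, spanned by the products of `d` linear
forms. -/
def polyDegree (d : ℕ) : Submodule F (Poly F V) := LinearMap.range (linForm F V) ^ d

/-- The space `∧^k V* ⊗ V`. -/
abbrev FormVec (k : ℕ) : Type _ := ⋀[F]^k (Dual F V) ⊗[F] V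

/-- The `S`-module `S ⊗ ∧^k V* ⊗ V` of differential derivations of rank `k`; the polynomial ring
acts on the first tensor factor. -/
abbrev DiffDerivation (k : ℕ) : Type _ := Poly F V ⊗[F] FormVec F V k

/-- A differential derivation is homogeneous of polynomial degree `d` when it lies in
`S_d ⊗ ∧^k V* ⊗ V`. -/
def IsHomogeneousOfDegree {k : ℕ} (d : ℕ) (η : DiffDerivation F V k) : Prop :=
  η ∈ LinearMap.range
    (TensorProduct.map (polyDegree F V d).subtype (LinearMap.id : FormVec F V k →ₗ[F] _))

end Polynomials

section Action

variable {F : Type*} [Field F] {V : Type*} [AddCommGroup V] [Module F V]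

/-- The dual action of `g` on `V*`, `φ ↦ φ ∘ g⁻¹`. -/
def dualAct (g : V ≃ₗ[F] V) : Dual F V →ₗ[F] Dual F V :=
  Dual.transpose (g⁻¹ : V ≃ₗ[F] V).toLinearMap

/-- The action of `g` on `S` by algebra homomorphisms that extends the dual action on `V*`. -/
def polyAct (g : V ≃ₗ[F] V) : Poly F V →ₐ[F] Poly F V :=
  SymmetricAlgebra.lift (linForm F V ∘ₗ dualAct g)

/-- The action of `g` on `S ⊗ ∧^k V* ⊗ V`, diagonal on the three tensor factors. -/
def diffDerAct (k : ℕ) (g : V ≃ₗ[F] V) : DiffDerivation F V k →ₗ[F] DiffDerivation F V k :=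
  TensorProduct.map (polyAct g).toLinearMap
    (TensorProduct.map (exteriorPower.map k (dualAct g)) g.toLinearMap)

lemma diffDerAct_smul (k : ℕ) (g : V ≃ₗ[F] V) (f : Poly F V) (η : DiffDerivation F V k) :
    diffDerAct k g (f • η) = polyAct g f • diffDerAct k g η := by
  induction η using TensorProduct.induction_on with
  | zero => simp
  | tmul p m => simp [diffDerAct, TensorProduct.smul_tmul']
  | add x y hx hy => rw [smul_add, map_add, map_add, smul_add, hx, hy]

/-- The ring `S^G` of invariant polynomials. -/
def polyInvariants (G : Subgroup (V ≃ₗ[F] V)) : Subalgebra F (Poly F V) where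
  carrier := {f | ∀ g ∈ G, polyAct g f = f}
  mul_mem' ha hb g hg := by rw [map_mul, ha g hg, hb g hg]
  add_mem' ha hb g hg := by rw [map_add, ha g hg, hb g hg]
  algebraMap_mem' r g _ := (polyAct g).commutes r

/-- The `S^G`-module `(S ⊗ ∧^k V* ⊗ V)^G` of invariant differential derivations of rank `k`. -/
def invariants (G : Subgroup (V ≃ₗ[F] V)) (k : ℕ) :
    Submodule (polyInvariants G) (DiffDerivation F V k) where
  carrier := {η | ∀ g ∈ G, diffDerAct k g η = η}
  add_mem' ha hb g hg := by rw [map_add, ha g hg, hb g hg]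
  zero_mem' g _ := map_zero _
  smul_mem' f η hη g hg := by
    change diffDerAct k g ((f : Poly F V) • η) = (f : Poly F V) • η
    rw [diffDerAct_smul, f.2 g hg, hη g hg]

/-- The coefficient matrix of a family in `S ⊗ ∧^k V* ⊗ V` with respect to an ordered basis `z` of
`∧^k V* ⊗ V`: the `i`-th member is `∑ j, f i j ⊗ z j`. -/
def coef {k m : ℕ} (z : Basis (Fin m) F (FormVec F V k)) (B : Fin m → DiffDerivation F V k) :
    Matrix (Fin m) (Fin m) (Poly F V) :=
  Matrix.of fun i j => (Algebra.TensorProduct.basis (Poly F V) z).repr (B i) j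

/-- Linear independence over the fraction field of `S`, inside the extension of scalars of
`S ⊗ ∧^k V* ⊗ V` from `S` to this field. -/
def FracIndependent {k : ℕ} {ι : Type*} (B : ι → DiffDerivation F V k) : Prop :=
  LinearIndependent (FractionRing (Poly F V))
    fun i => (1 : FractionRing (Poly F V)) ⊗ₜ[Poly F V] B i

end Action

section Arrangement

variable {F : Type*} [Field F] {V : Type*} [AddCommGroup V] [Module F V]

/-- `s` is a reflection about `H`: a nonidentity transformation that fixes pointwise the subspace
`H`, which has codimension one. -/
def IsReflectionAbout (s : V ≃ₗ[F] V) (H : Submodule F V) : Prop :=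
  s ≠ 1 ∧ finrank F (V ⧸ H) = 1 ∧ ∀ v ∈ H, s v = v

/-- The reflecting hyperplanes of `G`. -/
def reflectingHyperplanes (G : Subgroup (V ≃ₗ[F] V)) : Set (Submodule F V) :=
  {H | ∃ s ∈ G, IsReflectionAbout s H}

lemma IsReflectionAbout.eq_ker {s : V ≃ₗ[F] V} {H : Submodule F V} (h : IsReflectionAbout s H) :
    H = LinearMap.ker (s.toLinearMap - LinearMap.id) := by
  obtain ⟨h1, h2, h3⟩ := h
  have hle : H ≤ LinearMap.ker (s.toLinearMap - LinearMap.id) := fun v hv => by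
    simp [h3 v hv]
  have hco : IsCoatom H := by
    rw [← isSimpleModule_iff_isCoatom, isSimpleModule_iff_finrank_eq_one]
    exact h2
  rcases hco.le_iff.1 hle with h | h
  · exact absurd (LinearEquiv.ext fun v => by
      have : v ∈ LinearMap.ker (s.toLinearMap - LinearMap.id) := h ▸ Submodule.mem_top
      simpa [sub_eq_zero] using this) h1
  · exact h.symm

lemma finite_reflectingHyperplanes (G : Subgroup (V ≃ₗ[F] V)) [Finite G] :
    (reflectingHyperplanes G).Finite := by
  refine (Set.finite_range fun s : G =>
    LinearMap.ker ((s : V ≃ₗ[F] V).toLinearMap - LinearMap.id)).subset ?_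
  rintro H ⟨s, hs, h⟩
  exact ⟨⟨s, hs⟩, h.eq_ker.symm⟩

/-- The arrangement of reflecting hyperplanes of a finite group `G`, as a finite set. -/
def arrangement (G : Subgroup (V ≃ₗ[F] V)) [Finite G] : Finset (Submodule F V) :=
  (finite_reflectingHyperplanes G).toFinset

variable (G : Subgroup (V ≃ₗ[F] V)) (H : Submodule F V)

/-- The pointwise stabilizer `G_H` of `H` in `G`. -/
def pointwiseStabilizer : Subgroup (V ≃ₗ[F] V) :=
  G ⊓ fixingSubgroup (V ≃ₗ[F] V) (H : Set V)

/-- The subgroup `K_H` of `G_H`, the kernel of the determinant on `G_H`; for a hyperplane `H` it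
consists of the identity and the transvections in `G` about `H`. -/
def transvectionSubgroup : Subgroup (V ≃ₗ[F] V) :=
  pointwiseStabilizer G H ⊓ (LinearEquiv.det : (V ≃ₗ[F] V) →* Fˣ).ker

/-- The index `e_H = |G_H : K_H|`. -/
def eNum : ℕ := (transvectionSubgroup G H).relIndex (pointwiseStabilizer G H)

/-- The root space of `H`, spanned by the root vectors of the reflections `s` in `G` about `H`,
where the root vector of `s` spans the image of `s - 1`. -/
def rootSpace : Submodule F V :=
  ⨆ s ∈ {s ∈ G | IsReflectionAbout s H}, LinearMap.range (s.toLinearMap - LinearMap.id)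

/-- The dimension `b_H` of the transvection root space `rootSpace G H ⊓ H`. -/
def bNum : ℕ := finrank F (rootSpace G H ⊓ H : Submodule F V)

open Classical in
/-- `δ_H` is `1` if `G_H` consists of the identity and exactly one transvection, else `0`. -/
def deltaNum : ℕ :=
  if ∃ t ∈ transvectionSubgroup G H, t ≠ 1 ∧ (pointwiseStabilizer G H : Set (V ≃ₗ[F] V)) = {1, t}
  then 1 else 0

/-- The binomial coefficient `m` choose `k - 1`, which is `0` for `k = 0`. -/
def choosePred (m : ℕ) : ℕ → ℕ
  | 0 => 0
  | k + 1 => m.choose k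

/-- The integer `a_{H,k}`. As `n ≥ 1` and `b_H ≤ n - 1` for a hyperplane `H`, where `n = dim V`,
none of the subtractions truncates. -/
def aNum (k : ℕ) : ℕ :=
  (finrank F V - deltaNum G H) *
      ((finrank F V - 1).choose k - (finrank F V - bNum G H - 1).choose k) +
    (choosePred (finrank F V - 1) k - choosePred (finrank F V - bNum G H - 1) k)

variable [Finite G] (ℓ : Submodule F V → Dual F V)

/-- `Q`, the product of the linear forms `ℓ H` over the reflecting hyperplanes `H`. -/
def Q : Poly F V := ∏ H ∈ arrangement G, linForm F V (ℓ H)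

/-- `Q_det`, the product of the `ℓ H ^ (e_H - 1)`. -/
def Qdet : Poly F V := ∏ H ∈ arrangement G, linForm F V (ℓ H) ^ (eNum G H - 1)

/-- `Q_k`, the product of the `ℓ H ^ (e_H * a_{H,k})`. -/
def Qk (k : ℕ) : Poly F V := ∏ H ∈ arrangement G, linForm F V (ℓ H) ^ (eNum G H * aNum G H k)

end Arrangement

end DiffDer

end

/-!
The determinant criterion is a comparison of divisors in the factorial ring `S`. Let `M` stand for
`S ⊗ ∧^k V* ⊗ V` and let `c_H` be the exponent of `ℓ_H` in the product on the right hand side of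
the determinant formula (`exponent`; `discr` is the product itself).

**The local statement** (`exists_local_basis`). For a reflecting hyperplane `H` with pointwise
stabilizer `G_H` there is an `F`-basis `w_j` of `∧^k V* ⊗ V` with exponents `m_j` of sum `c_H` such
that the coordinates of a `G_H`-invariant are divisible by the `ℓ_H ^ m_j` and such that the
elements `ℓ_H ^ m_j ⊗ w_j` lie in the `S`-span of the `G_H`-invariants. So this span is free with
the basis `ℓ_H ^ m_j ⊗ w_j`, whose determinant is `ℓ_H ^ c_H` up to a constant.

**From local to global.** The first half of the local statement, applied at every `H`, shows that
the product of the `ℓ_H ^ c_H` divides the determinant of any `N` invariants (`discr_dvd_det`).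
If a family of invariants has exactly this determinant, up to a constant, Cramer's rule shows that
it is a basis (`mem_span_of_det`). Conversely, for a basis of the invariants no prime `q` of `S` can
divide the quotient: let `I` be the inertia group of `q`, which is `G_H` for `q = ℓ_H` and trivial
for a prime that is not associated to any `ℓ_H`. By a transfer argument there is an `u` prime to
`q` that multiplies all `I`-invariants into the span of the `G`-invariants (`exists_transfer`). By
the second half of the local statement the determinant of the basis thus divides `u ^ N * q ^ c`
up to a constant, where `c` is `c_H` or `0` (`not_pow_dvd_det`). The last condition of the theorem
follows by comparing degrees, since all determinants are homogeneous.

**The local computation.** Choose a basis `v_0, …, v_m` of `V` with dual basis `x_0 = ℓ_H, x_1, …`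
such that `v_0` is an eigenvector of some `s` in `G_H` whose eigenvalue generates the group of
determinants, of order `e_H`, and such that `v_j`, for `j` in a set `T` of `b_H` indices, span the
root vectors of the transvections in `G_H` (`exists_frame`). The `w_j` are the `x_J ⊗ v_i`, except
that for `i = 0 ∈ J` one takes the product of `x_{J - 0}` with the identity `∑ x_i ⊗ v_i` of
`V* ⊗ V` (`adaptedBasis`); the exponents are given by `frameExponent`.

For the divisibility one evaluates an invariant at a covector and `k` vectors (`pair`). An element
of `G_H` changes polynomials by multiples of `ℓ_H`, so comparing the value before and after the
action of a transvection yields divisibility by `ℓ_H` (`dvd_pair_of_fixed`, `dvd_pair_sub`), and by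
`ℓ_H ^ 2` when there are two different transvections (`sq_dvd_pair`). The weight of the value under
`s` improves this to the stated powers (`pow_succ_dvd_of_weight`).

For the second half one uses equivariant alternating maps `Θ` of covectors with values in `M`:
`ℓ_H ^ e_H Θ(y)` always lies in the span of the invariants (`IsFrame.pow_smul_mem`), one factor
`ℓ_H` fewer is needed when `ℓ_H` is among the `y_q`, and none when the `y_q` are fixed. If `G_H`
consists of the identity and one transvection, the trace of a suitable element gives a better
exponent (`IsFrame.vectorForm_zero_mem_of_unique`); this is the origin of the term `δ_H`.
-/

noncomputable section

namespace DiffDer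

open Module

section Algebra

variable {F : Type*} [Field F] {V : Type*} [AddCommGroup V] [Module F V]

/-! ### Linear forms and degrees in the polynomial ring -/

/-- Evaluation of polynomial functions at a point of `V`. -/
def evalAt (v : V) : Poly F V →ₐ[F] F := SymmetricAlgebra.lift (Dual.eval F V v)

@[simp] lemma evalAt_linForm (v : V) (ξ : Dual F V) : evalAt v (linForm F V ξ) = ξ v := by
  simp [evalAt, linForm]

lemma linForm_injective : Function.Injective (linForm F V) := by
  rw [← LinearMap.ker_eq_bot, LinearMap.ker_eq_bot']
  intro ξ h
  ext v
  rw [← evalAt_linForm, h, map_zero, LinearMap.zero_apply]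

lemma linForm_ne_zero {ξ : Dual F V} (h : ξ ≠ 0) : linForm F V ξ ≠ 0 := fun h' =>
  h (linForm_injective (h'.trans (map_zero _).symm))

lemma prime_linForm {ξ : Dual F V} (h : ξ ≠ 0) : Prime (linForm F V ξ) := by
  have hs : LinearIndepOn F id ({ξ} : Set (Dual F V)) := LinearIndepOn.singleton (v := id) h
  let b := Basis.extend hs
  have hb : b ⟨ξ, hs.subset_extend _ rfl⟩ = ξ := Basis.extend_apply_self hs _
  rw [← MulEquiv.prime_iff (SymmetricAlgebra.equivMvPolynomial b)]
  have h1 := SymmetricAlgebra.equivMvPolynomial_ι_apply b ⟨ξ, hs.subset_extend _ rfl⟩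
  rw [hb] at h1
  exact h1 ▸ MvPolynomial.X_prime

lemma eq_smul_of_linForm_dvd {ξ ζ : Dual F V} (h : linForm F V ξ ∣ linForm F V ζ) :
    ∃ c : F, ζ = c • ξ := by
  have : ζ ∈ Submodule.span F (Set.range fun _ : Unit => ξ) := by
    refine mem_span_of_iInf_ker_le_ker fun v hv => ?_
    simp only [Submodule.mem_iInf, LinearMap.mem_ker, forall_const] at hv
    obtain ⟨f, hf⟩ := h
    rw [LinearMap.mem_ker, ← evalAt_linForm, hf, map_mul, evalAt_linForm, hv, zero_mul]
  rw [Set.range_const, Submodule.mem_span_singleton] at this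
  obtain ⟨c, hc⟩ := this
  exact ⟨c, hc.symm⟩

variable (F V) in
lemma uniqueFactorizationMonoid_poly : UniqueFactorizationMonoid (Poly F V) :=
  (SymmetricAlgebra.equivMvPolynomial (Basis.ofVectorSpace F (Dual F V))).symm.toMulEquiv
    |>.uniqueFactorizationMonoid inferInstance

lemma associated_of_prime_dvd_linForm {q : Poly F V} (hq : Prime q) {ξ : Dual F V} (hξ : ξ ≠ 0)
    (h : q ∣ linForm F V ξ) : Associated q (linForm F V ξ) :=
  (hq.dvd_prime_iff_associated (prime_linForm hξ)).1 h

lemma isHomogeneous_of_mem_polyDegree {κ : Type*} (b : Basis κ F (Dual F V)) {d : ℕ}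
    {f : Poly F V} (hf : f ∈ polyDegree F V d) :
    (SymmetricAlgebra.equivMvPolynomial b f).IsHomogeneous d := by
  let e := (SymmetricAlgebra.equivMvPolynomial b).toAlgHom
  have h1 : (LinearMap.range (linForm F V)).map e.toLinearMap ≤
      MvPolynomial.homogeneousSubmodule κ F 1 := by
    rw [← LinearMap.range_comp, LinearMap.range_le_iff_comap, eq_top_iff, ← b.span_eq,
      Submodule.span_le]
    rintro _ ⟨i, rfl⟩
    change SymmetricAlgebra.equivMvPolynomial b (SymmetricAlgebra.ι _ _ (b i)) ∈
      MvPolynomial.homogeneousSubmodule κ F 1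
    rw [SymmetricAlgebra.equivMvPolynomial_ι_apply]
    exact MvPolynomial.isHomogeneous_X _ _
  have h2 : ∀ d, (LinearMap.range (linForm F V)).map e.toLinearMap ^ d ≤
      MvPolynomial.homogeneousSubmodule κ F d := by
    intro d
    induction d with
    | zero =>
      rw [pow_zero, Submodule.one_le]
      exact MvPolynomial.isHomogeneous_one _ _
    | succ d ih =>
      rw [pow_succ]
      exact (mul_le_mul' ih h1).trans (MvPolynomial.homogeneousSubmodule_mul _ _)
  have h3 : e f ∈ (polyDegree F V d).map e.toLinearMap := ⟨f, hf, rfl⟩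
  rw [polyDegree, Submodule.map_pow] at h3
  exact h2 d h3

lemma degree_unique {d d' : ℕ} {f : Poly F V} (hf : f ∈ polyDegree F V d)
    (hf' : f ∈ polyDegree F V d') (h0 : f ≠ 0) : d = d' :=
  let b := Basis.ofVectorSpace F (Dual F V)
  (isHomogeneous_of_mem_polyDegree b hf).inj_right (isHomogeneous_of_mem_polyDegree b hf')
    (by simpa using h0)

/-- A cofactor between two homogeneous polynomials of the same degree is a constant. -/
lemma eq_algebraMap_of_mul_mem {d : ℕ} {f r : Poly F V} (hf : f ∈ polyDegree F V d)
    (hfr : f * r ∈ polyDegree F V d) (h0 : f * r ≠ 0) : ∃ c : F, r = algebraMap F _ c := by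
  let b := Basis.ofVectorSpace F (Dual F V)
  let e := SymmetricAlgebra.equivMvPolynomial b
  have hf0 : e f ≠ 0 := by simpa using left_ne_zero_of_mul h0
  have hr0 : e r ≠ 0 := by simpa using right_ne_zero_of_mul h0
  have h1 := (isHomogeneous_of_mem_polyDegree b hf).totalDegree hf0
  have h2 := (isHomogeneous_of_mem_polyDegree b hfr).totalDegree (by simpa using h0)
  rw [map_mul, MvPolynomial.totalDegree_mul_of_isDomain hf0 hr0, h1] at h2
  have h3 : (e r).totalDegree = 0 := by omega
  rw [MvPolynomial.totalDegree_eq_zero_iff_eq_C] at h3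
  refine ⟨(e r).coeff 0, e.injective (h3.trans ?_)⟩
  rw [e.commutes]
  rfl

lemma eq_algebraMap_of_isUnit {r : Poly F V} (h : IsUnit r) :
    ∃ c : F, c ≠ 0 ∧ r = algebraMap F _ c := by
  let e := SymmetricAlgebra.equivMvPolynomial (Basis.ofVectorSpace F (Dual F V))
  have h1 : IsUnit (e r) := h.map e
  rw [MvPolynomial.isUnit_iff_eq_C_of_isReduced] at h1
  obtain ⟨c, hc, h1⟩ := h1
  refine ⟨c, hc.ne_zero, e.injective (h1.trans ?_)⟩
  rw [e.commutes]
  rfl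

lemma mul_mem_polyDegree {d d' : ℕ} {f g : Poly F V} (hf : f ∈ polyDegree F V d)
    (hg : g ∈ polyDegree F V d') : f * g ∈ polyDegree F V (d + d') := by
  rw [polyDegree, pow_add]
  exact Submodule.mul_mem_mul hf hg

lemma one_mem_polyDegree : (1 : Poly F V) ∈ polyDegree F V 0 := by
  rw [polyDegree, pow_zero]
  exact Submodule.one_le.1 le_rfl

lemma prod_mem_polyDegree {ι : Type*} (s : Finset ι) (f : ι → Poly F V) (d : ι → ℕ)
    (h : ∀ i ∈ s, f i ∈ polyDegree F V (d i)) : ∏ i ∈ s, f i ∈ polyDegree F V (∑ i ∈ s, d i) := by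
  classical
  induction s using Finset.induction_on with
  | empty => simpa using one_mem_polyDegree
  | insert a s ha ih =>
    rw [Finset.prod_insert ha, Finset.sum_insert ha]
    exact mul_mem_polyDegree (h _ (by simp)) (ih fun i hi => h i (by simp [hi]))

lemma linForm_pow_mem (ξ : Dual F V) (d : ℕ) : linForm F V ξ ^ d ∈ polyDegree F V d :=
  Submodule.pow_mem_pow _ (LinearMap.mem_range_self _ ξ) d

/-! ### The group actions -/

lemma dualAct_apply (g : V ≃ₗ[F] V) (ξ : Dual F V) (v : V) :
    dualAct g ξ v = ξ ((g⁻¹ : V ≃ₗ[F] V) v) := rfl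

lemma dualAct_one : dualAct (1 : V ≃ₗ[F] V) = LinearMap.id := by
  ext ξ v
  simp [dualAct_apply]

lemma dualAct_mul (g h : V ≃ₗ[F] V) : dualAct (g * h) = dualAct g ∘ₗ dualAct h := by
  ext ξ v
  simp [dualAct_apply, mul_inv_rev]

@[simp] lemma polyAct_linForm (g : V ≃ₗ[F] V) (ξ : Dual F V) :
    polyAct g (linForm F V ξ) = linForm F V (dualAct g ξ) := by
  simp [polyAct, linForm]

lemma polyAct_one : polyAct (1 : V ≃ₗ[F] V) = AlgHom.id F (Poly F V) := by
  refine SymmetricAlgebra.algHom_ext (LinearMap.ext fun ξ => ?_)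
  exact (polyAct_linForm 1 ξ).trans (by simp [dualAct_one])

lemma polyAct_mul (g h : V ≃ₗ[F] V) : polyAct (g * h) = (polyAct g).comp (polyAct h) := by
  refine SymmetricAlgebra.algHom_ext (LinearMap.ext fun ξ => ?_)
  refine (polyAct_linForm (g * h) ξ).trans ?_
  change _ = polyAct g (polyAct h (linForm F V ξ))
  rw [polyAct_linForm, polyAct_linForm, dualAct_mul]
  rfl

lemma polyAct_mul_apply (g h : V ≃ₗ[F] V) (f : Poly F V) :
    polyAct (g * h) f = polyAct g (polyAct h f) := by rw [polyAct_mul]; rfl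

lemma diffDerAct_tmul (k : ℕ) (g : V ≃ₗ[F] V) (f : Poly F V) (y : Fin k → Dual F V) (v : V) :
    diffDerAct k g (f ⊗ₜ (exteriorPower.ιMulti F k y ⊗ₜ v)) =
      polyAct g f ⊗ₜ (exteriorPower.ιMulti F k (dualAct g ∘ y) ⊗ₜ g v) := by
  simp [diffDerAct]

lemma diffDerAct_one (k : ℕ) :
    diffDerAct k (1 : V ≃ₗ[F] V) = LinearMap.id := by
  rw [diffDerAct, polyAct_one, dualAct_one, exteriorPower.map_id]
  ext
  simp

lemma diffDerAct_mul (k : ℕ) (g h : V ≃ₗ[F] V) :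
    diffDerAct k (g * h) = diffDerAct k g ∘ₗ diffDerAct k h := by
  rw [diffDerAct, diffDerAct, diffDerAct, polyAct_mul, dualAct_mul, exteriorPower.map_comp,
    ← TensorProduct.map_comp, ← TensorProduct.map_comp]
  rfl

lemma diffDerAct_mul_apply (k : ℕ) (g h : V ≃ₗ[F] V) (η : DiffDerivation F V k) :
    diffDerAct k (g * h) η = diffDerAct k g (diffDerAct k h η) := by rw [diffDerAct_mul]; rfl

end Algebra

section Inertia

variable {F : Type*} [Field F] {V : Type*} [AddCommGroup V] [Module F V]

/-! ### Inertia groups and transfer -/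

/-- The inertia group of `q`: the elements of `G` that act trivially on `S` modulo `q`. -/
def inertia (G : Subgroup (V ≃ₗ[F] V)) (q : Poly F V) : Subgroup (V ≃ₗ[F] V) where
  carrier := {g | g ∈ G ∧ ∀ f, q ∣ polyAct g f - f}
  mul_mem' := by
    rintro g h ⟨hg, hg'⟩ ⟨hh, hh'⟩
    refine ⟨mul_mem hg hh, fun f => ?_⟩
    rw [polyAct_mul_apply, ← sub_add_sub_cancel _ (polyAct h f)]
    exact dvd_add (hg' _) (hh' _)
  one_mem' := ⟨one_mem _, fun f => by simp [polyAct_one]⟩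
  inv_mem' := by
    rintro g ⟨hg, hg'⟩
    refine ⟨inv_mem hg, fun f => ?_⟩
    have := hg' (polyAct g⁻¹ f)
    rw [← polyAct_mul_apply, mul_inv_cancel, polyAct_one] at this
    rw [← dvd_neg, neg_sub]
    exact this

lemma inertia_le (G : Subgroup (V ≃ₗ[F] V)) (q : Poly F V) : inertia G q ≤ G := fun _ h => h.1

lemma dvd_polyAct_sub_of_linForm {g : V ≃ₗ[F] V} {q : Poly F V}
    (h : ∀ ξ : Dual F V, q ∣ linForm F V (dualAct g ξ) - linForm F V ξ) (f : Poly F V) :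
    q ∣ polyAct g f - f := by
  induction f using SymmetricAlgebra.induction with
  | algebraMap r => rw [AlgHom.commutes, sub_self]; exact dvd_zero _
  | ι x => rw [polyAct_linForm]; exact h x
  | mul a b ha hb =>
    rw [map_mul, show polyAct g a * polyAct g b - a * b =
      polyAct g a * (polyAct g b - b) + b * (polyAct g a - a) by ring]
    exact dvd_add (hb.mul_left _) (ha.mul_left _)
  | add a b ha hb =>
    rw [map_add, add_sub_add_comm]
    exact dvd_add ha hb

/-- The coefficients of the orbit polynomial `∏ (X - s x)`, `s` in the inertia group, are
invariant under that group; reducing modulo `q` turns the polynomial into a power of `X - x`.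
Hence these coefficients detect whether a further element `g` acts trivially modulo `q`. -/
lemma exists_invariant_not_dvd (G : Subgroup (V ≃ₗ[F] V)) [Finite G] {q : Poly F V} (hq : Prime q)
    {g : V ≃ₗ[F] V} (hg : g ∈ G) (hgI : g ∉ inertia G q) :
    ∃ f ∈ polyInvariants (inertia G q), ¬ q ∣ f - polyAct g f := by
  classical
  have hfin : Finite (inertia G q) := Finite.of_injective _
    (Subgroup.inclusion_injective (inertia_le G q))
  have := Fintype.ofFinite (inertia G q)
  by_contra! hcon
  refine hgI ⟨hg, fun x => ?_⟩
  let P : Polynomial (Poly F V) :=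
    ∏ s : inertia G q, (Polynomial.X - Polynomial.C (polyAct (s : V ≃ₗ[F] V) x))
  have hmap (h : V ≃ₗ[F] V) : P.map (polyAct h : Poly F V →+* Poly F V) =
      ∏ s : inertia G q, (Polynomial.X - Polynomial.C (polyAct (h * (s : V ≃ₗ[F] V)) x)) := by
    simp [P, Polynomial.map_prod, polyAct_mul_apply]
  have hinv (i : ℕ) : P.coeff i ∈ polyInvariants (inertia G q) := by
    intro h hh
    have h1 : P.map (polyAct h : Poly F V →+* Poly F V) = P := by
      rw [hmap]
      exact Fintype.prod_equiv (Equiv.mulLeft (⟨h, hh⟩ : inertia G q)) _ _ fun s => rfl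
    conv_rhs => rw [← h1]
    rw [Polynomial.coeff_map]
    rfl
  have h1 : q ∣ (P - P.map (polyAct g : Poly F V →+* Poly F V)).eval (polyAct g x) := by
    rw [Polynomial.eval_eq_sum]
    refine Finset.dvd_sum fun i _ => Dvd.dvd.mul_right ?_ _
    rw [Polynomial.coeff_sub, Polynomial.coeff_map]
    exact hcon _ (hinv i)
  have h2 : (P.map (polyAct g : Poly F V →+* Poly F V)).eval (polyAct g x) = 0 := by
    rw [hmap, Polynomial.eval_prod]
    exact Finset.prod_eq_zero (Finset.mem_univ 1) (by simp)
  rw [Polynomial.eval_sub, h2, sub_zero, Polynomial.eval_prod, hq.dvd_finsetProd_iff] at h1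
  obtain ⟨s, -, hs⟩ := h1
  rw [Polynomial.eval_sub, Polynomial.eval_X, Polynomial.eval_C] at hs
  rw [← sub_add_sub_cancel _ (polyAct (s : V ≃ₗ[F] V) x)]
  exact dvd_add hs (s.2.2 x)

/-- The sum of the translates of an `I`-invariant over the cosets of `I` is `G`-invariant. -/
lemma sum_coset_mem_invariants {G I : Subgroup (V ≃ₗ[F] V)} [Fintype (G ⧸ I.subgroupOf G)] {k : ℕ}
    {η : DiffDerivation F V k} (hη : η ∈ invariants I k) :
    ∑ c : G ⧸ I.subgroupOf G, diffDerAct k (c.out : V ≃ₗ[F] V) η ∈ invariants G k := by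
  intro g hg
  rw [map_sum]
  refine Fintype.sum_equiv (MulAction.toPerm (⟨g, hg⟩ : G)) _ _ fun c => ?_
  have h1 : MulAction.toPerm (⟨g, hg⟩ : G) c = QuotientGroup.mk ((⟨g, hg⟩ : G) * c.out) := by
    conv_lhs => rw [← QuotientGroup.out_eq' c]
    rfl
  obtain ⟨h, hh⟩ := QuotientGroup.mk_out_eq_mul (I.subgroupOf G) ((⟨g, hg⟩ : G) * c.out)
  rw [h1, hh, ← diffDerAct_mul_apply]
  simp only [Subgroup.coe_mul]
  rw [diffDerAct_mul_apply k _ (h : G).1]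
  exact (congrArg _ (hη (h : G).1 h.2)).symm

/-- Up to a factor prime to `q`, the invariants of the inertia group of `q` are spanned over `S` by
invariants of the whole group. The factor comes from a combination of the functions
`c ↦ c f` on `G / I`, for invariants `f` of the inertia group `I`, that is supported on the
trivial coset. -/
lemma exists_transfer (G : Subgroup (V ≃ₗ[F] V)) [Finite G] {q : Poly F V} (hq : Prime q) (k : ℕ) :
    ∃ u : Poly F V, ¬ q ∣ u ∧ ∀ η ∈ invariants (inertia G q) k,
      u • η ∈ Submodule.span (Poly F V) (invariants G k : Set (DiffDerivation F V k)) := by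
  classical
  let I := inertia G q
  let T := G ⧸ I.subgroupOf G
  have := Fintype.ofFinite T
  have hout (g : G) : ∃ i ∈ I, ((QuotientGroup.mk g : T).out : V ≃ₗ[F] V) = g * i := by
    obtain ⟨h, hh⟩ := QuotientGroup.mk_out_eq_mul (I.subgroupOf G) g
    exact ⟨h, h.2, by rw [hh]; rfl⟩
  let φ : polyInvariants I →* (T → Poly F V) :=
    { toFun := fun f c => polyAct (c.out : V ≃ₗ[F] V) f
      map_one' := by ext; simp
      map_mul' := fun a b => by ext; simp }
  let A := Algebra.adjoin (Poly F V) (Set.range φ)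
  have hA : ∀ a ∈ A, ∀ η ∈ invariants I k, ∑ c : T, a c • diffDerAct k (c.out : V ≃ₗ[F] V) η ∈
      Submodule.span (Poly F V) (invariants G k : Set (DiffDerivation F V k)) := by
    intro a ha η hη
    rw [← Subalgebra.mem_toSubmodule, Algebra.adjoin_eq_span, ← MonoidHom.coe_mrange,
      Submonoid.closure_eq] at ha
    induction ha using Submodule.span_induction with
    | mem a ha =>
      obtain ⟨f, rfl⟩ := ha
      have := sum_coset_mem_invariants (G := G) ((invariants I k).smul_mem f hη)
      refine Submodule.subset_span ?_
      rw [SetLike.mem_coe]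
      convert! this using 2 with c
      exact (diffDerAct_smul k (c.out : V ≃ₗ[F] V) (f : Poly F V) η).symm
    | zero => simp
    | add a b _ _ ha hb =>
      simp only [Pi.add_apply, add_smul, Finset.sum_add_distrib]
      exact add_mem ha hb
    | smul r a _ ha =>
      simp only [Pi.smul_apply, smul_assoc, ← Finset.smul_sum]
      exact Submodule.smul_mem _ _ ha
  have hf : ∀ c : T, ∃ f : polyInvariants I, c ≠ QuotientGroup.mk 1 →
      ¬ q ∣ (f : Poly F V) - polyAct (c.out : V ≃ₗ[F] V) f := by
    intro c
    by_cases hc : c = QuotientGroup.mk 1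
    · exact ⟨0, fun h => absurd hc h⟩
    · have : (c.out : V ≃ₗ[F] V) ∉ I := fun h => hc (by
        rw [← QuotientGroup.out_eq' c, eq_comm, QuotientGroup.eq]
        simpa [Subgroup.mem_subgroupOf] using h)
      obtain ⟨f, hf, h⟩ := exists_invariant_not_dvd G hq c.out.2 this
      exact ⟨⟨f, hf⟩, fun _ => h⟩
  choose f hf using hf
  let a : T → Poly F V := ∏ c ∈ Finset.univ.erase (QuotientGroup.mk 1),
    (φ (f c) - algebraMap (Poly F V) _ (polyAct (c.out : V ≃ₗ[F] V) (f c)))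
  have ha : a ∈ A := prod_mem fun c _ =>
    sub_mem (Algebra.subset_adjoin ⟨_, rfl⟩) (A.algebraMap_mem _)
  obtain ⟨i, hi, hout1⟩ := hout 1
  rw [OneMemClass.coe_one, one_mul] at hout1
  have ha1 : a (QuotientGroup.mk 1) = ∏ c ∈ Finset.univ.erase (QuotientGroup.mk 1 : T),
      ((f c : Poly F V) - polyAct (c.out : V ≃ₗ[F] V) (f c)) := by
    simp only [a, Finset.prod_apply]
    refine Finset.prod_congr rfl fun c _ => ?_
    change polyAct ((QuotientGroup.mk 1 : T).out : V ≃ₗ[F] V) (f c : Poly F V) - _ = _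
    rw [hout1, (f c).2 i hi]
    rfl
  have ha0 (c : T) (hc : c ≠ QuotientGroup.mk 1) : a c = 0 := by
    simp only [a, Finset.prod_apply]
    exact Finset.prod_eq_zero (Finset.mem_erase.2 ⟨hc, Finset.mem_univ c⟩) (sub_self _)
  refine ⟨a (QuotientGroup.mk 1), ?_, fun η hη => ?_⟩
  · rw [ha1, hq.dvd_finsetProd_iff]
    rintro ⟨c, hc, h⟩
    exact hf c (Finset.ne_of_mem_erase hc) h
  · have := hA a ha η hη
    rwa [Fintype.sum_eq_single (QuotientGroup.mk 1) fun c hc => by rw [ha0 c hc, zero_smul],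
      hout1, hη i hi] at this

end Inertia

section Determinants

variable {S M ι : Type*} [CommRing S] [AddCommGroup M] [Module S M] [Fintype ι] [DecidableEq ι]

/-! ### Determinants of families in a free module -/

/-- If the `j`-th coordinates of a family are divisible by `q ^ m j`, extract this factor from the
`j`-th row of the determinant. -/
lemma pow_sum_dvd_det (b : Basis ι S M) {q : S} (m : ι → ℕ) (η : ι → M)
    (h : ∀ i j, q ^ m j ∣ b.repr (η i) j) : q ^ (∑ j, m j) ∣ b.det η := by
  choose c hc using h
  have : b.toMatrix η = Matrix.of fun j i => q ^ m j * Matrix.of (fun j i => c i j) j i := by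
    ext j i
    exact hc i j
  rw [b.det_apply, this, Matrix.det_mul_column, Finset.prod_pow_eq_pow_sum]
  exact dvd_mul_right _ _

lemma det_dvd_det_of_mem_span (b : Basis ι S M) {η B : ι → M}
    (h : ∀ i, η i ∈ Submodule.span S (Set.range B)) : b.det B ∣ b.det η := by
  simp only [Submodule.mem_span_range_iff_exists_fun] at h
  choose c hc using h
  have : b.toMatrix η = b.toMatrix B * Matrix.of fun j i => c i j := by
    ext j i
    simp [Matrix.mul_apply, Basis.toMatrix_apply, ← hc, mul_comm]
  rw [b.det_apply, b.det_apply, this, Matrix.det_mul]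
  exact dvd_mul_right _ _

lemma det_eq_det_mul_det (b b' : Basis ι S M) (η : ι → M) : b.det η = b.det b' * b'.det η := by
  rw [b.det_apply, b.det_apply, b'.det_apply, ← Matrix.det_mul, Basis.toMatrix_mul_toMatrix]

/-- Cramer's rule in a free module. -/
lemma det_smul_eq_sum (b : Basis ι S M) (B : ι → M) (η : M) :
    b.det B • η = ∑ i, b.det (Function.update B i η) • B i := by
  refine b.repr.injective (Finsupp.ext fun j => ?_)
  have h := congrFun (Matrix.mulVec_cramer (b.toMatrix B) (b.repr η)) j
  simp only [Matrix.mulVec, dotProduct, Matrix.cramer_apply, Pi.smul_apply, smul_eq_mul] at h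
  simp only [map_smul, map_sum, Finsupp.smul_apply, Finsupp.coe_finsetSum, Finset.sum_apply,
    smul_eq_mul, b.det_apply, Basis.toMatrix_update]
  rw [← h]
  exact Finset.sum_congr rfl fun i _ => mul_comm _ _

lemma linearIndependent_of_det_ne_zero [IsDomain S] (b : Basis ι S M) {B : ι → M}
    (h : b.det B ≠ 0) : LinearIndependent S B := by
  rw [Fintype.linearIndependent_iff]
  intro c hc
  have : (b.toMatrix B).mulVec c = 0 := by
    ext j
    have := congrArg (fun x => b.repr x j) hc
    simpa [Matrix.mulVec, dotProduct, Basis.toMatrix_apply, mul_comm] using this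
  exact congrFun (Matrix.eq_zero_of_mulVec_eq_zero h this)

lemma linearIndependent_fractionRing_iff [IsDomain S] (b : Basis ι S M) (B : ι → M) :
    LinearIndependent (FractionRing S) (fun i => (1 : FractionRing S) ⊗ₜ[S] B i) ↔
      b.det B ≠ 0 := by
  let K := FractionRing S
  let e := (Algebra.TensorProduct.basis K b).equivFun
  rw [← LinearMap.linearIndependent_iff e.toLinearMap e.ker]
  have : (e.toLinearMap ∘ fun i => (1 : K) ⊗ₜ[S] B i) =
      ((b.toMatrix B).map (algebraMap S K)).transpose.row := by
    ext i j
    change (Algebra.TensorProduct.basis K b).repr ((1 : K) ⊗ₜ[S] B i) j = _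
    rw [Algebra.TensorProduct.basis_repr_tmul]
    simp [Basis.toMatrix_apply]
  rw [this, Matrix.linearIndependent_rows_iff_isUnit, Matrix.isUnit_iff_isUnit_det,
    Matrix.det_transpose, isUnit_iff_ne_zero, ← RingHom.mapMatrix_apply, ← RingHom.map_det,
    b.det_apply]
  simp

end Determinants

section Global

variable {F : Type*} [Field F] {V : Type*} [AddCommGroup V] [Module F V]

lemma det_coef {k N : ℕ} (z : Basis (Fin N) F (FormVec F V k)) (B : Fin N → DiffDerivation F V k) :
    (coef z B).det = (Algebra.TensorProduct.basis (Poly F V) z).det B := by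
  rw [Basis.det_apply, ← Matrix.det_transpose]
  rfl

lemma det_coef_mem_polyDegree {k N : ℕ} (z : Basis (Fin N) F (FormVec F V k))
    (B : Fin N → DiffDerivation F V k) (deg : Fin N → ℕ)
    (h : ∀ i, IsHomogeneousOfDegree F V (deg i) (B i)) :
    (coef z B).det ∈ polyDegree F V (∑ i, deg i) := by
  have hcoef (i j) : coef z B i j ∈ polyDegree F V (deg i) := by
    obtain ⟨x, hx⟩ := h i
    rw [coef, Matrix.of_apply, ← hx]
    clear hx
    induction x with
    | zero => simp
    | tmul p w =>
      rw [TensorProduct.map_tmul, Algebra.TensorProduct.basis_repr_tmul]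
      simp only [Submodule.subtype_apply, LinearMap.id_coe, id_eq, Finsupp.smul_apply,
        Finsupp.mapRange_apply, smul_eq_mul]
      rw [mul_comm, ← Algebra.smul_def]
      exact Submodule.smul_mem _ _ p.2
    | add x y hx hy =>
      rw [map_add, map_add, Finsupp.add_apply]
      exact add_mem hx hy
  rw [Matrix.det_apply]
  refine sum_mem fun σ _ => ?_
  have : ∏ i, coef z B (σ i) i ∈ polyDegree F V (∑ i, deg i) := by
    rw [← Equiv.sum_comp σ deg]
    exact prod_mem_polyDegree _ _ _ fun i _ => hcoef _ _
  rcases Int.units_eq_one_or (Equiv.Perm.sign σ) with h | h <;> rw [h]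
  · simpa using this
  · simpa using this

/-! ### The inertia groups of the primes of `S` -/

lemma mem_pointwiseStabilizer {G : Subgroup (V ≃ₗ[F] V)} {H : Submodule F V} {g : V ≃ₗ[F] V} :
    g ∈ pointwiseStabilizer G H ↔ g ∈ G ∧ ∀ x ∈ H, g x = x := by
  rw [pointwiseStabilizer, Subgroup.mem_inf, mem_fixingSubgroup_iff]
  rfl

lemma ker_ne_zero {G : Subgroup (V ≃ₗ[F] V)} {H : Submodule F V}
    (hH : H ∈ reflectingHyperplanes G) {ξ : Dual F V} (hξ : LinearMap.ker ξ = H) : ξ ≠ 0 := by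
  rintro rfl
  obtain ⟨s, -, hs1, -, hs⟩ := hH
  rw [LinearMap.ker_zero] at hξ
  exact hs1 (LinearEquiv.ext fun v => hs v (hξ ▸ Submodule.mem_top))

lemma inertia_linForm (G : Subgroup (V ≃ₗ[F] V)) {ξ : Dual F V} :
    inertia G (linForm F V ξ) = pointwiseStabilizer G (LinearMap.ker ξ) := by
  ext g
  rw [mem_pointwiseStabilizer]
  refine and_congr_right fun hg => ⟨fun h v hv => ?_, fun h => dvd_polyAct_sub_of_linForm fun ζ => ?_⟩
  · rw [← sub_eq_zero, ← forall_dual_apply_eq_zero_iff F]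
    intro ζ
    have h1 := h (linForm F V (dualAct g⁻¹ ζ))
    rw [polyAct_linForm, ← map_sub] at h1
    obtain ⟨c, hc⟩ := eq_smul_of_linForm_dvd h1
    have h2 := LinearMap.congr_fun hc v
    rw [← LinearMap.comp_apply (dualAct g), ← dualAct_mul, mul_inv_cancel, dualAct_one,
      LinearMap.smul_apply, LinearMap.mem_ker.1 hv, smul_zero, LinearMap.sub_apply,
      dualAct_apply, inv_inv, LinearMap.id_apply] at h2
    rw [map_sub, ← neg_sub, h2, neg_zero]
  · rw [← map_sub]
    have : dualAct g ζ - ζ ∈ Submodule.span F (Set.range fun _ : Unit => ξ) := by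
      refine mem_span_of_iInf_ker_le_ker fun v hv => ?_
      simp only [Submodule.mem_iInf, forall_const] at hv
      have h1 : (g⁻¹ : V ≃ₗ[F] V) v = v := by
        conv_lhs => rw [← h v hv]
        exact g.symm_apply_apply v
      rw [LinearMap.mem_ker, LinearMap.sub_apply, dualAct_apply, h1, sub_self]
    rw [Set.range_const, Submodule.mem_span_singleton] at this
    obtain ⟨c, hc⟩ := this
    rw [← hc, map_smul, Algebra.smul_def]
    exact dvd_mul_left _ _

/-- A prime of `S` that is not the linear form of a reflecting hyperplane is unramified. -/
lemma inertia_eq_bot (G : Subgroup (V ≃ₗ[F] V)) {ℓ : Submodule F V → Dual F V}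
    (hℓ : ∀ H ∈ reflectingHyperplanes G, LinearMap.ker (ℓ H) = H) {q : Poly F V} (hq : Prime q)
    (h : ∀ H ∈ reflectingHyperplanes G, ¬ Associated q (linForm F V (ℓ H))) :
    inertia G q = ⊥ := by
  rw [Subgroup.eq_bot_iff_forall]
  intro g hg
  by_contra hg1
  obtain ⟨ζ, hζ⟩ : ∃ ζ, dualAct g ζ - ζ ≠ 0 := by
    by_contra! h0
    refine hg1 (LinearEquiv.ext fun v => ?_)
    rw [← sub_eq_zero, ← forall_dual_apply_eq_zero_iff F]
    intro ξ
    have := LinearMap.congr_fun (h0 ξ) (g v)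
    rw [LinearMap.sub_apply, dualAct_apply, LinearMap.zero_apply] at this
    rw [← neg_eq_zero, map_sub, neg_sub]
    convert this using 2
    exact congrArg ξ (g.symm_apply_apply v).symm
  have h1 := hg.2 (linForm F V ζ)
  rw [polyAct_linForm, ← map_sub] at h1
  set ξ := dualAct g ζ - ζ
  have hqξ := associated_of_prime_dvd_linForm hq hζ h1
  have hg2 : g ∈ pointwiseStabilizer G (LinearMap.ker ξ) := by
    rw [← inertia_linForm]
    exact ⟨hg.1, fun f => hqξ.symm.dvd.trans (hg.2 f)⟩
  rw [mem_pointwiseStabilizer] at hg2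
  have hH : LinearMap.ker ξ ∈ reflectingHyperplanes G := by
    refine ⟨g, hg.1, hg1, ?_, hg2.2⟩
    have hs : LinearMap.range ξ = ⊤ := LinearMap.range_eq_top.2 (LinearMap.surjective hζ)
    rw [(ξ.quotKerEquivRange).finrank_eq, hs, finrank_top, finrank_self]
  refine h _ hH (hqξ.trans ?_)
  have h2 : linForm F V (ℓ (LinearMap.ker ξ)) ∣ linForm F V ξ := by
    have : ξ ∈ Submodule.span F (Set.range fun _ : Unit => ℓ (LinearMap.ker ξ)) := by
      refine mem_span_of_iInf_ker_le_ker ?_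
      simp [hℓ _ hH]
    rw [Set.range_const, Submodule.mem_span_singleton] at this
    obtain ⟨c, hc⟩ := this
    refine ⟨algebraMap F _ c, ?_⟩
    rw [← hc, map_smul, Algebra.smul_def, mul_comm, hc]
  exact (associated_of_prime_dvd_linForm (prime_linForm (ker_ne_zero hH (hℓ _ hH))) hζ h2).symm

/-- If `B` spans the invariants of `G`, its determinant is at most as divisible by the prime `q` as
the one of a spanning family for the inertia group of `q`. -/
lemma not_pow_dvd_det (G : Subgroup (V ≃ₗ[F] V)) [Finite G] {q : Poly F V} (hq : Prime q) {k N : ℕ}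
    {B : Fin N → DiffDerivation F V k}
    (hB : (invariants G k : Set (DiffDerivation F V k)) ⊆ Submodule.span (Poly F V) (Set.range B))
    (w : Basis (Fin N) F (FormVec F V k)) (m : Fin N → ℕ)
    (hw : ∀ j, (q ^ m j) ⊗ₜ[F] w j ∈ Submodule.span (Poly F V)
      (invariants (inertia G q) k : Set (DiffDerivation F V k))) :
    ¬ q ^ (∑ j, m j + 1) ∣ (Algebra.TensorProduct.basis (Poly F V) w).det B := by
  intro hdvd
  obtain ⟨u, hu, h⟩ := exists_transfer G hq k
  have h2 (x) (hx : x ∈ Submodule.span (Poly F V)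
      (invariants (inertia G q) k : Set (DiffDerivation F V k))) :
      u • x ∈ Submodule.span (Poly F V) (Set.range B) := by
    induction hx using Submodule.span_induction with
    | mem x hx => exact Submodule.span_le.2 hB (h x hx)
    | zero => simp
    | add x y _ _ hx hy => rw [smul_add]; exact add_mem hx hy
    | smul a x _ hx => rw [smul_comm]; exact Submodule.smul_mem _ _ hx
  have h3 := hdvd.trans (det_dvd_det_of_mem_span (Algebra.TensorProduct.basis (Poly F V) w)
    fun j => h2 _ (hw j))
  have h4 : (fun j => u • (q ^ m j) ⊗ₜ[F] w j) =
      fun j => (u * q ^ m j) • Algebra.TensorProduct.basis (Poly F V) w j := by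
    ext j
    rw [Algebra.TensorProduct.basis_apply, mul_smul]
    congr 1
    rw [TensorProduct.smul_tmul', smul_eq_mul, mul_one]
  rw [h4, AlternatingMap.map_smul_univ, Basis.det_self, smul_eq_mul, mul_one,
    Finset.prod_mul_distrib, Finset.prod_pow_eq_pow_sum, pow_succ, mul_comm] at h3
  rw [mul_dvd_mul_iff_right (pow_ne_zero _ hq.ne_zero)] at h3
  simp only [Finset.prod_const] at h3
  exact hu (hq.dvd_of_dvd_pow h3)

end Global

section Pairing

variable {F : Type*} [Field F] {V : Type*} [AddCommGroup V] [Module F V] {k : ℕ}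

/-! ### Evaluation of differential derivations on covectors and vectors -/

variable (F V k) in
/-- Evaluation of `k`-forms on `V` at `k` vectors. -/
def evalForm : V [⋀^Fin k]→ₗ[F] Dual F (⋀[F]^k (Dual F V)) :=
  (exteriorPower.alternatingMapToDual F (Dual F V) k).compLinearMap (Dual.eval F V)

lemma evalForm_ιMulti (u : Fin k → V) (y : Fin k → Dual F V) :
    evalForm F V k u (exteriorPower.ιMulti F k y) = (Matrix.of fun i j => y i (u j)).det := by
  rw [evalForm, AlternatingMap.compLinearMap_apply,
    exteriorPower.alternatingMapToDual_apply_ιMulti]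
  rfl

lemma evalForm_comp_map (f : Dual F V →ₗ[F] Dual F V) (g : V → V)
    (h : ∀ y v, f y v = y (g v)) (u : Fin k → V) :
    evalForm F V k u ∘ₗ exteriorPower.map k f = evalForm F V k (g ∘ u) := by
  refine exteriorPower.linearMap_ext (AlternatingMap.ext fun y => ?_)
  simp only [LinearMap.compAlternatingMap_apply, LinearMap.comp_apply,
    exteriorPower.map_apply_ιMulti, evalForm_ιMulti, Function.comp_apply, h]

/-- The `S`-linear extension to `S ⊗ ∧^k V* ⊗ V` of a linear form on `∧^k V* ⊗ V`. -/
def extendScalars (φ : FormVec F V k →ₗ[F] F) : DiffDerivation F V k →ₗ[Poly F V] Poly F V :=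
  (TensorProduct.AlgebraTensorModule.rid F (Poly F V) (Poly F V)).toLinearMap ∘ₗ
    LinearMap.baseChange (Poly F V) φ

@[simp] lemma extendScalars_tmul (φ : FormVec F V k →ₗ[F] F) (f : Poly F V)
    (w : FormVec F V k) : extendScalars φ (f ⊗ₜ w) = φ w • f := rfl

lemma extendScalars_add (φ ψ : FormVec F V k →ₗ[F] F) (η : DiffDerivation F V k) :
    extendScalars (φ + ψ) η = extendScalars φ η + extendScalars ψ η := by
  simp [extendScalars, LinearMap.baseChange_add]

lemma extendScalars_smul (c : F) (φ : FormVec F V k →ₗ[F] F) (η : DiffDerivation F V k) :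
    extendScalars (c • φ) η = c • extendScalars φ η := by
  induction η using TensorProduct.induction_on with
  | zero => simp
  | tmul p x => rw [extendScalars_tmul, extendScalars_tmul, LinearMap.smul_apply, smul_assoc]
  | add x y hx hy => rw [map_add, map_add, hx, hy, smul_add]

lemma extendScalars_sub (φ ψ : FormVec F V k →ₗ[F] F) (η : DiffDerivation F V k) :
    extendScalars (φ - ψ) η = extendScalars φ η - extendScalars ψ η := by
  rw [eq_sub_iff_add_eq, ← extendScalars_add, sub_add_cancel]

lemma basis_repr_eq_extendScalars {ι : Type*} (w : Basis ι F (FormVec F V k))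
    (η : DiffDerivation F V k) (j : ι) :
    (Algebra.TensorProduct.basis (Poly F V) w).repr η j = extendScalars (w.coord j) η := by
  induction η using TensorProduct.induction_on with
  | zero => simp
  | tmul p x =>
    rw [Algebra.TensorProduct.basis_repr_tmul, extendScalars_tmul, Algebra.smul_def, mul_comm]
    rfl
  | add x y hx hy => rw [map_add, map_add, Finsupp.add_apply, hx, hy]

/-- The linear form `ω ⊗ v ↦ ψ ω * ξ v`. -/
def tensorForm (ψ : Dual F (⋀[F]^k (Dual F V))) (ξ : Dual F V) : Dual F (FormVec F V k) :=
  TensorProduct.dualDistrib F _ _ (ψ ⊗ₜ ξ)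

@[simp] lemma tensorForm_tmul (ψ : Dual F (⋀[F]^k (Dual F V))) (ξ : Dual F V)
    (ω : ⋀[F]^k (Dual F V)) (v : V) : tensorForm ψ ξ (ω ⊗ₜ v) = ψ ω * ξ v :=
  TensorProduct.dualDistrib_apply _ _ _ _

/-- The value of a differential derivation at the linear form `ξ` and at `k` vectors, as an
alternating function of the vectors. -/
def pair (η : DiffDerivation F V k) (ξ : Dual F V) : V [⋀^Fin k]→ₗ[F] Poly F V :=
  LinearMap.compAlternatingMap
    { toFun := fun ψ => extendScalars (tensorForm ψ ξ) η
      map_add' := fun a b => by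
        rw [← extendScalars_add]
        simp [tensorForm, TensorProduct.add_tmul]
      map_smul' := fun c a => by
        rw [RingHom.id_apply, ← extendScalars_smul]
        simp [tensorForm, ← TensorProduct.smul_tmul'] }
    (evalForm F V k)

lemma pair_apply (η : DiffDerivation F V k) (ξ : Dual F V) (u : Fin k → V) :
    pair η ξ u = extendScalars (tensorForm (evalForm F V k u) ξ) η := rfl

lemma pair_add (η : DiffDerivation F V k) (ξ ζ : Dual F V) (u : Fin k → V) :
    pair η (ξ + ζ) u = pair η ξ u + pair η ζ u := by
  simp only [pair_apply, ← extendScalars_add]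
  simp [tensorForm, TensorProduct.tmul_add]

lemma pair_smul (η : DiffDerivation F V k) (c : F) (ξ : Dual F V) (u : Fin k → V) :
    pair η (c • ξ) u = c • pair η ξ u := by
  simp only [pair_apply, ← extendScalars_smul]
  simp [tensorForm]

lemma polyAct_pair (g : V ≃ₗ[F] V) (η : DiffDerivation F V k) (ξ : Dual F V) (u : Fin k → V) :
    polyAct g (pair η ξ u) = pair (diffDerAct k g η) (dualAct g ξ) (g ∘ u) := by
  simp only [pair_apply]
  induction η using TensorProduct.induction_on with
  | zero => simp
  | add x y hx hy => simp only [map_add, hx, hy]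
  | tmul p w =>
    rw [diffDerAct, TensorProduct.map_tmul, extendScalars_tmul, extendScalars_tmul, map_smul]
    congr 1
    induction w using TensorProduct.induction_on with
    | zero => simp
    | add x y hx hy => simp only [map_add, hx, hy]
    | tmul ω v =>
      have h1 := LinearMap.congr_fun (evalForm_comp_map (dualAct g) (g⁻¹ : V ≃ₗ[F] V)
        (fun y v => dualAct_apply g y v) (g ∘ u)) ω
      have h2 : (g⁻¹ : V ≃ₗ[F] V) ∘ g ∘ u = u := funext fun i => g.symm_apply_apply (u i)
      rw [h2] at h1
      rw [TensorProduct.map_tmul, tensorForm_tmul, tensorForm_tmul, ← h1, dualAct_apply]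
      exact congrArg (fun x => _ * ξ x) (g.symm_apply_apply v).symm

lemma polyAct_pair_of_mem {I : Subgroup (V ≃ₗ[F] V)} {g : V ≃ₗ[F] V} (hg : g ∈ I)
    {η : DiffDerivation F V k} (hη : η ∈ invariants I k) (ξ : Dual F V) (u : Fin k → V) :
    polyAct g (pair η ξ u) = pair η (dualAct g ξ) (g ∘ u) := by
  rw [polyAct_pair, hη g hg]

end Pairing

section Bases

variable {F : Type*} [Field F] {V : Type*} [AddCommGroup V] [Module F V] {k m : ℕ}
  (v : Basis (Fin (m + 1)) F V)

/-! ### Bases of `∧^k V* ⊗ V` -/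

open Set.powersetCard in
/-- The increasing enumeration of a `k`-element set of indices. -/
abbrev enum (J : Set.powersetCard (Fin (m + 1)) k) : Fin k ↪o Fin (m + 1) := ofFinEmbEquiv.symm J

lemma exists_enum_eq {J : Set.powersetCard (Fin (m + 1)) k} {i : Fin (m + 1)} (h : i ∈ J.val) :
    ∃ p, enum J p = i :=
  (Set.powersetCard.mem_range_ofFinEmbEquiv_symm_iff_mem J i).2 h

lemma enum_mem (J : Set.powersetCard (Fin (m + 1)) k) (p : Fin k) : enum J p ∈ J.val :=
  (Set.powersetCard.mem_range_ofFinEmbEquiv_symm_iff_mem J _).1 ⟨p, rfl⟩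

variable (k) in
/-- The basis of `∧^k V* ⊗ V` given by a basis of `V` and the dual basis of `V*`. -/
def stdBasis : Basis (Set.powersetCard (Fin (m + 1)) k × Fin (m + 1)) F (FormVec F V k) :=
  (v.dualBasis.exteriorPower k).tensorProduct v

lemma stdBasis_apply (J : Set.powersetCard (Fin (m + 1)) k) (i : Fin (m + 1)) :
    stdBasis k v (J, i) = exteriorPower.ιMulti F k (v.coord ∘ enum J) ⊗ₜ v i := by
  rw [stdBasis, Basis.tensorProduct_apply, exteriorPower.coe_basis, Basis.coe_dualBasis]
  rfl

lemma stdBasis_coord (J : Set.powersetCard (Fin (m + 1)) k) (i : Fin (m + 1)) :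
    (stdBasis k v).coord (J, i) = tensorForm (evalForm F V k (v ∘ enum J)) (v.coord i) := by
  refine TensorProduct.ext' fun ω x => ?_
  rw [tensorForm_tmul, Basis.coord_apply, stdBasis, Basis.tensorProduct_repr_tmul_apply,
    exteriorPower.basis_repr_apply, smul_eq_mul, mul_comm]
  congr 1
  have : exteriorPower.ιMultiDual F k v.dualBasis J = evalForm F V k (v ∘ enum J) := by
    rw [exteriorPower.ιMultiDual, exteriorPower.pairingDual, exteriorPower.ιMulti_family,
      exteriorPower.alternatingMapLinearEquiv_apply_ιMulti, evalForm,
      AlternatingMap.compLinearMap_apply]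
    congr 1
    ext p ξ
    exact v.dualBasis_repr ξ _
  rw [this]

/-- The substitution `x_0 ↦ x_0 + x_i` in the linear forms. -/
def addCoord (i : Fin (m + 1)) : Dual F V →ₗ[F] Dual F V :=
  LinearMap.id + (Dual.eval F V (v 0)).smulRight (v.coord i)

lemma addCoord_apply (i : Fin (m + 1)) (ξ : Dual F V) :
    addCoord v i ξ = ξ + ξ (v 0) • v.coord i := rfl

lemma addCoord_coord_of_ne {i j : Fin (m + 1)} (hj : j ≠ 0) :
    addCoord v i (v.coord j) = v.coord j := by
  simp [addCoord_apply, hj.symm]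

lemma addCoord_coord_zero (i : Fin (m + 1)) :
    addCoord v i (v.coord 0) = v.coord 0 + v.coord i := by
  simp [addCoord_apply]

variable (k) in
/-- The nilpotent operator on `∧^k V* ⊗ V` that replaces `x_0 ∧ ω ⊗ v_0` by the sum of the
`x_i ∧ ω ⊗ v_i`, `i ≠ 0`, and kills the other basis vectors. -/
def shear : FormVec F V k →ₗ[F] FormVec F V k :=
  ∑ i ∈ Finset.univ.erase 0, TensorProduct.map
    (exteriorPower.map k (addCoord v i) - LinearMap.id) ((v.coord 0).smulRight (v i))

lemma shear_tmul (ω : ⋀[F]^k (Dual F V)) (x : V) : shear k v (ω ⊗ₜ x) =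
    ∑ i ∈ Finset.univ.erase 0,
      (exteriorPower.map k (addCoord v i) ω - ω) ⊗ₜ (v.coord 0 x • v i) := by
  simp only [shear, LinearMap.sum_apply, TensorProduct.map_tmul]
  rfl

lemma shear_tmul_of_coord_zero (ω : ⋀[F]^k (Dual F V)) {x : V} (hx : v.coord 0 x = 0) :
    shear k v (ω ⊗ₜ x) = 0 := by
  rw [shear_tmul]
  exact Finset.sum_eq_zero fun i _ => by rw [hx, zero_smul, TensorProduct.tmul_zero]

lemma shear_comp_shear : shear k v ∘ₗ shear k v = 0 := by
  refine TensorProduct.ext' fun ω x => ?_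
  rw [LinearMap.comp_apply, shear_tmul, map_sum]
  refine Finset.sum_eq_zero fun i hi => shear_tmul_of_coord_zero v _ ?_
  simp [(Finset.ne_of_mem_erase hi)]

/-- The unipotent automorphism `1 + R` for an endomorphism `R` of square zero. -/
def oneAddEquiv {W : Type*} [AddCommGroup W] [Module F W] (R : W →ₗ[F] W)
    (h : ∀ x, R (R x) = 0) : W ≃ₗ[F] W :=
  LinearEquiv.ofLinearMap (LinearMap.id + R) (LinearMap.id - R)
    (LinearMap.ext fun x => by
      change x - R x + R (x - R x) = x
      rw [map_sub, h, sub_zero, sub_add_cancel])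
    (LinearMap.ext fun x => by
      change x + R x - R (x + R x) = x
      rw [map_add, h, add_zero, add_sub_cancel_right])

variable (k) in
/-- The unipotent change of coordinates `1 + shear`. -/
def shearEquiv : FormVec F V k ≃ₗ[F] FormVec F V k :=
  oneAddEquiv (W := FormVec F V k) (shear k v)
    fun x => LinearMap.congr_fun (shear_comp_shear v) x

lemma shearEquiv_apply (x : FormVec F V k) : shearEquiv k v x = x + shear k v x := rfl

lemma shearEquiv_symm_apply (x : FormVec F V k) :
    (shearEquiv k v).symm x = x - shear k v x := rfl

variable (k) in
/-- The basis of `∧^k V* ⊗ V` adapted to the invariants of the pointwise stabilizer of the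
hyperplane `x_0 = 0`: in the standard basis `x_0 ∧ ω ⊗ v_0` is replaced by the product
`∑ x_i ∧ ω ⊗ v_i` of `ω` with the identity element of `V* ⊗ V`. -/
def adaptedBasis : Basis (Set.powersetCard (Fin (m + 1)) k × Fin (m + 1)) F (FormVec F V k) :=
  (stdBasis k v).map (shearEquiv k v)

lemma adaptedBasis_apply_of_ne (J : Set.powersetCard (Fin (m + 1)) k) {i : Fin (m + 1)}
    (hi : i ≠ 0) :
    adaptedBasis k v (J, i) = exteriorPower.ιMulti F k (v.coord ∘ enum J) ⊗ₜ v i := by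
  rw [adaptedBasis, Basis.map_apply, stdBasis_apply, shearEquiv_apply]
  rw [shear_tmul_of_coord_zero, add_zero]
  simp [hi]

lemma adaptedBasis_apply_zero_of_notMem (J : Set.powersetCard (Fin (m + 1)) k)
    (hJ : 0 ∉ J.val) :
    adaptedBasis k v (J, 0) = exteriorPower.ιMulti F k (v.coord ∘ enum J) ⊗ₜ v 0 := by
  rw [adaptedBasis, Basis.map_apply, stdBasis_apply, shearEquiv_apply]
  rw [shear_tmul, Finset.sum_eq_zero, add_zero]
  · intro i _
    have : addCoord v i ∘ v.coord ∘ enum J = v.coord ∘ enum J := funext fun p =>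
      addCoord_coord_of_ne v fun h => hJ (h ▸ enum_mem J p)
    rw [exteriorPower.map_apply_ιMulti, this, sub_self, TensorProduct.zero_tmul]

lemma adaptedBasis_apply_zero_of_mem (J : Set.powersetCard (Fin (m + 1)) (k + 1))
    (hJ : 0 ∈ J.val) :
    enum J 0 = 0 ∧ adaptedBasis (k + 1) v (J, 0) = ∑ i, exteriorPower.ιMulti F (k + 1)
      (Fin.cons (v.coord i) (v.coord ∘ enum J ∘ Fin.succ)) ⊗ₜ v i := by
  have h0 : enum J 0 = 0 := by
    obtain ⟨p, hp⟩ := exists_enum_eq hJ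
    have := (enum J).monotone (Fin.zero_le p)
    rw [hp] at this
    exact Fin.le_zero_iff.1 this
  have hcons (i : Fin (m + 1)) (y : Dual F V) (hy : y = v.coord 0 ∨ y = v.coord i) :
      Function.update (v.coord ∘ enum J) 0 y = Fin.cons y (v.coord ∘ enum J ∘ Fin.succ) := by
    funext p
    refine Fin.cases ?_ (fun q => ?_) p
    · simp
    · simp
  refine ⟨h0, ?_⟩
  rw [adaptedBasis, Basis.map_apply, stdBasis_apply, shearEquiv_apply]
  rw [shear_tmul, ← Finset.add_sum_erase _ _ (Finset.mem_univ (0 : Fin (m + 1)))]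
  congr 1
  · rw [← hcons 0 _ (.inl rfl)]
    have : v.coord 0 = (v.coord ∘ enum J) 0 := by simp [h0]
    rw [this, Function.update_eq_self]
  · refine Finset.sum_congr rfl fun i hi => ?_
    have h1 : addCoord v i ∘ v.coord ∘ enum J =
        Function.update (v.coord ∘ enum J) 0 (v.coord 0 + v.coord i) := by
      funext p
      by_cases hp : p = 0
      · subst hp
        simp only [Function.comp_apply, h0, Function.update_self]
        exact addCoord_coord_zero v i
      · rw [Function.update_of_ne hp]
        exact addCoord_coord_of_ne v fun h => hp ((enum J).injective (h.trans h0.symm))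
    rw [exteriorPower.map_apply_ιMulti, h1, AlternatingMap.map_update_add]
    have h2 : v.coord 0 = (v.coord ∘ enum J) 0 := by simp [h0]
    nth_rw 1 [h2]
    rw [Function.update_eq_self, add_sub_cancel_left, hcons i _ (.inr rfl)]
    simp

lemma adaptedBasis_coord (j : Set.powersetCard (Fin (m + 1)) k × Fin (m + 1))
    (x : FormVec F V k) :
    (adaptedBasis k v).coord j x = (stdBasis k v).coord j (x - shear k v x) := by
  rw [Basis.coord_apply, Basis.coord_apply, adaptedBasis, Basis.map_repr, ← shearEquiv_symm_apply]
  rfl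

lemma adaptedBasis_coord_zero (J : Set.powersetCard (Fin (m + 1)) k) :
    (adaptedBasis k v).coord (J, 0) =
      tensorForm (evalForm F V k (v ∘ enum J)) (v.coord 0) := by
  refine TensorProduct.ext' fun ω x => ?_
  rw [adaptedBasis_coord, stdBasis_coord, map_sub, shear_tmul, map_sum,
    Finset.sum_eq_zero, sub_zero]
  · intro i hi
    rw [tensorForm_tmul]
    simp [Finset.ne_of_mem_erase hi]

lemma adaptedBasis_coord_of_ne (J : Set.powersetCard (Fin (m + 1)) k) {i : Fin (m + 1)}
    (hi : i ≠ 0) :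
    (adaptedBasis k v).coord (J, i) =
      tensorForm (evalForm F V k (v ∘ enum J)) (v.coord i) -
        (tensorForm (evalForm F V k fun p => v (enum J p) + v.coord i (v (enum J p)) • v 0)
            (v.coord 0) - tensorForm (evalForm F V k (v ∘ enum J)) (v.coord 0)) := by
  refine TensorProduct.ext' fun ω x => ?_
  rw [adaptedBasis_coord, stdBasis_coord, map_sub, shear_tmul, map_sum,
    Finset.sum_eq_single i]
  · have h2 := LinearMap.congr_fun (evalForm_comp_map (addCoord v i)
      (fun x => x + v.coord i x • v 0) (fun y x => by
        simp [addCoord_apply, mul_comm]) (v ∘ enum J)) ω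
    simp only [LinearMap.sub_apply, tensorForm_tmul, map_sub]
    have h3 : v.coord i (v i) = 1 := by simp
    rw [← LinearMap.comp_apply, h2, map_smul, sub_mul, h3, smul_eq_mul, mul_one]
    rfl
  · intro j hj hji
    rw [tensorForm_tmul]
    simp [hji]
  · intro h
    exact absurd (Finset.mem_erase.2 ⟨hi, Finset.mem_univ i⟩) h

/-- The coordinates of `η` in the adapted basis, in terms of the values of `η`. -/
lemma repr_adaptedBasis (η : DiffDerivation F V k) (J : Set.powersetCard (Fin (m + 1)) k)
    (i : Fin (m + 1)) :
    (Algebra.TensorProduct.basis (Poly F V) (adaptedBasis k v)).repr η (J, i) =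
      if i = 0 then pair η (v.coord 0) (v ∘ enum J)
      else pair η (v.coord i) (v ∘ enum J) -
        (pair η (v.coord 0) (fun p => v (enum J p) + v.coord i (v (enum J p)) • v 0) -
          pair η (v.coord 0) (v ∘ enum J)) := by
  rw [basis_repr_eq_extendScalars]
  split_ifs with hi
  · rw [hi, adaptedBasis_coord_zero]
    rfl
  · rw [adaptedBasis_coord_of_ne v J hi]
    simp only [pair_apply, extendScalars_sub]

end Bases

section Frames

variable {F : Type*} [Field F] {V : Type*} [AddCommGroup V] [Module F V]

/-! ### Frames adapted to a reflecting hyperplane -/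

lemma apply_eq_add_smul {ξ : Dual F V} {g : V ≃ₗ[F] V} (hg : ∀ x, ξ x = 0 → g x = x) {y : V}
    (hy : ξ y = 1) (x : V) : g x = x + ξ x • (g y - y) := by
  have h := hg (x - ξ x • y) (by simp [hy])
  rw [map_sub, map_smul, sub_eq_iff_eq_add] at h
  rw [h, smul_sub]
  abel

lemma det_eq_apply [FiniteDimensional F V] {ξ : Dual F V} {g : V ≃ₗ[F] V}
    (hg : ∀ x, ξ x = 0 → g x = x) {y : V} (hy : ξ y = 1) :
    ((LinearEquiv.det g : Fˣ) : F) = ξ (g y) := by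
  have : g.toLinearMap = LinearMap.transvection ξ (g y - y) := LinearMap.ext fun x => by
    rw [LinearMap.transvection.apply]
    exact apply_eq_add_smul hg hy x
  rw [LinearEquiv.coe_det, this, LinearMap.transvection.det, map_sub, hy]
  ring

/-- The space spanned by the root vectors `t y - y` of the transvections `t` about the kernel of `ξ`
in a group `I` that fixes this kernel pointwise, where `ξ y = 1`. -/
def transvectionSpace (I : Subgroup (V ≃ₗ[F] V)) (ξ : Dual F V) (y : V) : Submodule F V :=
  Submodule.span F {a | ξ a = 0 ∧ ∃ t ∈ I, t y = y + a}

/-- A basis `v` of `V` adapted to a group `I` that fixes the hyperplane `H = {x_0 = 0}` pointwise,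
where `x_0` is the first dual basis vector: `v_0` is an eigenvector of an element `s` of `I`
whose eigenvalue `c` generates the group of determinants of `I`, of order `e`, and the `v_j` with
`j` in `T` span the root vectors of the transvections in `I`. -/
structure IsFrame {m : ℕ} (I : Subgroup (V ≃ₗ[F] V)) (v : Basis (Fin (m + 1)) F V)
    (T : Finset (Fin (m + 1))) (s : V ≃ₗ[F] V) (c : F) (e : ℕ) : Prop where
  fix : ∀ g ∈ I, ∀ x, v.coord 0 x = 0 → g x = x
  mem : s ∈ I
  apply_zero : s (v 0) = c • v 0
  isPrimitiveRoot : IsPrimitiveRoot c e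
  pos : 0 < e
  pow_eq_one : ∀ g ∈ I, v.coord 0 (g (v 0)) ^ e = 1
  zero_notMem : 0 ∉ T
  coord_eq_zero : ∀ g ∈ I, ∀ j ≠ 0, j ∉ T → v.coord j (g (v 0)) = 0
  mem_transvectionSpace : ∀ j ∈ T, v j ∈ transvectionSpace I (v.coord 0) (v 0)

/-- A basis of a subspace `W` of a hyperplane `H` and a vector `y` outside `H` extend to a basis
of `V` by vectors of `H`. -/
lemma exists_basis_extending [FiniteDimensional F V] {ξ : Dual F V} {y : V} (hy : ξ y = 1)
    {W : Submodule F V} (hW : W ≤ LinearMap.ker ξ) :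
    ∃ (m : ℕ) (v : Basis (Fin (m + 1)) F V) (T : Finset (Fin (m + 1))), v.coord 0 = ξ ∧ v 0 = y ∧
      0 ∉ T ∧ T.card = finrank F W ∧ (∀ j ∈ T, v j ∈ W) ∧
      ∀ j ≠ 0, j ∉ T → ∀ x ∈ W, v.coord j x = 0 := by
  set H := LinearMap.ker ξ with hH
  let W' : Submodule F H := W.comap H.subtype
  obtain ⟨C, hC⟩ := W'.exists_isCompl
  let bW := finBasis F W'
  let bC := finBasis F C
  let bH : Basis (Fin (finrank F W' + finrank F C)) F H :=
    ((bW.prod bC).map (Submodule.prodEquivOfIsCompl _ _ hC)).reindex finSumFinEquiv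
  have h1 : ∀ (c : F), ∀ x ∈ H, c • y + x = 0 → c = 0 := fun c x hx h => by
    have := congrArg ξ h
    rwa [map_add, map_smul, hy, LinearMap.mem_ker.1 hx, map_zero, add_zero, smul_eq_mul,
      mul_one] at this
  have h2 : ∀ z : V, ∃ c : F, z + c • y ∈ H := fun z => ⟨-ξ z, by simp [hH, hy]⟩
  let v := Basis.mkFinCons y bH h1 h2
  have hv0 : v 0 = y := by simp [v]
  have hvs (i) : v (Fin.succ i) = bH i := by simp [v]
  have hvl (i) : v (Fin.succ (Fin.castAdd _ i)) = (bW i : H) := by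
    rw [hvs]
    simp [bH]
  have hvr (i) : v (Fin.succ (Fin.natAdd _ i)) = (bC i : H) := by
    rw [hvs]
    simp [bH]
  let f : Fin (finrank F W') → Fin (finrank F W' + finrank F C + 1) :=
    fun i => Fin.succ (Fin.castAdd _ i)
  have hf : Function.Injective f := fun i j h =>
    Fin.castAdd_injective _ _ (Fin.succ_injective _ h)
  refine ⟨_, v, Finset.univ.image f, ?_, hv0, ?_, ?_, ?_, ?_⟩
  · refine v.ext fun j => ?_
    refine Fin.cases ?_ (fun i => ?_) j
    · rw [hv0, hy, ← hv0]
      simp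
    · rw [hvs, LinearMap.mem_ker.1 (bH i).2, ← hvs]
      simp
  · simp only [Finset.mem_image, not_exists, not_and]
    exact fun i _ => Fin.succ_ne_zero _
  · rw [Finset.card_image_of_injective _ hf, Finset.card_univ, Fintype.card_fin]
    exact (Submodule.comapSubtypeEquivOfLe hW).finrank_eq
  · simp only [Finset.mem_image]
    rintro j ⟨i, -, rfl⟩
    rw [hvl]
    exact (bW i).2
  · intro j hj hjT x hx
    have hx' : x ∈ Submodule.span F (Set.range fun i => v (f i)) := by
      have h3 : (⟨⟨x, hW hx⟩, hx⟩ : W') ∈ Submodule.span F (Set.range bW) := by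
        rw [bW.span_eq]
        trivial
      have h4 := Submodule.mem_map_of_mem (f := H.subtype ∘ₗ W'.subtype) h3
      rw [Submodule.map_span, ← Set.range_comp] at h4
      have h5 : (fun i => v (f i)) = ⇑(H.subtype ∘ₗ W'.subtype) ∘ bW := funext fun i => hvl i
      rw [h5]
      exact h4
    have h6 : Submodule.span F (Set.range fun i => v (f i)) ≤ LinearMap.ker (v.coord j) := by
      rw [Submodule.span_le]
      rintro _ ⟨i, rfl⟩
      have : f i ≠ j := fun h => hjT (Finset.mem_image.2 ⟨i, Finset.mem_univ _, h⟩)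
      simp [this]
    exact h6 hx'

/-- The transvection root space `rootSpace G H ⊓ H`, which involves the root vectors of all
reflections, is already spanned by the root vectors of the transvections. The hypothesis is provided
by `sub_smul_mem_transvectionSpace`. -/
lemma rootSpace_inf_eq {G : Subgroup (V ≃ₗ[F] V)} {H : Submodule F V} {ξ : Dual F V}
    (hξ : LinearMap.ker ξ = H) {y : V} (hy : ξ y = 1)
    (h : ∀ g ∈ pointwiseStabilizer G H,
      g y - ξ (g y) • y ∈ transvectionSpace (pointwiseStabilizer G H) ξ y) :
    rootSpace G H ⊓ H = transvectionSpace (pointwiseStabilizer G H) ξ y := by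
  set I := pointwiseStabilizer G H
  have hfix : ∀ g ∈ I, ∀ x, ξ x = 0 → g x = x := fun g hg x hx =>
    (mem_pointwiseStabilizer.1 hg).2 x (hξ ▸ hx)
  have hquot : finrank F (V ⧸ H) = 1 := by
    have hs : Function.Surjective ξ := fun c => ⟨c • y, by simp [hy]⟩
    rw [← hξ, (ξ.quotKerEquivOfSurjective hs).finrank_eq, finrank_self]
  have hle : transvectionSpace I ξ y ≤ H := by
    rw [transvectionSpace, Submodule.span_le]
    rintro a ⟨ha, -⟩
    exact hξ ▸ ha
  refine le_antisymm ?_ (le_inf ?_ hle)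
  · have h1 : rootSpace G H ≤ Submodule.span F {y} ⊔ transvectionSpace I ξ y := by
      refine iSup₂_le fun s hs => ?_
      rintro _ ⟨x, rfl⟩
      have hsI : s ∈ I := mem_pointwiseStabilizer.2 ⟨hs.1, hs.2.2.2⟩
      have : (s.toLinearMap - LinearMap.id : V →ₗ[F] V) x =
          (ξ x * (ξ (s y) - 1)) • y + ξ x • (s y - ξ (s y) • y) := by
        change s x - x = _
        rw [apply_eq_add_smul (hfix s hsI) hy x]
        module
      rw [this]
      exact Submodule.add_mem_sup
        (Submodule.smul_mem _ _ (Submodule.mem_span_singleton_self y))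
        (Submodule.smul_mem _ _ (h s hsI))
    rintro x ⟨hx, hxH⟩
    obtain ⟨a, ha, w, hw, rfl⟩ := Submodule.mem_sup.1 (h1 hx)
    obtain ⟨r, rfl⟩ := Submodule.mem_span_singleton.1 ha
    have h2 : ξ (r • y + w) = 0 := by
      rw [← hξ] at hxH
      exact hxH
    have h3 : ξ w = 0 := by
      have := hle hw
      rw [← hξ] at this
      exact this
    rw [map_add, h3, map_smul, hy, smul_eq_mul, mul_one, add_zero] at h2
    rwa [h2, zero_smul, zero_add]
  · rw [transvectionSpace, Submodule.span_le]
    rintro a ⟨ha, t, ht, hta⟩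
    by_cases h0 : a = 0
    · rw [h0]
      exact zero_mem _
    refine Submodule.mem_iSup_of_mem t (Submodule.mem_iSup_of_mem ⟨?_, ?_, hquot, ?_⟩ ⟨y, ?_⟩)
    · exact (mem_pointwiseStabilizer.1 ht).1
    · rintro rfl
      exact h0 (by simpa using hta)
    · exact (mem_pointwiseStabilizer.1 ht).2
    · change t y - y = a
      rw [hta, add_sub_cancel_left]

/-- For a reflection `s` with `s y = c y`, the components along the hyperplane of the root vectors
are spanned by the root vectors of transvections, because of the commutators with `s`. -/
lemma sub_smul_mem_transvectionSpace {I : Subgroup (V ≃ₗ[F] V)} {ξ : Dual F V} {y : V}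
    (hy : ξ y = 1) (hfix : ∀ g ∈ I, ∀ x, ξ x = 0 → g x = x) {s : V ≃ₗ[F] V} (hs : s ∈ I) {c : F}
    (hsy : s y = c • y) (hc : c = 1 → ∀ g ∈ I, ξ (g y) = 1) {g : V ≃ₗ[F] V} (hg : g ∈ I) :
    g y - ξ (g y) • y ∈ transvectionSpace I ξ y := by
  set l := ξ (g y) with hl
  set h := g y - l • y with hh
  have hξh : ξ h = 0 := by rw [hh, map_sub, map_smul, hy, smul_eq_mul, mul_one, sub_self]
  have hgy : g y = l • y + h := by rw [hh, add_sub_cancel]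
  by_cases hc1 : c = 1
  · have hl1 : l = 1 := hc hc1 g hg
    exact Submodule.subset_span ⟨hξh, g, hg, by rw [hgy, hl1, one_smul]⟩
  have hc0 : c ≠ 0 := by
    rintro rfl
    rw [zero_smul, LinearEquiv.map_eq_zero_iff] at hsy
    simp [hsy] at hy
  have hl0 : l ≠ 0 := by
    intro h0
    rw [h0, zero_smul, zero_add] at hgy
    have : y = h := g.injective (by rw [hgy, hfix g hg h hξh])
    rw [this, hξh] at hy
    exact zero_ne_one hy
  -- The commutator of `s` and `g` is a transvection with root vector proportional to `h`.
  have hinv : s⁻¹ y = c⁻¹ • y := by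
    apply s.injective
    rw [map_smul, hsy, smul_smul, inv_mul_cancel₀ hc0, one_smul]
    exact s.apply_symm_apply y
  have hginv : g⁻¹ y = l⁻¹ • (y - h) := by
    apply g.injective
    rw [map_smul, map_sub, hfix g hg h hξh, hgy, add_sub_cancel_right, smul_smul,
      inv_mul_cancel₀ hl0, one_smul]
    exact g.apply_symm_apply y
  have hsinvh : s⁻¹ h = h := hfix _ (I.inv_mem hs) h hξh
  have ht : (s * g * s⁻¹ * g⁻¹) y = y + (l⁻¹ * (c⁻¹ - 1)) • h := by
    change s (g (s⁻¹ (g⁻¹ y))) = _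
    rw [hginv, map_smul, map_sub, hinv, hsinvh, map_smul, map_sub, map_smul g, hgy,
      hfix g hg h hξh, map_smul, map_sub, map_smul, map_add, map_smul, hsy, hfix s hs h hξh]
    match_scalars <;> field_simp
    ring
  have hmem : (l⁻¹ * (c⁻¹ - 1)) • h ∈ transvectionSpace I ξ y :=
    Submodule.subset_span ⟨by rw [map_smul, hξh, smul_zero], _,
      I.mul_mem (I.mul_mem (I.mul_mem hs hg) (I.inv_mem hs)) (I.inv_mem hg), ht⟩
  refine (Submodule.smul_mem_iff _ ?_).1 hmem
  exact mul_ne_zero (inv_ne_zero hl0) (sub_ne_zero.2 fun h' => hc1 (inv_eq_one.1 h'))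

/-- Frames exist: if `G_H` contains a reflection `s` of nontrivial determinant, `v_0` is its
root vector, and otherwise `v_0` is any vector outside `H`. -/
lemma exists_frame [FiniteDimensional F V] (G : Subgroup (V ≃ₗ[F] V)) [Finite G]
    {H : Submodule F V} {ξ : Dual F V} (hξ : LinearMap.ker ξ = H) (hξ0 : ξ ≠ 0) :
    ∃ (m : ℕ) (v : Basis (Fin (m + 1)) F V) (T : Finset (Fin (m + 1))) (s : V ≃ₗ[F] V) (c : F),
      v.coord 0 = ξ ∧ T.card = bNum G H ∧
      IsFrame (pointwiseStabilizer G H) v T s c (eNum G H) := by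
  set I := pointwiseStabilizer G H with hI
  have hfix : ∀ g ∈ I, ∀ x, ξ x = 0 → g x = x := fun g hg x hx =>
    (mem_pointwiseStabilizer.1 hg).2 x (hξ ▸ hx)
  have : Finite I := Finite.of_injective (Subgroup.inclusion (inf_le_left : I ≤ G))
    (Subgroup.inclusion_injective _)
  set D : Subgroup Fˣ := I.map (LinearEquiv.det : (V ≃ₗ[F] V) →* Fˣ) with hD
  have hDfin : Finite D := by
    have : (D : Set Fˣ).Finite := by
      rw [hD, Subgroup.coe_map]
      exact (Set.toFinite (I : Set (V ≃ₗ[F] V))).image _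
    exact this.to_subtype
  have hcard : Nat.card D = eNum G H := by
    rw [eNum, transvectionSubgroup, inf_comm, Subgroup.inf_relIndex_right, Subgroup.relIndex_ker]
  -- A finite subgroup of the multiplicative group of a field is cyclic.
  obtain ⟨d, hd⟩ := IsCyclic.exists_generator (α := D)
  obtain ⟨s, hs, hsd⟩ := Subgroup.mem_map.1 d.2
  have hord : orderOf ((d : Fˣ) : F) = eNum G H := by
    rw [orderOf_units, Subgroup.orderOf_coe, orderOf_eq_card_of_forall_mem_zpowers hd, hcard]
  set c : F := ((d : Fˣ) : F) with hc
  have hpow : ∀ g ∈ I, ((LinearEquiv.det g : Fˣ) : F) ^ eNum G H = 1 := fun g hg => by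
    have := pow_card_eq_one' (x := (⟨LinearEquiv.det g, Subgroup.mem_map_of_mem _ hg⟩ : D))
    rw [hcard] at this
    have h := congrArg (fun x : D => ((x : Fˣ) : F)) this
    simpa using h
  obtain ⟨y₀, hy₀⟩ : ∃ y, ξ y = 1 := by
    obtain ⟨y, hy⟩ := DFunLike.ne_iff.1 hξ0
    exact ⟨(ξ y)⁻¹ • y, by rw [map_smul, smul_eq_mul, inv_mul_cancel₀ hy]⟩
  have hcs : ∀ y, ξ y = 1 → ξ (s y) = c := fun y hy => by
    rw [← det_eq_apply (hfix s hs) hy, hsd]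
  obtain ⟨y, hy, hsy⟩ : ∃ y, ξ y = 1 ∧ (c ≠ 1 → s y = c • y) := by
    by_cases hc1 : c = 1
    · exact ⟨y₀, hy₀, fun h => absurd hc1 h⟩
    have h1 : ξ (s y₀ - y₀) = c - 1 := by rw [map_sub, hcs y₀ hy₀, hy₀]
    have h2 : c - 1 ≠ 0 := sub_ne_zero.2 hc1
    refine ⟨(c - 1)⁻¹ • (s y₀ - y₀), by rw [map_smul, h1, smul_eq_mul, inv_mul_cancel₀ h2],
      fun _ => ?_⟩
    rw [map_smul, apply_eq_add_smul (hfix s hs) hy₀ (s y₀ - y₀), h1, smul_comm c]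
    congr 1
    module
  have hpow' : ∀ g ∈ I, ξ (g y) ^ eNum G H = 1 := fun g hg => by
    rw [← det_eq_apply (hfix g hg) hy]
    exact hpow g hg
  have hc1 : c = 1 → ∀ g ∈ I, ξ (g y) = 1 := fun h g hg => by
    have h' := hpow' g hg
    rwa [← hord, h, orderOf_one, pow_one] at h'
  -- If `c = 1`, the identity serves as the distinguished group element.
  obtain ⟨s', hs', hsy'⟩ : ∃ s' ∈ I, s' y = c • y := by
    by_cases h : c = 1
    · exact ⟨1, I.one_mem, by rw [h, one_smul]; rfl⟩
    · exact ⟨s, hs, hsy h⟩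
  have hroot := fun g hg => sub_smul_mem_transvectionSpace hy hfix hs' hsy' hc1 (g := g) hg
  obtain ⟨m, v, T, hv0, hvy, hT0, hTc, hTW, hTx⟩ := exists_basis_extending hy
    (W := transvectionSpace I ξ y) (by
      rw [transvectionSpace, Submodule.span_le]
      exact fun a ha => ha.1)
  refine ⟨m, v, T, s', c, hv0, ?_, ?_⟩
  · rw [hTc, bNum, rootSpace_inf_eq hξ hy hroot]
  · subst hv0 hvy
    refine ⟨hfix, hs', hsy', hord ▸ IsPrimitiveRoot.orderOf c, ?_, hpow', hT0, ?_, hTW⟩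
    · rw [← hcard]
      exact Nat.card_pos
    · intro g hg j hj hjT
      have h1 := hTx j hj hjT _ (hroot g hg)
      rw [map_sub, map_smul] at h1
      simpa [hj.symm, hj] using h1

end Frames

section Divisibility

variable {F : Type*} [Field F] {V : Type*} [AddCommGroup V] [Module F V] {k : ℕ}
  {I : Subgroup (V ≃ₗ[F] V)} {ξ : Dual F V} {y : V}

/-! ### Divisibility of the values of invariant differential derivations -/

lemma exists_dual_eq_one {x : V} (hx : x ≠ 0) : ∃ ζ : Dual F V, ζ x = 1 := by
  obtain ⟨ζ, hζ⟩ := not_forall.1 fun h => hx ((forall_dual_apply_eq_zero_iff F x).1 h)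
  exact ⟨(ζ x)⁻¹ • ζ, inv_mul_cancel₀ hζ⟩

lemma dvd_polyAct_sub {g : V ≃ₗ[F] V} (hg : ∀ x, ξ x = 0 → g x = x) (f : Poly F V) :
    linForm F V ξ ∣ polyAct g f - f := by
  have : g ∈ inertia ⊤ (linForm F V ξ) := by
    rw [inertia_linForm, mem_pointwiseStabilizer]
    exact ⟨trivial, hg⟩
  exact this.2 f

lemma inv_fix {g : V ≃ₗ[F] V} (hg : ∀ x, ξ x = 0 → g x = x) (x : V) (hx : ξ x = 0) :
    (g⁻¹ : V ≃ₗ[F] V) x = x := by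
  conv_lhs => rw [← hg x hx]
  exact g.symm_apply_apply x

lemma dualAct_eq_add {g : V ≃ₗ[F] V} (hg : ∀ x, ξ x = 0 → g x = x) (hy : ξ y = 1)
    (ζ : Dual F V) : dualAct g ζ = ζ + ζ ((g⁻¹ : V ≃ₗ[F] V) y - y) • ξ := by
  ext x
  rw [dualAct_apply, apply_eq_add_smul (inv_fix hg) hy x]
  simp [mul_comm]

lemma dualAct_self {g : V ≃ₗ[F] V} (hg : ∀ x, ξ x = 0 → g x = x) (hy : ξ y = 1) :
    dualAct g ξ = ξ ((g⁻¹ : V ≃ₗ[F] V) y) • ξ := by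
  ext x
  rw [dualAct_eq_add hg hy, map_sub, hy]
  simp [sub_mul]

lemma inv_apply_of_transvection {t : V ≃ₗ[F] V} (ht : ∀ x, ξ x = 0 → t x = x) {a : V}
    (ha : ξ a = 0) (hta : t y = y + a) : (t⁻¹ : V ≃ₗ[F] V) y = y - a := by
  apply t.injective
  rw [map_sub, hta, ht a ha, add_sub_cancel_right]
  exact t.apply_symm_apply y

lemma dualAct_transvection {t : V ≃ₗ[F] V} (ht : ∀ x, ξ x = 0 → t x = x) (hy : ξ y = 1) {a : V}
    (ha : ξ a = 0) (hta : t y = y + a) (ζ : Dual F V) : dualAct t ζ = ζ + (-ζ a) • ξ := by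
  rw [dualAct_eq_add ht hy, inv_apply_of_transvection ht ha hta, sub_sub_cancel_left, map_neg]

lemma comp_update_of_fix {g : V ≃ₗ[F] V} (hg : ∀ x, ξ x = 0 → g x = x) {u : Fin k → V}
    {p : Fin k} (hu : ∀ q ≠ p, ξ (u q) = 0) (x : V) :
    g ∘ Function.update u p x = Function.update u p (g x) := by
  funext q
  by_cases hq : q = p
  · subst hq
    simp
  · simp [Function.update_of_ne hq, hg _ (hu q hq)]

/-- A nonidentity element `g` of `I` moves a suitable covector `ζ` to `ζ + ξ`. -/
lemma dvd_pair_of_fixed (hfix : ∀ g ∈ I, ∀ x, ξ x = 0 → g x = x) (hy : ξ y = 1)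
    (hI : ∃ g ∈ I, g ≠ 1) {η : DiffDerivation F V k} (hη : η ∈ invariants I k)
    {u : Fin k → V} (hu : ∀ q, ξ (u q) = 0) : linForm F V ξ ∣ pair η ξ u := by
  obtain ⟨g, hg, hg1⟩ := hI
  have ha : (g⁻¹ : V ≃ₗ[F] V) y - y ≠ 0 := fun h => hg1 (inv_eq_one.1 (LinearEquiv.ext fun x => by
    rw [apply_eq_add_smul (inv_fix (hfix g hg)) hy x, h, smul_zero, add_zero]
    rfl))
  obtain ⟨ζ, hζ⟩ := exists_dual_eq_one (F := F) ha
  have h := polyAct_pair_of_mem hg hη ζ u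
  have hgu : g ∘ u = u := funext fun q => hfix g hg _ (hu q)
  rw [hgu, dualAct_eq_add (hfix g hg) hy, hζ, one_smul, pair_add] at h
  rw [← sub_eq_iff_eq_add'.2 h]
  exact dvd_polyAct_sub (hfix g hg) _

/-- The effect of a transvection with root vector `a` on a value of an invariant. -/
lemma polyAct_pair_transvection (hfix : ∀ g ∈ I, ∀ x, ξ x = 0 → g x = x) (hy : ξ y = 1)
    {η : DiffDerivation F V k} (hη : η ∈ invariants I k) {t : V ≃ₗ[F] V} (ht : t ∈ I) {a : V}
    (ha : ξ a = 0) (hta : t y = y + a) (ζ : Dual F V) {u : Fin k → V} {p : Fin k}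
    (hu : ∀ q ≠ p, ξ (u q) = 0) :
    polyAct t (pair η ζ (Function.update u p y)) - pair η ζ (Function.update u p y) =
      pair η ζ (Function.update u p a) - ζ a • pair η ξ (Function.update u p y) -
        ζ a • pair η ξ (Function.update u p a) := by
  rw [polyAct_pair_of_mem ht hη, comp_update_of_fix (hfix t ht) hu, hta,
    dualAct_transvection (hfix t ht) hy ha hta, pair_add, pair_smul,
    AlternatingMap.map_update_add, AlternatingMap.map_update_add]
  module

/-- Modulo the linear form, the root vector `a` of a transvection may be replaced by `y` at the cost
of replacing the covector `ζ` by `ζ a • ξ`. -/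
lemma dvd_pair_sub (hfix : ∀ g ∈ I, ∀ x, ξ x = 0 → g x = x) (hy : ξ y = 1)
    (hI : ∃ g ∈ I, g ≠ 1) {η : DiffDerivation F V k} (hη : η ∈ invariants I k)
    {a : V} (ha : a ∈ transvectionSpace I ξ y) (ζ : Dual F V) {u : Fin k → V} {p : Fin k}
    (hu : ∀ q ≠ p, ξ (u q) = 0) :
    linForm F V ξ ∣
      pair η ζ (Function.update u p a) - ζ a • pair η ξ (Function.update u p y) := by
  rw [transvectionSpace] at ha
  induction ha using Submodule.span_induction with
  | mem a ha =>
    obtain ⟨ha, t, ht, hta⟩ := ha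
    rw [sub_eq_iff_eq_add.1 (polyAct_pair_transvection hfix hy hη ht ha hta ζ hu).symm]
    refine dvd_add (dvd_polyAct_sub (hfix t ht) _) (dvd_smul_of_dvd _ ?_)
    refine dvd_pair_of_fixed hfix hy hI hη fun q => ?_
    by_cases hq : q = p
    · subst hq
      rwa [Function.update_self]
    · rw [Function.update_of_ne hq, hu q hq]
  | zero => simp
  | add a b _ _ iha ihb =>
    rw [AlternatingMap.map_update_add, map_add, add_smul, add_sub_add_comm]
    exact dvd_add iha ihb
  | smul c a _ iha =>
    rw [AlternatingMap.map_update_smul, map_smul, smul_assoc, ← smul_sub]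
    exact dvd_smul_of_dvd _ iha

lemma dvd_pair_update_update (hfix : ∀ g ∈ I, ∀ x, ξ x = 0 → g x = x) (hy : ξ y = 1)
    (hI : ∃ g ∈ I, g ≠ 1) {η : DiffDerivation F V k} (hη : η ∈ invariants I k)
    {a : V} (ha : a ∈ transvectionSpace I ξ y) {u : Fin k → V} {p r : Fin k}
    (hpr : r ≠ p) (hu : ∀ q ≠ p, ξ (u q) = 0) :
    linForm F V ξ ∣ pair η ξ (Function.update (Function.update u p y) r a) := by
  have ha' := ha
  rw [transvectionSpace] at ha
  induction ha using Submodule.span_induction with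
  | mem a haS =>
    by_cases ha0 : a = 0
    · rw [ha0, AlternatingMap.map_update_zero]
      exact dvd_zero _
    -- Evaluating at `ζ` with `ζ a = 1` and inserting `a` twice kills the first term.
    obtain ⟨ζ, hζ⟩ := exists_dual_eq_one (F := F) ha0
    have h := dvd_pair_sub hfix hy hI hη ha' ζ (u := Function.update u r a) (p := p) fun q hq => by
      by_cases hqr : q = r
      · subst hqr
        rw [Function.update_self, haS.1]
      · rw [Function.update_of_ne hqr, hu q hq]
    rwa [(pair η ζ).map_eq_zero_of_eq _ (i := p) (j := r) (by
      rw [Function.update_self, Function.update_of_ne hpr, Function.update_self]) hpr.symm,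
      hζ, one_smul, zero_sub, dvd_neg, Function.update_comm hpr] at h
  | zero =>
    rw [AlternatingMap.map_update_zero]
    exact dvd_zero _
  | add a b h1 h2 iha ihb =>
    rw [AlternatingMap.map_update_add]
    exact dvd_add (iha h1) (ihb h2)
  | smul c a h1 iha =>
    rw [AlternatingMap.map_update_smul]
    exact dvd_smul_of_dvd _ (iha h1)

/-! ### Transvections modulo the square of the linear form -/

lemma polyAct_linForm_transvection {t : V ≃ₗ[F] V} (ht : ∀ x, ξ x = 0 → t x = x) (hy : ξ y = 1)
    {a : V} (ha : ξ a = 0) (hta : t y = y + a) (ζ : Dual F V) :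
    polyAct t (linForm F V ζ) - linForm F V ζ = -(ζ a • linForm F V ξ) := by
  rw [polyAct_linForm, dualAct_transvection ht hy ha hta, map_add, map_smul,
    add_sub_cancel_left, neg_smul]

lemma sq_dvd_polyAct_mul_sub {t t' : V ≃ₗ[F] V} (ht : ∀ x, ξ x = 0 → t x = x)
    (ht' : ∀ x, ξ x = 0 → t' x = x) (hy : ξ y = 1) {a : V} (ha : ξ a = 0) (hta : t y = y + a)
    (f : Poly F V) :
    linForm F V ξ ^ 2 ∣
      (polyAct (t * t') f - f) - ((polyAct t f - f) + (polyAct t' f - f)) := by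
  obtain ⟨h, hh⟩ := dvd_polyAct_sub ht' f
  have h1 : polyAct t (linForm F V ξ) = linForm F V ξ := by
    rw [← sub_eq_zero, polyAct_linForm_transvection ht hy ha hta, ha, zero_smul, neg_zero]
  have h2 : (polyAct (t * t') f - f) - ((polyAct t f - f) + (polyAct t' f - f)) =
      linForm F V ξ * (polyAct t h - h) := by
    have h3 := congrArg (polyAct t) hh
    rw [map_sub, map_mul, h1] at h3
    rw [polyAct_mul_apply, mul_sub, ← h3, ← hh]
    ring
  rw [h2, sq]
  exact mul_dvd_mul_left _ (dvd_polyAct_sub ht h)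

lemma sq_dvd_polyAct_smul_sub {t t' : V ≃ₗ[F] V} (ht : ∀ x, ξ x = 0 → t x = x)
    (ht' : ∀ x, ξ x = 0 → t' x = x) (hy : ξ y = 1) {a : V} (ha : ξ a = 0) (hta : t y = y + a)
    {c : F} (hta' : t' y = y + c • a) (f : Poly F V) :
    linForm F V ξ ^ 2 ∣ (polyAct t' f - f) - c • (polyAct t f - f) := by
  induction f using SymmetricAlgebra.induction with
  | algebraMap r => simp
  | ι x =>
    have h1 := polyAct_linForm_transvection ht hy ha hta x
    have h2 := polyAct_linForm_transvection ht' hy (a := c • a) (by simp [ha]) hta' x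
    rw [h1, h2, map_smul, smul_neg, smul_assoc, sub_self]
    exact dvd_zero _
  | mul f g hf hg =>
    have h1 : linForm F V ξ ∣ polyAct t' f - polyAct t f := by
      have := dvd_sub (dvd_polyAct_sub ht' f) (dvd_polyAct_sub ht f)
      rwa [sub_sub_sub_cancel_right] at this
    have h2 : (polyAct t' (f * g) - f * g) - c • (polyAct t (f * g) - f * g) =
        polyAct t' f * ((polyAct t' g - g) - c • (polyAct t g - g)) +
          c • ((polyAct t' f - polyAct t f) * (polyAct t g - g)) +
          g * ((polyAct t' f - f) - c • (polyAct t f - f)) := by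
      simp only [map_mul, Algebra.smul_def]
      ring
    rw [h2]
    refine dvd_add (dvd_add (hg.mul_left _) (dvd_smul_of_dvd _ ?_)) (hf.mul_left _)
    rw [sq]
    exact mul_dvd_mul h1 (dvd_polyAct_sub ht g)
  | add f g hf hg =>
    have : (polyAct t' (f + g) - (f + g)) - c • (polyAct t (f + g) - (f + g)) =
        ((polyAct t' f - f) - c • (polyAct t f - f)) +
          ((polyAct t' g - g) - c • (polyAct t g - g)) := by
      simp only [map_add]
      module
    rw [this]
    exact dvd_add hf hg

/-- Suppose that no transvection of `I` is the only one. Modulo the square of the linear form,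
`t f - f` is additive in the transvection `t` and homogeneous in its root vector `a`. By
`polyAct_pair_transvection` the quadratic function `ζ a * η(ξ; …, a, …)` of `a` then has these
two properties as well, which for two different transvections forces it to vanish. -/
lemma sq_dvd_pair (hfix : ∀ g ∈ I, ∀ x, ξ x = 0 → g x = x) (hy : ξ y = 1)
    (htwo : ∀ t ∈ I, t ≠ 1 → ξ (t y) = 1 → ∃ t' ∈ I, t' ≠ 1 ∧ t' ≠ t ∧ ξ (t' y) = 1)
    {η : DiffDerivation F V k} (hη : η ∈ invariants I k)
    {a : V} (ha : a ∈ transvectionSpace I ξ y) {u : Fin k → V} {p : Fin k}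
    (hu : ∀ q ≠ p, ξ (u q) = 0) :
    linForm F V ξ ^ 2 ∣ pair η ξ (Function.update u p a) := by
  rw [transvectionSpace] at ha
  induction ha using Submodule.span_induction with
  | zero =>
    rw [AlternatingMap.map_update_zero]
    exact dvd_zero _
  | add a b _ _ iha ihb =>
    rw [AlternatingMap.map_update_add]
    exact dvd_add iha ihb
  | smul c a _ iha =>
    rw [AlternatingMap.map_update_smul]
    exact dvd_smul_of_dvd _ iha
  | mem a haS =>
    obtain ⟨ha, t, ht, hta⟩ := haS
    by_cases ha0 : a = 0
    · rw [ha0, AlternatingMap.map_update_zero]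
      exact dvd_zero _
    have ht1 : t ≠ 1 := by
      rintro rfl
      exact ha0 (left_eq_add.1 hta)
    obtain ⟨t', ht', ht'1, htt', hty'⟩ := htwo t ht ht1 (by rw [hta, map_add, hy, ha, add_zero])
    obtain ⟨a', hta'⟩ : ∃ a', t' y = y + a' := ⟨t' y - y, by abel⟩
    have ha' : ξ a' = 0 := by
      rw [hta', map_add, hy] at hty'
      exact left_eq_add.1 hty'.symm
    have hne : ∀ {g g' : V ≃ₗ[F] V}, g ∈ I → g' ∈ I → g y = g' y → g = g' :=
      fun {g g'} hg hg' h => LinearEquiv.ext fun x => by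
        rw [apply_eq_add_smul (hfix g hg) hy, apply_eq_add_smul (hfix g' hg') hy, h]
    have ha'0 : a' ≠ 0 := by
      rintro rfl
      exact ht'1 (hne ht' I.one_mem (by rw [hta', add_zero]; rfl))
    have haa' : a' ≠ a := by
      rintro rfl
      exact htt' (hne ht' ht (by rw [hta, hta']))
    have key (ζ : Dual F V) := polyAct_pair_transvection hfix hy hη ht ha hta ζ hu
    have key' (ζ : Dual F V) := polyAct_pair_transvection hfix hy hη ht' ha' hta' ζ hu
    -- If `a' = c a`, compare the quadratic with the linear behaviour under scaling; otherwise,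
    -- polarize at a covector `ζ` with `ζ a' = 1` and `ζ a = 0`.
    by_cases hspan : a' ∈ Submodule.span F {a}
    · obtain ⟨c, rfl⟩ := Submodule.mem_span_singleton.1 hspan
      have hc0 : c ≠ 0 := fun h => ha'0 (by rw [h, zero_smul])
      have hc1 : c ≠ 1 := fun h => haa' (by rw [h, one_smul])
      obtain ⟨ζ, hζ⟩ := exists_dual_eq_one (F := F) ha0
      have h := sq_dvd_polyAct_smul_sub (hfix t ht) (hfix t' ht') hy ha hta hta'
        (pair η ζ (Function.update u p y))
      rw [key, key', AlternatingMap.map_update_smul, AlternatingMap.map_update_smul, map_smul,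
        hζ] at h
      have h' : linForm F V ξ ^ 2 ∣ (c * (1 - c)) • pair η ξ (Function.update u p a) := by
        convert h using 1
        simp only [smul_eq_mul]
        module
      have := dvd_smul_of_dvd (c * (1 - c))⁻¹ h'
      rwa [smul_smul, inv_mul_cancel₀ (mul_ne_zero hc0 (sub_ne_zero.2 hc1.symm)), one_smul] at this
    · obtain ⟨ζ, hζ⟩ : ∃ ζ : Dual F V, ζ a' = 1 ∧ ζ a = 0 := by
        obtain ⟨ζ, h1, h2⟩ := Submodule.exists_dual_map_eq_bot_of_notMem hspan inferInstance
        refine ⟨(ζ a')⁻¹ • ζ, by simp [h1], ?_⟩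
        have : ζ a ∈ (Submodule.span F {a}).map ζ :=
          Submodule.mem_map_of_mem (Submodule.mem_span_singleton_self a)
        rw [h2, Submodule.mem_bot] at this
        simp [this]
      have htt : (t * t') y = y + (a + a') := by
        change t (t' y) = _
        rw [hta', map_add, hta, hfix t ht a' ha', add_assoc]
      have h := sq_dvd_polyAct_mul_sub (hfix t ht) (hfix t' ht') hy ha hta
        (pair η ζ (Function.update u p y))
      rw [key, key', polyAct_pair_transvection hfix hy hη (I.mul_mem ht ht')
        (a := a + a') (by rw [map_add, ha, ha', add_zero]) htt ζ hu,
        AlternatingMap.map_update_add, AlternatingMap.map_update_add, map_add, hζ.1, hζ.2] at h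
      rw [← dvd_neg]
      convert h using 1
      module

/-! ### Weights -/

/-- If `f` is divisible by `ξ ^ m`, the quotient is an eigenvector of `s`; since `s` acts trivially
modulo `ξ`, the quotient is divisible by `ξ` unless its eigenvalue is one. -/
lemma pow_succ_dvd_of_weight {s : V ≃ₗ[F] V} (hs : ∀ x, ξ x = 0 → s x = x) (hξ : ξ ≠ 0) {d μ : F}
    (hd : dualAct s ξ = d • ξ) {f : Poly F V} (hf : polyAct s f = μ • f) {m : ℕ}
    (hm : linForm F V ξ ^ m ∣ f) (hμ : μ ≠ d ^ m) : linForm F V ξ ^ (m + 1) ∣ f := by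
  obtain ⟨h, rfl⟩ := hm
  rw [map_mul, map_pow, polyAct_linForm, hd, map_smul, smul_pow, smul_mul_assoc,
    ← mul_smul_comm, ← mul_smul_comm] at hf
  have h1 := mul_left_cancel₀ (pow_ne_zero m (linForm_ne_zero hξ)) hf
  have h2 : (μ - d ^ m) • h = d ^ m • (polyAct s h - h) := by
    rw [smul_sub, h1]
    module
  have h3 : linForm F V ξ ∣ h := by
    have := dvd_smul_of_dvd (μ - d ^ m)⁻¹ (h2 ▸ dvd_smul_of_dvd _ (dvd_polyAct_sub hs h))
    rwa [smul_smul, inv_mul_cancel₀ (sub_ne_zero.2 hμ), one_smul] at this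
  rw [pow_succ]
  exact mul_dvd_mul_left _ h3

end Divisibility

section FrameDivisibility

variable {F : Type*} [Field F] {V : Type*} [AddCommGroup V] [Module F V] {k m : ℕ}
  {I : Subgroup (V ≃ₗ[F] V)} {v : Basis (Fin (m + 1)) F V} {T : Finset (Fin (m + 1))}
  {s : V ≃ₗ[F] V} {c : F} {e : ℕ}

/-! ### Divisibility of the coordinates in the adapted basis -/

open Classical in
/-- The exponent of `x_0` that belongs to the member `(J, i)` of the adapted basis; `T` is the set of
indices of the transvection root vectors, and `e` and `d` stand for `e_H` and `δ_H`. -/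
def frameExponent (T : Finset (Fin (m + 1))) (e d : ℕ)
    (j : Set.powersetCard (Fin (m + 1)) k × Fin (m + 1)) : ℕ :=
  if j.2 = 0 then
    if 0 ∈ j.1.val then if Disjoint j.1.val T then 0 else e
    else if Disjoint j.1.val T then 1 else 1 + e * (1 - d)
  else if 0 ∈ j.1.val then e - 1 else if Disjoint j.1.val T then 0 else e

lemma coord_zero_ne_zero (v : Basis (Fin (m + 1)) F V) : v.coord 0 ≠ 0 := fun h => by
  have := LinearMap.congr_fun h (v 0)
  simp at this

lemma coord_zero_apply_enum (J : Set.powersetCard (Fin (m + 1)) k) {p : Fin k}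
    (h : enum J p ≠ 0) : v.coord 0 ((v ∘ enum J) p) = 0 := by
  simp [h]

lemma enum_ne {J : Set.powersetCard (Fin (m + 1)) k} {i : Fin (m + 1)} (h : i ∉ J.val)
    (p : Fin k) : enum J p ≠ i := fun h' => h (h' ▸ enum_mem J p)

lemma enum_ne_of_ne {J : Set.powersetCard (Fin (m + 1)) k} {i : Fin (m + 1)} {p q : Fin k}
    (h : enum J p = i) (hq : q ≠ p) : enum J q ≠ i := fun h' =>
  hq ((enum J).injective (h'.trans h.symm))

lemma repr_adaptedBasis_of_notMem (η : DiffDerivation F V k)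
    (J : Set.powersetCard (Fin (m + 1)) k) {i : Fin (m + 1)} (hi : i ≠ 0) (hJ : i ∉ J.val) :
    (Algebra.TensorProduct.basis (Poly F V) (adaptedBasis k v)).repr η (J, i) =
      pair η (v.coord i) (v ∘ enum J) := by
  have : (fun p => v (enum J p) + v.coord i (v (enum J p)) • v 0) = v ∘ enum J :=
    funext fun p => by simp [enum_ne hJ p]
  rw [repr_adaptedBasis, if_neg hi, this, sub_self, sub_zero]

lemma repr_adaptedBasis_of_enum_eq (η : DiffDerivation F V k)
    (J : Set.powersetCard (Fin (m + 1)) k) {i : Fin (m + 1)} (hi : i ≠ 0) {p : Fin k}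
    (hp : enum J p = i) :
    (Algebra.TensorProduct.basis (Poly F V) (adaptedBasis k v)).repr η (J, i) =
      pair η (v.coord i) (v ∘ enum J) -
        pair η (v.coord 0) (Function.update (v ∘ enum J) p (v 0)) := by
  have : (fun p => v (enum J p) + v.coord i (v (enum J p)) • v 0) =
      Function.update (v ∘ enum J) p ((v ∘ enum J) p + v 0) := by
    funext q
    by_cases hq : q = p
    · subst hq
      simp [hp]
    · simp [Function.update_of_ne hq, enum_ne_of_ne hp hq]
  rw [repr_adaptedBasis, if_neg hi, this, AlternatingMap.map_update_add, Function.update_eq_self,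
    add_sub_cancel_left]

namespace IsFrame

variable (hv : IsFrame I v T s c e)

include hv

lemma ne_zero : c ≠ 0 := hv.isPrimitiveRoot.ne_zero hv.pos.ne'

lemma inv_apply_zero : (s⁻¹ : V ≃ₗ[F] V) (v 0) = c⁻¹ • v 0 := by
  apply s.injective
  rw [map_smul, hv.apply_zero, smul_smul, inv_mul_cancel₀ hv.ne_zero, one_smul]
  exact s.apply_symm_apply _

lemma dualAct_zero : dualAct s (v.coord 0) = c⁻¹ • v.coord 0 := by
  rw [dualAct_self (hv.fix s hv.mem) (y := v 0) (by simp), hv.inv_apply_zero]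
  simp

lemma dualAct_of_ne {i : Fin (m + 1)} (hi : i ≠ 0) : dualAct s (v.coord i) = v.coord i := by
  rw [dualAct_eq_add (hv.fix s hv.mem) (y := v 0) (by simp), hv.inv_apply_zero]
  simp [hi.symm]

/-- A polynomial `f` of weight `μ` under `s` that is divisible by `x_0 ^ a` is divisible by
`x_0 ^ b` if no weight `μ c ^ r`, `a ≤ r < b`, is trivial. -/
lemma pow_dvd {f : Poly F V} {μ : F} (hf : polyAct s f = μ • f) {a b : ℕ}
    (ha : linForm F V (v.coord 0) ^ a ∣ f) (hab : a ≤ b)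
    (h : ∀ r, a ≤ r → r < b → μ * c ^ r ≠ 1) : linForm F V (v.coord 0) ^ b ∣ f := by
  induction b, hab using Nat.le_induction with
  | base => exact ha
  | succ r har ih =>
    refine pow_succ_dvd_of_weight (hv.fix s hv.mem) (coord_zero_ne_zero v) hv.dualAct_zero hf
      (ih fun r' h1 h2 => h r' h1 (by omega)) fun h' => h r har (by omega) ?_
    rw [h', inv_pow, inv_mul_cancel₀ (pow_ne_zero _ hv.ne_zero)]

variable {η : DiffDerivation F V k} (hη : η ∈ invariants I k)

include hη

lemma polyAct_pair_of_notMem {J : Set.powersetCard (Fin (m + 1)) k} (hJ : 0 ∉ J.val)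
    (ζ : Dual F V) :
    polyAct s (pair η ζ (v ∘ enum J)) = pair η (dualAct s ζ) (v ∘ enum J) := by
  rw [polyAct_pair_of_mem hv.mem hη]
  congr 1
  exact funext fun p => hv.fix s hv.mem _ (coord_zero_apply_enum J (enum_ne hJ p))

lemma polyAct_pair_update {u : Fin k → V} {p : Fin k} (hu : ∀ q ≠ p, v.coord 0 (u q) = 0)
    (ζ : Dual F V) :
    polyAct s (pair η ζ (Function.update u p (v 0))) =
      c • pair η (dualAct s ζ) (Function.update u p (v 0)) := by
  rw [polyAct_pair_of_mem hv.mem hη, comp_update_of_fix (hv.fix s hv.mem) hu, hv.apply_zero,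
    AlternatingMap.map_update_smul]

lemma polyAct_pair_of_mem {J : Set.powersetCard (Fin (m + 1)) k} (hJ : 0 ∈ J.val)
    (ζ : Dual F V) :
    polyAct s (pair η ζ (v ∘ enum J)) = c • pair η (dualAct s ζ) (v ∘ enum J) := by
  obtain ⟨p, hp⟩ := exists_enum_eq hJ
  have h : Function.update (v ∘ enum J) p (v 0) = v ∘ enum J := by
    conv_rhs => rw [← Function.update_eq_self p (v ∘ enum J)]
    simp [hp]
  rw [← h]
  exact hv.polyAct_pair_update hη
    (fun q hq => coord_zero_apply_enum J (enum_ne_of_ne hp hq)) ζ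

variable (hI : ∃ g ∈ I, g ≠ 1)

include hI

lemma dvd_repr_zero_of_notMem {d : ℕ}
    (htwo : d = 0 → ∀ t ∈ I, t ≠ 1 → v.coord 0 (t (v 0)) = 1 →
      ∃ t' ∈ I, t' ≠ 1 ∧ t' ≠ t ∧ v.coord 0 (t' (v 0)) = 1)
    {J : Set.powersetCard (Fin (m + 1)) k} (hJ : 0 ∉ J.val) :
    linForm F V (v.coord 0) ^ frameExponent T e d (J, 0) ∣ pair η (v.coord 0) (v ∘ enum J) := by
  have hy : v.coord 0 (v 0) = 1 := by simp
  have hu : ∀ q, v.coord 0 ((v ∘ enum J) q) = 0 := fun q =>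
    coord_zero_apply_enum J (enum_ne hJ q)
  have h1 : linForm F V (v.coord 0) ^ 1 ∣ pair η (v.coord 0) (v ∘ enum J) := by
    rw [pow_one]
    exact dvd_pair_of_fixed hv.fix hy hI hη hu
  rw [frameExponent, if_pos rfl, if_neg hJ]
  split_ifs with hT
  · exact h1
  by_cases hd : d = 0
  · subst hd
    obtain ⟨β, hβJ, hβT⟩ := Finset.not_disjoint_iff.1 hT
    obtain ⟨p, hp⟩ := exists_enum_eq hβJ
    have h2 := sq_dvd_pair hv.fix hy (htwo rfl) hη (hv.mem_transvectionSpace β hβT)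
      (u := v ∘ enum J) (p := p) fun q _ => hu q
    have h3 : v β = (v ∘ enum J) p := by simp [hp]
    rw [h3, Function.update_eq_self] at h2
    have hw := hv.polyAct_pair_of_notMem hη hJ (v.coord 0)
    rw [hv.dualAct_zero, pair_smul] at hw
    rw [Nat.sub_zero, mul_one]
    have he := hv.pos
    refine hv.pow_dvd hw h2 (by omega) fun r hr hre => ?_
    obtain ⟨r, rfl⟩ : ∃ r', r = r' + 1 := ⟨r - 1, by omega⟩
    rw [pow_succ', inv_mul_cancel_left₀ hv.ne_zero]
    exact hv.isPrimitiveRoot.pow_ne_one_of_pos_of_lt (by omega) (by omega)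
  · rw [show 1 + e * (1 - d) = 1 by
      rw [Nat.sub_eq_zero_of_le (by omega), mul_zero, add_zero]]
    exact h1

lemma dvd_pair_update_of_not_disjoint {u : Fin k → V} {p r : Fin k} (hpr : r ≠ p)
    (hu : ∀ q ≠ p, v.coord 0 (u q) = 0) {β : Fin (m + 1)} (hβ : β ∈ T) (hur : u r = v β) :
    linForm F V (v.coord 0) ∣ pair η (v.coord 0) (Function.update u p (v 0)) := by
  have h := dvd_pair_update_update hv.fix (y := v 0) (by simp) hI hη
    (hv.mem_transvectionSpace β hβ) hpr hu
  have h1 : v β = Function.update u p (v 0) r := by rw [Function.update_of_ne hpr, hur]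
  rwa [h1, Function.update_eq_self] at h

lemma dvd_repr_zero_of_mem {d : ℕ} {J : Set.powersetCard (Fin (m + 1)) k} (hJ : 0 ∈ J.val) :
    linForm F V (v.coord 0) ^ frameExponent T e d (J, 0) ∣ pair η (v.coord 0) (v ∘ enum J) := by
  rw [frameExponent, if_pos rfl, if_pos hJ]
  split_ifs with hT
  · rw [pow_zero]
    exact one_dvd _
  obtain ⟨β, hβJ, hβT⟩ := Finset.not_disjoint_iff.1 hT
  obtain ⟨p, hp⟩ := exists_enum_eq hJ
  obtain ⟨r, hr⟩ := exists_enum_eq hβJ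
  have hβ0 : β ≠ 0 := fun h => hv.zero_notMem (h ▸ hβT)
  have h := hv.dvd_pair_update_of_not_disjoint hη hI (u := v ∘ enum J) (p := p) (r := r)
    (fun h => hβ0 (by rw [← hr, h, hp])) (fun q hq => coord_zero_apply_enum J (enum_ne_of_ne hp hq))
    hβT (by simp [hr])
  have h1 : v 0 = (v ∘ enum J) p := by simp [hp]
  rw [h1, Function.update_eq_self, ← pow_one (linForm F V (v.coord 0))] at h
  have hw := hv.polyAct_pair_of_mem hη hJ (v.coord 0)
  rw [hv.dualAct_zero, pair_smul, smul_smul, mul_inv_cancel₀ hv.ne_zero] at hw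
  refine hv.pow_dvd hw h hv.pos fun r' h2 h3 => ?_
  rw [one_mul]
  exact hv.isPrimitiveRoot.pow_ne_one_of_pos_of_lt (by omega) h3

omit hI in
lemma dvd_repr_of_mem {J : Set.powersetCard (Fin (m + 1)) k} (hJ : 0 ∈ J.val) {i : Fin (m + 1)}
    (hi : i ≠ 0) : linForm F V (v.coord 0) ^ (e - 1) ∣
      (Algebra.TensorProduct.basis (Poly F V) (adaptedBasis k v)).repr η (J, i) := by
  have h : (Algebra.TensorProduct.basis (Poly F V) (adaptedBasis k v)).repr η (J, i) =
      pair η (v.coord i) (v ∘ enum J) := by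
    by_cases hiJ : i ∈ J.val
    -- The correction term has the argument `v 0` twice.
    · obtain ⟨p, hp⟩ := exists_enum_eq hiJ
      obtain ⟨q, hq⟩ := exists_enum_eq hJ
      have hqp : q ≠ p := fun h => hi (by rw [← hp, ← h, hq])
      rw [repr_adaptedBasis_of_enum_eq η J hi hp,
        AlternatingMap.map_eq_zero_of_eq (pair η (v.coord 0)) _ (i := p) (j := q) _ hqp.symm,
        sub_zero]
      rw [Function.update_self, Function.update_of_ne hqp, Function.comp_apply, hq]
    · exact repr_adaptedBasis_of_notMem η J hi hiJ
  have hw := hv.polyAct_pair_of_mem hη hJ (v.coord i)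
  rw [hv.dualAct_of_ne hi] at hw
  rw [h]
  refine hv.pow_dvd hw (a := 0) (by rw [pow_zero]; exact one_dvd _) (Nat.zero_le _)
    fun r _ hr => ?_
  rw [← pow_succ']
  exact hv.isPrimitiveRoot.pow_ne_one_of_pos_of_lt (by omega) (by omega)

lemma dvd_repr_of_notMem {J : Set.powersetCard (Fin (m + 1)) k} (hJ : 0 ∉ J.val)
    (hT : ¬ Disjoint J.val T) {i : Fin (m + 1)} (hi : i ≠ 0) :
    linForm F V (v.coord 0) ^ e ∣
      (Algebra.TensorProduct.basis (Poly F V) (adaptedBasis k v)).repr η (J, i) := by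
  have hy : v.coord 0 (v 0) = 1 := by simp
  have hu : ∀ q, v.coord 0 ((v ∘ enum J) q) = 0 := fun q =>
    coord_zero_apply_enum J (enum_ne hJ q)
  obtain ⟨β, hβJ, hβT⟩ := Finset.not_disjoint_iff.1 hT
  obtain ⟨r, hr⟩ := exists_enum_eq hβJ
  have h1 : ∀ p, enum J p ∈ T → linForm F V (v.coord 0) ∣ pair η (v.coord i) (v ∘ enum J) -
      v.coord i (v (enum J p)) • pair η (v.coord 0) (Function.update (v ∘ enum J) p (v 0)) :=
    fun p hp => by
      have h := dvd_pair_sub hv.fix hy hI hη (hv.mem_transvectionSpace _ hp) (v.coord i)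
        (u := v ∘ enum J) (p := p) fun q _ => hu q
      rwa [← Function.comp_apply (f := v) (g := enum J), Function.update_eq_self] at h
  have hw0 := hv.polyAct_pair_of_notMem hη hJ (v.coord i)
  rw [hv.dualAct_of_ne hi] at hw0
  have hfin : ∀ f, polyAct s f = f → linForm F V (v.coord 0) ∣ f →
      linForm F V (v.coord 0) ^ e ∣ f := fun f hf h => by
    rw [← pow_one (linForm F V (v.coord 0))] at h
    refine hv.pow_dvd (μ := 1) (by rw [hf, one_smul]) h hv.pos fun r' h2 h3 => ?_
    rw [one_mul]
    exact hv.isPrimitiveRoot.pow_ne_one_of_pos_of_lt (by omega) h3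
  by_cases hiJ : i ∈ J.val
  · obtain ⟨p, hp⟩ := exists_enum_eq hiJ
    have hw1 := hv.polyAct_pair_update hη (u := v ∘ enum J) (p := p) (fun q _ => hu q) (v.coord 0)
    rw [hv.dualAct_zero, pair_smul, smul_smul, mul_inv_cancel₀ hv.ne_zero, one_smul] at hw1
    rw [repr_adaptedBasis_of_enum_eq η J hi hp]
    refine hfin _ (by rw [map_sub, hw0, hw1]) ?_
    by_cases hiT : i ∈ T
    · have h2 := h1 p (hp ▸ hiT)
      rwa [hp, show v.coord i (v i) = 1 by simp, one_smul] at h2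
    · have hrp : r ≠ p := fun h => hiT (by rwa [← hp, ← h, hr])
      have h2 := h1 r (hr ▸ hβT)
      have h3 : v.coord i (v (enum J r)) = 0 := by
        simp [enum_ne_of_ne hp hrp]
      rw [h3, zero_smul, sub_zero] at h2
      exact dvd_sub h2 (hv.dvd_pair_update_of_not_disjoint hη hI hrp (fun q _ => hu q) hβT
        (by simp [hr]))
  · rw [repr_adaptedBasis_of_notMem η J hi hiJ]
    refine hfin _ hw0 ?_
    have h2 := h1 r (hr ▸ hβT)
    have h3 : v.coord i (v (enum J r)) = 0 := by
      simp [enum_ne hiJ r]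
    rwa [h3, zero_smul, sub_zero] at h2

/-- The coordinates of an invariant differential derivation in the adapted basis are divisible by
the powers of the linear form given by `frameExponent`. -/
lemma pow_frameExponent_dvd_repr {d : ℕ}
    (htwo : d = 0 → ∀ t ∈ I, t ≠ 1 → v.coord 0 (t (v 0)) = 1 →
      ∃ t' ∈ I, t' ≠ 1 ∧ t' ≠ t ∧ v.coord 0 (t' (v 0)) = 1)
    (j : Set.powersetCard (Fin (m + 1)) k × Fin (m + 1)) :
    linForm F V (v.coord 0) ^ frameExponent T e d j ∣
      (Algebra.TensorProduct.basis (Poly F V) (adaptedBasis k v)).repr η j := by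
  obtain ⟨J, i⟩ := j
  by_cases hi : i = 0
  · subst hi
    rw [repr_adaptedBasis, if_pos rfl]
    by_cases hJ : 0 ∈ J.val
    · exact hv.dvd_repr_zero_of_mem hη hI hJ
    · exact hv.dvd_repr_zero_of_notMem hη hI htwo hJ
  · by_cases hJ : 0 ∈ J.val
    · rw [frameExponent, if_neg hi, if_pos hJ]
      exact hv.dvd_repr_of_mem hη hJ hi
    · rw [frameExponent, if_neg hi, if_neg hJ]
      split_ifs with hT
      · rw [pow_zero]
        exact one_dvd _
      · exact hv.dvd_repr_of_notMem hη hI hJ hT hi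

end IsFrame

end FrameDivisibility

section Membership

variable {F : Type*} [Field F] {V : Type*} [AddCommGroup V] [Module F V] {k m r : ℕ}

/-! ### Invariants from equivariant alternating maps -/

/-- Adding multiples of one vector to all arguments of an alternating map has a first order effect
only. -/
lemma alternatingMap_add_smul {M N : Type*} [AddCommGroup M] [Module F M] [AddCommGroup N]
    [Module F N] (Θ : M [⋀^Fin r]→ₗ[F] N) (y : Fin r → M) (ξ : M) (c : Fin r → F) :
    Θ (fun q => y q + c q • ξ) = Θ y + ∑ q, c q • Θ (Function.update y q ξ) := by
  have key : ∀ (S : Finset (Fin r)) (y : Fin r → M),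
      Θ (fun q => if q ∈ S then y q + c q • ξ else y q) =
        Θ y + ∑ q ∈ S, c q • Θ (Function.update y q ξ) := by
    intro S
    induction S using Finset.induction_on with
    | empty => simp
    | insert a S ha ih =>
      intro y
      have h1 : (fun q => if q ∈ insert a S then y q + c q • ξ else y q) =
          Function.update (fun q => if q ∈ S then y q + c q • ξ else y q) a (y a + c a • ξ) := by
        funext q
        by_cases hq : q = a
        · subst hq
          simp
        · simp [hq]
      have h2 : Function.update (fun q => if q ∈ S then y q + c q • ξ else y q) a (y a) =
          fun q => if q ∈ S then y q + c q • ξ else y q := by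
        conv_rhs => rw [← Function.update_eq_self a (fun q => if q ∈ S then y q + c q • ξ else y q)]
        simp [ha]
      have h3 : Function.update (fun q => if q ∈ S then y q + c q • ξ else y q) a ξ =
          fun q => if q ∈ S then Function.update y a ξ q + c q • ξ
            else Function.update y a ξ q := by
        funext q
        by_cases hq : q = a
        · subst hq
          simp [ha]
        · simp [hq]
      have h4 : ∑ q ∈ S, c q • Θ (Function.update (Function.update y a ξ) q ξ) = 0 := by
        refine Finset.sum_eq_zero fun q hq => ?_
        have hqa : a ≠ q := fun h => ha (h ▸ hq)
        rw [Θ.map_eq_zero_of_eq _ (i := a) (j := q) _ hqa, smul_zero]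
        rw [Function.update_of_ne hqa, Function.update_self, Function.update_self]
      rw [h1, Θ.map_update_add, Θ.map_update_smul, h2, h3, ih, ih, h4, add_zero, Finset.sum_insert ha,
        add_assoc, add_comm (∑ q ∈ S, _)]
  simpa using key Finset.univ y

lemma alternatingMap_add_smul_of_eq {M N : Type*} [AddCommGroup M] [Module F M] [AddCommGroup N]
    [Module F N] (Θ : M [⋀^Fin r]→ₗ[F] N) {y : Fin r → M} {ξ : M} {p : Fin r} (hp : y p = ξ)
    (c : Fin r → F) : Θ (fun q => y q + c q • ξ) = (1 + c p) • Θ y := by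
  rw [alternatingMap_add_smul, Finset.sum_eq_single p, ← hp, Function.update_eq_self, add_smul,
    one_smul]
  · intro q _ hq
    rw [Θ.map_eq_zero_of_eq _ (i := p) (j := q) _ hq.symm, smul_zero]
    rw [Function.update_of_ne hq.symm, Function.update_self, hp]
  · simp

lemma smul_smul_add_sub_sum {S N : Type*} [CommRing S] [AddCommGroup N] [Module S N] [Module F N]
    (a : F) (l : S) (x : N) (Y Z : Fin r → N) :
    a • l • (x + ∑ q, Z q) - ∑ q, a • (Y q + l • Z q) = a • (l • x - ∑ q, Y q) := by
  rw [← Finset.smul_sum, Finset.sum_add_distrib, ← Finset.smul_sum, ← smul_sub, smul_add,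
    add_sub_add_right_eq_sub]

/-- The `S`-span of the invariant differential derivations. -/
abbrev invariantSpan (I : Subgroup (V ≃ₗ[F] V)) (k : ℕ) :
    Submodule (Poly F V) (DiffDerivation F V k) :=
  Submodule.span (Poly F V) (invariants I k : Set (DiffDerivation F V k))

lemma mem_invariantSpan {I : Subgroup (V ≃ₗ[F] V)} {η : DiffDerivation F V k}
    (h : ∀ g ∈ I, diffDerAct k g η = η) : η ∈ invariantSpan I k :=
  Submodule.subset_span h

namespace IsFrame

variable {I : Subgroup (V ≃ₗ[F] V)} {v : Basis (Fin (m + 1)) F V} {T : Finset (Fin (m + 1))}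
  {s : V ≃ₗ[F] V} {c : F} {e : ℕ} (hv : IsFrame I v T s c e)

include hv

lemma dualAct_eq {g : V ≃ₗ[F] V} (hg : g ∈ I) (ζ : Dual F V) :
    dualAct g ζ = ζ + ζ ((g⁻¹ : V ≃ₗ[F] V) (v 0) - v 0) • v.coord 0 :=
  dualAct_eq_add (hv.fix g hg) (by simp) ζ

lemma dualAct_coord {g : V ≃ₗ[F] V} (hg : g ∈ I) {j : Fin (m + 1)} (hj : j ≠ 0) (hjT : j ∉ T) :
    dualAct g (v.coord j) = v.coord j := by
  rw [hv.dualAct_eq hg, map_sub, hv.coord_eq_zero _ (I.inv_mem hg) j hj hjT]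
  simp [hj.symm]

/-- An element that `I` multiplies by the inverse of the determinant becomes invariant after
multiplication by `x_0 ^ (e - 1)`. -/
lemma pow_smul_mem_of_semiinvariant {Ψ : DiffDerivation F V k}
    (h : ∀ g ∈ I, diffDerAct k g Ψ = v.coord 0 ((g⁻¹ : V ≃ₗ[F] V) (v 0)) • Ψ) :
    linForm F V (v.coord 0) ^ (e - 1) • Ψ ∈ invariantSpan I k := by
  refine mem_invariantSpan fun g hg => ?_
  rw [diffDerAct_smul, h g hg, map_pow, polyAct_linForm,
    dualAct_self (hv.fix g hg) (y := v 0) (by simp), map_smul, smul_pow, smul_comm, smul_assoc,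
    smul_smul, ← pow_succ', Nat.sub_add_cancel hv.pos, hv.pow_eq_one _ (I.inv_mem hg), one_smul]

variable {Θ : Dual F V [⋀^Fin r]→ₗ[F] DiffDerivation F V k}
  (hΘ : ∀ g ∈ I, ∀ y, diffDerAct k g (Θ y) = Θ (dualAct g ∘ y))

include hΘ

omit hv in
lemma apply_mem_of_fixed {y : Fin r → Dual F V} (hy : ∀ g ∈ I, ∀ q, dualAct g (y q) = y q) :
    Θ y ∈ invariantSpan I k :=
  mem_invariantSpan fun g hg => by rw [hΘ g hg, show dualAct g ∘ y = y from funext (hy g hg)]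

lemma diffDerAct_apply_of_eq {y : Fin r → Dual F V} {p : Fin r} (hp : y p = v.coord 0)
    {g : V ≃ₗ[F] V} (hg : g ∈ I) :
    diffDerAct k g (Θ y) = v.coord 0 ((g⁻¹ : V ≃ₗ[F] V) (v 0)) • Θ y := by
  have h : dualAct g ∘ y =
      fun q => y q + y q ((g⁻¹ : V ≃ₗ[F] V) (v 0) - v 0) • v.coord 0 :=
    funext fun q => hv.dualAct_eq hg (y q)
  rw [hΘ g hg, h, alternatingMap_add_smul_of_eq Θ hp, hp, map_sub]
  simp

lemma pow_smul_mem_of_eq {y : Fin r → Dual F V} {p : Fin r} (hp : y p = v.coord 0) :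
    linForm F V (v.coord 0) ^ (e - 1) • Θ y ∈ invariantSpan I k :=
  hv.pow_smul_mem_of_semiinvariant fun _ hg => hv.diffDerAct_apply_of_eq hΘ hp hg

/-- The combination `x_0 Θ(y) - ∑ y_q Θ(…, x_0, …)` is semi-invariant, since `I` changes the `y_q`
by multiples of `x_0`. -/
lemma diffDerAct_smul_sub_sum (y : Fin r → Dual F V) {g : V ≃ₗ[F] V} (hg : g ∈ I) :
    diffDerAct k g (linForm F V (v.coord 0) • Θ y -
      ∑ q, linForm F V (y q) • Θ (Function.update y q (v.coord 0))) =
    v.coord 0 ((g⁻¹ : V ≃ₗ[F] V) (v 0)) • (linForm F V (v.coord 0) • Θ y -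
      ∑ q, linForm F V (y q) • Θ (Function.update y q (v.coord 0))) := by
  have h : dualAct g ∘ y =
      fun q => y q + y q ((g⁻¹ : V ≃ₗ[F] V) (v 0) - v 0) • v.coord 0 :=
    funext fun q => hv.dualAct_eq hg (y q)
  have h3 : ∀ q, diffDerAct k g (linForm F V (y q) • Θ (Function.update y q (v.coord 0))) =
      v.coord 0 ((g⁻¹ : V ≃ₗ[F] V) (v 0)) •
        (linForm F V (y q) • Θ (Function.update y q (v.coord 0)) +
        linForm F V (v.coord 0) • (y q ((g⁻¹ : V ≃ₗ[F] V) (v 0) - v 0) •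
          Θ (Function.update y q (v.coord 0)))) := fun q => by
    rw [diffDerAct_smul, hv.diffDerAct_apply_of_eq hΘ (p := q) (Function.update_self _ _ _) hg,
      polyAct_linForm, hv.dualAct_eq hg, map_add, map_smul, smul_comm, add_smul, smul_assoc,
      smul_comm (y q _)]
  rw [map_sub, map_sum, diffDerAct_smul, polyAct_linForm,
    dualAct_self (hv.fix g hg) (y := v 0) (by simp), map_smul, hΘ g hg, h,
    alternatingMap_add_smul, Finset.sum_congr rfl fun q _ => h3 q, smul_assoc]
  exact smul_smul_add_sub_sum _ _ _ _ _

lemma pow_smul_mem (y : Fin r → Dual F V) :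
    linForm F V (v.coord 0) ^ e • Θ y ∈ invariantSpan I k := by
  have h1 : ∀ q, linForm F V (y q) • linForm F V (v.coord 0) ^ (e - 1) •
      Θ (Function.update y q (v.coord 0)) ∈ invariantSpan I k := fun q =>
    Submodule.smul_mem _ _ (hv.pow_smul_mem_of_eq hΘ (p := q) (Function.update_self _ _ _))
  have h2 := hv.pow_smul_mem_of_semiinvariant fun g hg => hv.diffDerAct_smul_sub_sum hΘ y hg
  have h3 := (invariantSpan I k).add_mem h2 (Submodule.sum_mem _ (t := Finset.univ) fun q _ => h1 q)
  obtain ⟨e, rfl⟩ : ∃ e', e = e' + 1 := ⟨e - 1, (Nat.sub_add_cancel hv.pos).symm⟩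
  rw [smul_sub, Finset.smul_sum, Finset.sum_congr rfl fun q _ => smul_comm _ _ _, sub_add_cancel,
    smul_smul, Nat.add_sub_cancel, ← pow_succ] at h3
  exact h3

end IsFrame

end Membership

section Forms

variable {F : Type*} [Field F] {V : Type*} [AddCommGroup V] [Module F V] {k m : ℕ}

/-! ### Equivariant alternating maps with values in differential derivations -/

lemma alternatingMap_sum_apply {M N ι : Type*} [AddCommGroup M] [Module F M] [AddCommGroup N]
    [Module F N] (S : Finset ι) (Θ : ι → M [⋀^Fin k]→ₗ[F] N) (y : Fin k → M) :
    (∑ i ∈ S, Θ i) y = ∑ i ∈ S, Θ i y :=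
  map_sum (AddMonoidHom.mk' (fun f : M [⋀^Fin k]→ₗ[F] N => f y) fun _ _ => rfl) Θ S

/-- The linear map `ω ↦ f ⊗ ω ⊗ x`. -/
def tensorMap (k : ℕ) (f : Poly F V) (x : V) : ⋀[F]^k (Dual F V) →ₗ[F] DiffDerivation F V k :=
  TensorProduct.mk F (Poly F V) (FormVec F V k) f ∘ₗ (TensorProduct.mk F _ V).flip x

/-- The alternating map `y ↦ y_1 ∧ … ∧ y_k ⊗ x`. -/
def vectorForm (k : ℕ) (x : V) : Dual F V [⋀^Fin k]→ₗ[F] DiffDerivation F V k :=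
  (tensorMap k 1 x).compAlternatingMap (exteriorPower.ιMulti F k)

variable (v : Basis (Fin (m + 1)) F V)

/-- The alternating map that multiplies `y_1 ∧ … ∧ y_k` by the Euler derivation `∑ x_i ⊗ v_i`. -/
def eulerForm (k : ℕ) : Dual F V [⋀^Fin k]→ₗ[F] DiffDerivation F V k :=
  ∑ i, (tensorMap k (linForm F V (v.coord i)) (v i)).compAlternatingMap (exteriorPower.ιMulti F k)

/-- The sum of the `y_1 ∧ … ∧ x_i ∧ … ∧ y_k ⊗ v_i`, where `x_i` replaces `y_p`. -/
def insertIdentity (y : Fin k → Dual F V) (p : Fin k) : DiffDerivation F V k :=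
  ∑ i, vectorForm k (v i) (Function.update y p (v.coord i))

/-- The alternating map that multiplies `y_1 ∧ … ∧ y_k` by the identity `∑ x_i ⊗ v_i` of
`V* ⊗ V`. -/
def identityForm (k : ℕ) : Dual F V [⋀^Fin k]→ₗ[F] DiffDerivation F V (k + 1) :=
  ∑ i, (tensorMap (k + 1) 1 (v i)).compAlternatingMap
    ((exteriorPower.ιMulti F (k + 1)).curryLeft (v.coord i))

lemma vectorForm_apply (x : V) (y : Fin k → Dual F V) :
    vectorForm k x y = 1 ⊗ₜ (exteriorPower.ιMulti F k y ⊗ₜ x) := rfl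

lemma smul_vectorForm (f : Poly F V) (x : V) (y : Fin k → Dual F V) :
    f • vectorForm k x y = f ⊗ₜ (exteriorPower.ιMulti F k y ⊗ₜ x) := by
  rw [vectorForm_apply, TensorProduct.smul_tmul', smul_eq_mul, mul_one]

lemma eulerForm_apply (y : Fin k → Dual F V) :
    eulerForm v k y = ∑ i, linForm F V (v.coord i) • vectorForm k (v i) y := by
  rw [eulerForm, alternatingMap_sum_apply]
  exact Finset.sum_congr rfl fun i _ => (smul_vectorForm _ _ _).symm

lemma identityForm_apply (y : Fin k → Dual F V) :
    identityForm v k y = insertIdentity v (Fin.cons 0 y) 0 := by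
  rw [identityForm, alternatingMap_sum_apply, insertIdentity]
  refine Finset.sum_congr rfl fun i _ => ?_
  rw [Fin.update_cons_zero]
  rfl

lemma vectorForm_add (x x' : V) (y : Fin k → Dual F V) :
    vectorForm k (x + x') y = vectorForm k x y + vectorForm k x' y := by
  simp only [vectorForm_apply, TensorProduct.tmul_add]

lemma vectorForm_smul (a : F) (x : V) (y : Fin k → Dual F V) :
    vectorForm k (a • x) y = a • vectorForm k x y := by
  simp only [vectorForm_apply, TensorProduct.tmul_smul]

lemma diffDerAct_vectorForm (g : V ≃ₗ[F] V) (x : V) (y : Fin k → Dual F V) :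
    diffDerAct k g (vectorForm k x y) = vectorForm k (g x) (dualAct g ∘ y) := by
  rw [vectorForm_apply, diffDerAct_tmul, map_one]
  rfl

/-- The identity `∑ x_i ⊗ v_i` of `V* ⊗ V` is invariant under all linear automorphisms. -/
lemma sum_dualAct {X : Type*} [AddCommGroup X] [Module F X] (B : Dual F V →ₗ[F] V →ₗ[F] X)
    (g : V ≃ₗ[F] V) : ∑ i, B (dualAct g (v.coord i)) (g (v i)) = ∑ i, B (v.coord i) (v i) := by
  have h1 : ∀ i, B (dualAct g (v.coord i)) (g (v i)) =
      ∑ j, v.coord j (g (v i)) • B (dualAct g (v.coord i)) (v j) := fun i => by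
    conv_lhs => rw [← v.sum_repr (g (v i))]
    simp only [map_sum, map_smul, Basis.coord_apply]
  rw [Finset.sum_congr rfl fun i _ => h1 i, Finset.sum_comm]
  refine Finset.sum_congr rfl fun j _ => ?_
  have h2 : ∑ i, v.coord j (g (v i)) • dualAct g (v.coord i) = v.coord j := by
    refine LinearMap.ext fun x => ?_
    have h3 := congrArg (fun z => v.coord j (g z)) (v.sum_repr ((g⁻¹ : V ≃ₗ[F] V) x))
    have h4 : g ((g⁻¹ : V ≃ₗ[F] V) x) = x := g.apply_symm_apply x
    simp only [map_sum, map_smul, h4] at h3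
    rw [← h3, LinearMap.sum_apply]
    refine Finset.sum_congr rfl fun i _ => ?_
    rw [LinearMap.smul_apply, dualAct_apply, smul_eq_mul, smul_eq_mul, mul_comm]
    rfl
  conv_rhs => rw [← h2]
  rw [map_sum, LinearMap.sum_apply]
  exact Finset.sum_congr rfl fun i _ => by rw [map_smul, LinearMap.smul_apply]

lemma diffDerAct_eulerForm (g : V ≃ₗ[F] V) (y : Fin k → Dual F V) :
    diffDerAct k g (eulerForm v k y) = eulerForm v k (dualAct g ∘ y) := by
  rw [eulerForm_apply, eulerForm_apply, map_sum]
  have h := sum_dualAct v ((TensorProduct.mk F (Poly F V) (FormVec F V k)).compl₁₂ (linForm F V)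
    (TensorProduct.mk F _ V (exteriorPower.ιMulti F k (dualAct g ∘ y)))) g
  simp only [smul_vectorForm, diffDerAct_tmul, polyAct_linForm]
  exact h

lemma diffDerAct_insertIdentity (g : V ≃ₗ[F] V) (y : Fin k → Dual F V) (p : Fin k) :
    diffDerAct k g (insertIdentity v y p) = insertIdentity v (dualAct g ∘ y) p := by
  rw [insertIdentity, insertIdentity, map_sum]
  have h := sum_dualAct v (((TensorProduct.mk F _ V).compr₂
    (TensorProduct.mk F (Poly F V) (FormVec F V k) 1)) ∘ₗ
      (exteriorPower.ιMulti F k).toMultilinearMap.toLinearMap (dualAct g ∘ y) p) g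
  simp only [diffDerAct_vectorForm, Function.comp_update]
  exact h

lemma diffDerAct_identityForm (g : V ≃ₗ[F] V) (y : Fin k → Dual F V) :
    diffDerAct (k + 1) g (identityForm v k y) = identityForm v k (dualAct g ∘ y) := by
  rw [identityForm_apply, identityForm_apply, diffDerAct_insertIdentity]
  congr 1
  funext q
  refine Fin.cases ?_ (fun q => ?_) q <;> simp

end Forms

section FrameMembership

variable {F : Type*} [Field F] {V : Type*} [AddCommGroup V] [Module F V] {k m : ℕ}

/-! ### Multiples of the adapted basis in the span of the invariants -/

namespace IsFrame

variable {I : Subgroup (V ≃ₗ[F] V)} {v : Basis (Fin (m + 1)) F V} {T : Finset (Fin (m + 1))}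
  {s : V ≃ₗ[F] V} {c : F} {e : ℕ} (hv : IsFrame I v T s c e)

include hv

lemma diffDerAct_vectorForm {i : Fin (m + 1)} (hi : i ≠ 0) (g : V ≃ₗ[F] V) (hg : g ∈ I)
    (y : Fin k → Dual F V) :
    diffDerAct k g (vectorForm k (v i) y) = vectorForm k (v i) (dualAct g ∘ y) := by
  rw [DiffDer.diffDerAct_vectorForm, hv.fix g hg (v i) (by simp [hi])]

lemma dualAct_enum {J : Set.powersetCard (Fin (m + 1)) k} (hJ : 0 ∉ J.val)
    (hT : Disjoint J.val T) (g : V ≃ₗ[F] V) (hg : g ∈ I) (q : Fin k) :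
    dualAct g ((v.coord ∘ enum J) q) = (v.coord ∘ enum J) q :=
  hv.dualAct_coord hg (enum_ne hJ q) (Finset.disjoint_left.1 hT (enum_mem J q))

lemma smul_vectorForm_mem_of_ne (d : ℕ) (J : Set.powersetCard (Fin (m + 1)) k)
    {i : Fin (m + 1)} (hi : i ≠ 0) :
    linForm F V (v.coord 0) ^ frameExponent T e d (J, i) •
      vectorForm k (v i) (v.coord ∘ enum J) ∈ invariantSpan I k := by
  rw [frameExponent, if_neg hi]
  split_ifs with hJ hT
  · obtain ⟨p, hp⟩ := exists_enum_eq hJ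
    exact hv.pow_smul_mem_of_eq (hv.diffDerAct_vectorForm hi) (p := p) (by simp [hp])
  · rw [pow_zero, one_smul]
    exact apply_mem_of_fixed (hv.diffDerAct_vectorForm hi) (hv.dualAct_enum hJ hT)
  · exact hv.pow_smul_mem (hv.diffDerAct_vectorForm hi) _

lemma tmul_mem_of_mem (d : ℕ) {J : Set.powersetCard (Fin (m + 1)) k} (hJ : 0 ∈ J.val) :
    (linForm F V (v.coord 0) ^ frameExponent T e d (J, 0)) ⊗ₜ adaptedBasis k v (J, 0) ∈
      invariantSpan I k := by
  obtain ⟨p, hp⟩ := exists_enum_eq hJ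
  cases k with
  | zero => exact p.elim0
  | succ k =>
    obtain ⟨h0, hw⟩ := adaptedBasis_apply_zero_of_mem v J hJ
    have h1 : ∀ f : Poly F V, f ⊗ₜ adaptedBasis (k + 1) v (J, 0) =
        f • identityForm v k (v.coord ∘ enum J ∘ Fin.succ) := fun f => by
      rw [hw, TensorProduct.tmul_sum, identityForm_apply, insertIdentity, Finset.smul_sum]
      refine Finset.sum_congr rfl fun i _ => ?_
      rw [smul_vectorForm, Fin.update_cons_zero]
    rw [h1, frameExponent, if_pos rfl, if_pos hJ]
    split_ifs with hT
    · rw [pow_zero, one_smul]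
      refine apply_mem_of_fixed (I := I) (fun g _ => diffDerAct_identityForm v g) fun g hg q => ?_
      refine hv.dualAct_coord hg (fun h => ?_) (Finset.disjoint_left.1 hT (enum_mem J _))
      exact Fin.succ_ne_zero q ((enum J).injective (h.trans h0.symm))
    · exact hv.pow_smul_mem (fun g _ => diffDerAct_identityForm v g) _

omit hv in
/-- The product `x_0 ω ⊗ v_0` is the Euler derivation times `ω` minus the `x_i ω ⊗ v_i`, `i ≠ 0`. -/
lemma vectorForm_zero_mem_of_euler {a : ℕ} {y : Fin k → Dual F V}
    (h0 : linForm F V (v.coord 0) ^ a • eulerForm v k y ∈ invariantSpan I k)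
    (h : ∀ i ≠ 0, linForm F V (v.coord 0) ^ a • vectorForm k (v i) y ∈ invariantSpan I k) :
    linForm F V (v.coord 0) ^ (1 + a) • vectorForm k (v 0) y ∈ invariantSpan I k := by
  rw [eulerForm_apply, ← Finset.add_sum_erase _ _ (Finset.mem_univ 0), smul_add, smul_smul,
    ← pow_succ, add_comm a] at h0
  refine (Submodule.add_mem_iff_left _ ?_).1 h0
  rw [Finset.smul_sum]
  refine Submodule.sum_mem _ fun i hi => ?_
  rw [smul_comm]
  exact Submodule.smul_mem _ _ (h i (Finset.ne_of_mem_erase hi))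

lemma vectorForm_zero_mem_of_disjoint {J : Set.powersetCard (Fin (m + 1)) k}
    (hJ : 0 ∉ J.val) (hT : Disjoint J.val T) :
    linForm F V (v.coord 0) • vectorForm k (v 0) (v.coord ∘ enum J) ∈ invariantSpan I k := by
  have h := vectorForm_zero_mem_of_euler (I := I) (v := v) (a := 0) (y := v.coord ∘ enum J) (by
    rw [pow_zero, one_smul]
    exact apply_mem_of_fixed (I := I) (fun g _ => diffDerAct_eulerForm v g)
      (hv.dualAct_enum hJ hT)) fun i hi => by
    rw [pow_zero, one_smul]
    exact apply_mem_of_fixed (hv.diffDerAct_vectorForm hi) (hv.dualAct_enum hJ hT)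
  rwa [add_zero, pow_one] at h

lemma vectorForm_zero_mem (y : Fin k → Dual F V) :
    linForm F V (v.coord 0) ^ (1 + e) • vectorForm k (v 0) y ∈ invariantSpan I k :=
  vectorForm_zero_mem_of_euler (hv.pow_smul_mem (fun g _ => diffDerAct_eulerForm v g) y)
    fun _ hi => hv.pow_smul_mem (hv.diffDerAct_vectorForm hi) y

/-- When the only nonidentity element of `I` is a transvection `t`, the field has characteristic
two and `t` modifies a single coordinate `x_β`. -/
lemma of_unique_transvection {t : V ≃ₗ[F] V} (ht : t ∈ I) (ht1 : t ≠ 1)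
    (hu : ∀ g ∈ I, g = 1 ∨ g = t) (hdet : v.coord 0 (t (v 0)) = 1) {β : Fin (m + 1)}
    (hβ : β ∈ T) :
    e = 1 ∧ t * t = 1 ∧ (2 : F) = 0 ∧ ∃ a : F, a ≠ 0 ∧ t (v 0) = v 0 + a • v β := by
  obtain ⟨α, hα⟩ : ∃ α, t (v 0) = v 0 + α := ⟨t (v 0) - v 0, by abel⟩
  have hα0 : v.coord 0 α = 0 := by
    have h1 : v.coord 0 (v 0) = 1 := by simp
    rw [hα, map_add, h1] at hdet
    exact left_eq_add.1 hdet.symm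
  have hαne : α ≠ 0 := by
    rintro rfl
    refine ht1 (LinearEquiv.ext fun x => ?_)
    rw [apply_eq_add_smul (hv.fix t ht) (y := v 0) (by simp), hα]
    simp
  have htt : t * t = 1 := (hu _ (I.mul_mem ht ht)).resolve_right fun h => ht1 (by simpa using h)
  have h2 : (2 : F) = 0 := by
    have h := LinearEquiv.congr_fun htt (v 0)
    change t (t (v 0)) = v 0 at h
    rw [hα, map_add, hα, hv.fix t ht α hα0, add_assoc, add_eq_left, ← two_smul F] at h
    exact (smul_eq_zero.1 h).resolve_right hαne
  have hspan : transvectionSpace I (v.coord 0) (v 0) ≤ Submodule.span F {α} := by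
    rw [transvectionSpace, Submodule.span_le]
    rintro b ⟨-, g, hg, hgb⟩
    rcases hu g hg with rfl | rfl
    · rw [show b = 0 from left_eq_add.1 hgb]
      exact zero_mem _
    · rw [show b = α from add_left_cancel (hgb.symm.trans hα)]
      exact Submodule.mem_span_singleton_self _
  obtain ⟨b, hb⟩ := Submodule.mem_span_singleton.1 (hspan (hv.mem_transvectionSpace β hβ))
  have hb0 : b ≠ 0 := by
    rintro rfl
    rw [zero_smul] at hb
    exact v.ne_zero β hb.symm
  refine ⟨?_, htt, h2, b⁻¹, inv_ne_zero hb0, ?_⟩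
  · have hc : c = 1 := by
      have h := hv.apply_zero
      rcases hu s hv.mem with rfl | rfl
      · have := congrArg (v.coord 0) h
        simpa using this.symm
      · rw [h] at hdet
        simpa using hdet
    rw [hv.isPrimitiveRoot.eq_orderOf, hc, orderOf_one]
  · rw [hα, ← hb, smul_smul, inv_mul_cancel₀ hb0, one_smul]

end IsFrame

end FrameMembership

section UniqueTransvection

variable {F : Type*} [Field F] {V : Type*} [AddCommGroup V] [Module F V] {k m : ℕ}

/-! ### The case of a single transvection -/

lemma smul_add_smul_of_two_eq_zero {S N : Type*} [CommRing S] [Algebra F S] [AddCommGroup N]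
    [Module S N] [Module F N] [IsScalarTower F S N] (h2 : (2 : F) = 0) (x l : S) (a : F)
    (z w : N) : x • z + (x + a • l) • w = a • l • z + (x + a • l) • (w - z) := by
  have h : x • z = -(x • z) := eq_neg_of_add_eq_zero_left (by rw [← two_smul F, h2, zero_smul])
  rw [smul_sub, add_smul x (a • l) z, smul_assoc a l z]
  conv_lhs => rw [h]
  abel

namespace IsFrame

variable {I : Subgroup (V ≃ₗ[F] V)} {v : Basis (Fin (m + 1)) F V} {T : Finset (Fin (m + 1))}
  {s : V ≃ₗ[F] V} {c : F} {e : ℕ}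

lemma dualAct_coord_of_unique {t : V ≃ₗ[F] V} (ht : ∀ x, v.coord 0 x = 0 → t x = x)
    {β : Fin (m + 1)} (hβ0 : β ≠ 0) {a : F} (hta : t (v 0) = v 0 + a • v β) (j : Fin (m + 1)) :
    dualAct t (v.coord j) = v.coord j + (if j = β then -a else 0) • v.coord 0 := by
  rw [dualAct_transvection ht (y := v 0) (a := a • v β) (by simp) (by simp [hβ0]) hta]
  by_cases h : j = β
  · subst h
    simp
  · simp [h]

lemma insertIdentity_update (v : Basis (Fin (m + 1)) F V) (y : Fin k → Dual F V) (p : Fin k)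
    (ζ : Dual F V) : insertIdentity v (Function.update y p ζ) p = insertIdentity v y p := by
  simp only [insertIdentity, Function.update_idem]

/-- Let `ω = x_J` with `β ∈ J`. Modulo invariants, `x_0 ω' ⊗ v_0` equals `- ω ⊗ v_β`, where `ω'` is
`ω` without `x_β`: the product of `ω'` with the identity of `V* ⊗ V` is invariant, and so are its
remaining terms. -/
lemma vectorForm_add_mem (ht : ∀ g ∈ I, ∀ x, v.coord 0 x = 0 → g x = x) {t : V ≃ₗ[F] V}
    (hu : ∀ g ∈ I, g = 1 ∨ g = t) (htI : t ∈ I) {β : Fin (m + 1)} (hβ0 : β ≠ 0) {a : F}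
    (hta : t (v 0) = v 0 + a • v β) {J : Set.powersetCard (Fin (m + 1)) k}
    {p : Fin k} (hp : enum J p = β) :
    vectorForm k (v 0) (Function.update (v.coord ∘ enum J) p (v.coord 0)) +
      vectorForm k (v β) (v.coord ∘ enum J) ∈ invariantSpan I k := by
  have hdual := dualAct_coord_of_unique (ht t htI) hβ0 hta
  have hfix : ∀ j ≠ β, ∀ g ∈ I, dualAct g (v.coord j) = v.coord j := fun j hj g hg => by
    rcases hu g hg with rfl | rfl
    · rw [dualAct_one]
      rfl
    · rw [hdual, if_neg hj]
      simp
  have hid : insertIdentity v (v.coord ∘ enum J) p ∈ invariantSpan I k := by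
    refine mem_invariantSpan fun g hg => ?_
    have h : dualAct g ∘ v.coord ∘ enum J =
        Function.update (v.coord ∘ enum J) p (dualAct g (v.coord β)) := by
      funext q
      by_cases hq : q = p
      · subst hq
        simp [hp]
      · rw [Function.update_of_ne hq]
        exact hfix _ (enum_ne_of_ne hp hq) g hg
    rw [diffDerAct_insertIdentity, h, insertIdentity_update]
  have hrest : ∀ i ∈ (Finset.univ.erase 0).erase β,
      vectorForm k (v i) (Function.update (v.coord ∘ enum J) p (v.coord i)) ∈
        invariantSpan I k := fun i hi => by
    have hiβ := Finset.ne_of_mem_erase hi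
    have hi0 := Finset.ne_of_mem_erase (Finset.mem_of_mem_erase hi)
    refine apply_mem_of_fixed (I := I) (fun g hg y => ?_) fun g hg q => ?_
    · rw [DiffDer.diffDerAct_vectorForm, ht g hg (v i) (by simp [hi0])]
    · by_cases hq : q = p
      · subst hq
        rw [Function.update_self]
        exact hfix i hiβ g hg
      · rw [Function.update_of_ne hq]
        exact hfix _ (enum_ne_of_ne hp hq) g hg
  have hself : Function.update (v.coord ∘ enum J) p (v.coord β) = v.coord ∘ enum J := by
    conv_rhs => rw [← Function.update_eq_self p (v.coord ∘ enum J)]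
    simp [hp]
  rw [insertIdentity, ← Finset.add_sum_erase _ _ (Finset.mem_univ 0),
    ← Finset.add_sum_erase _ _ (Finset.mem_erase.2 ⟨hβ0, Finset.mem_univ β⟩), ← add_assoc,
    hself] at hid
  exact (Submodule.add_mem_iff_left _ (Submodule.sum_mem _ hrest)).1 hid

/-- In characteristic two the first order terms of `t (ω ⊗ v_0) - ω ⊗ v_0` combine to the element of
`vectorForm_add_mem`. -/
lemma diffDerAct_sub_mem (hv : IsFrame I v T s c 1) {t : V ≃ₗ[F] V}
    (hu : ∀ g ∈ I, g = 1 ∨ g = t) (htI : t ∈ I) (h2 : (2 : F) = 0) {β : Fin (m + 1)} (hβ0 : β ≠ 0)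
    {a : F} (hta : t (v 0) = v 0 + a • v β) {J : Set.powersetCard (Fin (m + 1)) k}
    {p : Fin k} (hp : enum J p = β) :
    diffDerAct k t (vectorForm k (v 0) (v.coord ∘ enum J)) -
      vectorForm k (v 0) (v.coord ∘ enum J) ∈ invariantSpan I k := by
  have hdual := dualAct_coord_of_unique (hv.fix t htI) hβ0 hta
  have h1 := vectorForm_add_mem hv.fix hu htI hβ0 hta hp
  have h3 : vectorForm k (v β) (Function.update (v.coord ∘ enum J) p (v.coord 0)) ∈
      invariantSpan I k := by
    have := hv.pow_smul_mem_of_eq (hv.diffDerAct_vectorForm hβ0)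
      (y := Function.update (v.coord ∘ enum J) p (v.coord 0)) (p := p) (Function.update_self _ _ _)
    rwa [Nat.sub_self, pow_zero, one_smul] at this
  have hty : dualAct t ∘ v.coord ∘ enum J =
      Function.update (v.coord ∘ enum J) p ((v.coord ∘ enum J) p + (-a) • v.coord 0) := by
    funext q
    by_cases hq : q = p
    · subst hq
      simp [hp, hdual]
    · rw [Function.update_of_ne hq, Function.comp_apply, Function.comp_apply, hdual,
        if_neg (enum_ne_of_ne hp hq)]
      simp
  have h4 : diffDerAct k t (vectorForm k (v 0) (v.coord ∘ enum J)) =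
      vectorForm k (v 0) (v.coord ∘ enum J) + a • vectorForm k (v β) (v.coord ∘ enum J) +
        (-a) • vectorForm k (v 0) (Function.update (v.coord ∘ enum J) p (v.coord 0)) +
        (-a * a) • vectorForm k (v β) (Function.update (v.coord ∘ enum J) p (v.coord 0)) := by
    rw [DiffDer.diffDerAct_vectorForm, hty, hta, vectorForm_add, vectorForm_smul,
      AlternatingMap.map_update_add, AlternatingMap.map_update_smul, AlternatingMap.map_update_add,
      AlternatingMap.map_update_smul, Function.update_eq_self, smul_add, smul_smul, mul_comm a]
    abel
  have hneg : -a = a := by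
    rw [neg_eq_iff_add_eq_zero, ← two_mul, h2, zero_mul]
  have h5 : diffDerAct k t (vectorForm k (v 0) (v.coord ∘ enum J)) -
      vectorForm k (v 0) (v.coord ∘ enum J) =
      a • (vectorForm k (v 0) (Function.update (v.coord ∘ enum J) p (v.coord 0)) +
        vectorForm k (v β) (v.coord ∘ enum J)) +
      (-a * a) • vectorForm k (v β) (Function.update (v.coord ∘ enum J) p (v.coord 0)) := by
    rw [h4, hneg, smul_add]
    abel
  rw [h5]
  exact Submodule.add_mem _ (Submodule.smul_of_tower_mem _ a h1)
    (Submodule.smul_of_tower_mem _ (-a * a) h3)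

/-- In the case of a unique transvection `t`, the trace of `x_β ω ⊗ v_0` over `{1, t}` yields an
invariant with a smaller exponent than the general construction. -/
lemma vectorForm_zero_mem_of_unique (hv : IsFrame I v T s c e) {t : V ≃ₗ[F] V} (htI : t ∈ I)
    (ht1 : t ≠ 1) (hu : ∀ g ∈ I, g = 1 ∨ g = t) (hdet : v.coord 0 (t (v 0)) = 1)
    {J : Set.powersetCard (Fin (m + 1)) k} (hJ : 0 ∉ J.val) (hT : ¬ Disjoint J.val T) :
    linForm F V (v.coord 0) • vectorForm k (v 0) (v.coord ∘ enum J) ∈ invariantSpan I k := by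
  obtain ⟨β, hβJ, hβT⟩ := Finset.not_disjoint_iff.1 hT
  obtain ⟨p, hp⟩ := exists_enum_eq hβJ
  have hβ0 : β ≠ 0 := fun h => hJ (h ▸ hβJ)
  obtain ⟨rfl, htt, h2, a, ha, hta⟩ := hv.of_unique_transvection htI ht1 hu hdet hβT
  have h1 := hv.diffDerAct_sub_mem hu htI h2 hβ0 hta hp
  set z := vectorForm k (v 0) (v.coord ∘ enum J)
  have htrace : linForm F V (v.coord β) • z + diffDerAct k t (linForm F V (v.coord β) • z) ∈
      invariantSpan I k := by
    refine mem_invariantSpan fun g hg => ?_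
    rcases hu g hg with rfl | rfl
    · rw [diffDerAct_one]
      rfl
    · rw [map_add, ← diffDerAct_mul_apply, htt, diffDerAct_one, add_comm]
      rfl
  have h3 : linForm F V (v.coord β) • z + diffDerAct k t (linForm F V (v.coord β) • z) =
      (-a) • linForm F V (v.coord 0) • z +
        (linForm F V (v.coord β) + (-a) • linForm F V (v.coord 0)) • (diffDerAct k t z - z) := by
    rw [diffDerAct_smul, polyAct_linForm, dualAct_coord_of_unique (hv.fix t htI) hβ0 hta,
      if_pos rfl, map_add, map_smul]
    exact smul_add_smul_of_two_eq_zero (S := Poly F V) (N := DiffDerivation F V k) h2 _ _ _ _ _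
  rw [h3] at htrace
  have h4 := (Submodule.add_mem_iff_left _ (Submodule.smul_mem _ _ h1)).1 htrace
  have h5 := Submodule.smul_of_tower_mem _ (-a)⁻¹ h4
  rwa [smul_smul, inv_mul_cancel₀ (neg_ne_zero.2 ha), one_smul] at h5

end IsFrame

end UniqueTransvection

section LocalBasis

variable {F : Type*} [Field F] {V : Type*} [AddCommGroup V] [Module F V] {k m : ℕ}

/-! ### The local structure of the invariants -/

namespace IsFrame

variable {I : Subgroup (V ≃ₗ[F] V)} {v : Basis (Fin (m + 1)) F V} {T : Finset (Fin (m + 1))}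
  {s : V ≃ₗ[F] V} {c : F} {e : ℕ}

lemma pow_frameExponent_tmul_mem (hv : IsFrame I v T s c e) {d : ℕ}
    (hone : d ≠ 0 → ∃ t ∈ I, t ≠ 1 ∧ (∀ g ∈ I, g = 1 ∨ g = t) ∧ v.coord 0 (t (v 0)) = 1)
    (j : Set.powersetCard (Fin (m + 1)) k × Fin (m + 1)) :
    (linForm F V (v.coord 0) ^ frameExponent T e d j) ⊗ₜ adaptedBasis k v j ∈
      invariantSpan I k := by
  obtain ⟨J, i⟩ := j
  by_cases hi : i = 0
  · subst hi
    by_cases hJ : 0 ∈ J.val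
    · exact hv.tmul_mem_of_mem d hJ
    · rw [adaptedBasis_apply_zero_of_notMem v J hJ, ← smul_vectorForm, frameExponent, if_pos rfl,
        if_neg hJ]
      split_ifs with hT
      · rw [pow_one]
        exact hv.vectorForm_zero_mem_of_disjoint hJ hT
      · by_cases hd : d = 0
        · rw [hd, Nat.sub_zero, mul_one]
          exact hv.vectorForm_zero_mem _
        · obtain ⟨t, ht, ht1, hu, hdet⟩ := hone hd
          rw [Nat.sub_eq_zero_of_le (by omega), mul_zero, add_zero, pow_one]
          exact hv.vectorForm_zero_mem_of_unique ht ht1 hu hdet hJ hT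
  · rw [adaptedBasis_apply_of_ne v J hi, ← smul_vectorForm]
    exact hv.smul_vectorForm_mem_of_ne d J hi

/-- A transvection is different from its conjugate by a reflection of nontrivial determinant. -/
lemma exists_conj_ne (hv : IsFrame I v T s c e) (hc : c ≠ 1) {t : V ≃ₗ[F] V} (ht : t ∈ I)
    (ht1 : t ≠ 1) (hdet : v.coord 0 (t (v 0)) = 1) :
    ∃ t' ∈ I, t' ≠ 1 ∧ t' ≠ t ∧ v.coord 0 (t' (v 0)) = 1 := by
  have h0 : v.coord 0 (v 0) = 1 := by simp
  obtain ⟨α, hα⟩ : ∃ α, t (v 0) = v 0 + α := ⟨t (v 0) - v 0, by abel⟩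
  have hα0 : v.coord 0 α = 0 := by
    rw [hα, map_add, h0] at hdet
    exact left_eq_add.1 hdet.symm
  have hconj : (s * t * s⁻¹) (v 0) = v 0 + c⁻¹ • α := by
    change s (t ((s⁻¹ : V ≃ₗ[F] V) (v 0))) = _
    rw [hv.inv_apply_zero, map_smul, hα, map_smul, map_add, hv.apply_zero, hv.fix s hv.mem α hα0,
      smul_add, smul_smul, inv_mul_cancel₀ hv.ne_zero, one_smul]
  refine ⟨s * t * s⁻¹, I.mul_mem (I.mul_mem hv.mem ht) (I.inv_mem hv.mem), ?_, ?_, ?_⟩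
  · exact fun h => ht1 (conj_eq_one_iff.1 h)
  · intro h
    rw [h, hα, add_right_inj] at hconj
    have h1 : (c⁻¹ - 1) • α = 0 := by rw [sub_smul, one_smul, ← hconj, sub_self]
    rcases smul_eq_zero.1 h1 with h1 | h1
    · exact hc (inv_eq_one.1 (sub_eq_zero.1 h1))
    · refine ht1 (LinearEquiv.ext fun x => ?_)
      rw [apply_eq_add_smul (hv.fix t ht) h0, hα, h1]
      simp
  · rw [hconj, map_add, map_smul, hα0, smul_zero, add_zero, h0]

end IsFrame

section Delta

variable [FiniteDimensional F V] {G : Subgroup (V ≃ₗ[F] V)} {H : Submodule F V}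
  {v : Basis (Fin (m + 1)) F V} {T : Finset (Fin (m + 1))} {s : V ≃ₗ[F] V} {c : F} {e : ℕ}
  (hv : IsFrame (pointwiseStabilizer G H) v T s c e)

include hv

lemma mem_transvectionSubgroup_iff {t : V ≃ₗ[F] V} (ht : t ∈ pointwiseStabilizer G H) :
    t ∈ transvectionSubgroup G H ↔ v.coord 0 (t (v 0)) = 1 := by
  rw [← det_eq_apply (hv.fix t ht) (by simp), transvectionSubgroup, Subgroup.mem_inf,
    MonoidHom.mem_ker, Units.val_eq_one]
  exact and_iff_right ht

lemma exists_unique_of_deltaNum_ne_zero (h : deltaNum G H ≠ 0) :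
    ∃ t ∈ pointwiseStabilizer G H, t ≠ 1 ∧ (∀ g ∈ pointwiseStabilizer G H, g = 1 ∨ g = t) ∧
      v.coord 0 (t (v 0)) = 1 := by
  rw [deltaNum] at h
  obtain ⟨t, ht, ht1, hI⟩ := of_not_not fun h' => h (if_neg h')
  have htI : t ∈ pointwiseStabilizer G H := inf_le_left (a := pointwiseStabilizer G H) ht
  refine ⟨t, htI, ht1, fun g hg => ?_, (mem_transvectionSubgroup_iff hv htI).1 ht⟩
  have : g ∈ (pointwiseStabilizer G H : Set (V ≃ₗ[F] V)) := hg
  rw [hI] at this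
  exact this

lemma exists_ne_of_deltaNum_eq_zero (h : deltaNum G H = 0) {t : V ≃ₗ[F] V}
    (ht : t ∈ pointwiseStabilizer G H) (ht1 : t ≠ 1) (hdet : v.coord 0 (t (v 0)) = 1) :
    ∃ t' ∈ pointwiseStabilizer G H, t' ≠ 1 ∧ t' ≠ t ∧ v.coord 0 (t' (v 0)) = 1 := by
  by_cases hc : c = 1
  · have he : e = 1 := by rw [hv.isPrimitiveRoot.eq_orderOf, hc, orderOf_one]
    by_contra hno
    rw [deltaNum, if_pos] at h
    · exact one_ne_zero h
    refine ⟨t, (mem_transvectionSubgroup_iff hv ht).2 hdet, ht1, Set.Subset.antisymm ?_ ?_⟩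
    · intro g hg
      by_contra hg'
      simp only [Set.mem_insert_iff, Set.mem_singleton_iff, not_or] at hg'
      have := hv.pow_eq_one g hg
      rw [he, pow_one] at this
      exact hno ⟨g, hg, hg'.1, hg'.2, this⟩
    · rintro g (rfl | rfl)
      · exact one_mem _
      · exact ht
  · exact hv.exists_conj_ne hc ht ht1 hdet

end Delta

/-! ### The sum of the exponents -/

lemma choose_succ_eq (n k : ℕ) : (n + 1).choose k = choosePred n k + n.choose k := by
  cases k with
  | zero => simp [choosePred]
  | succ k => rw [Nat.choose_succ_succ, choosePred]

lemma choosePred_le {a b : ℕ} (h : a ≤ b) (k : ℕ) : choosePred a k ≤ choosePred b k := by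
  cases k with
  | zero => exact le_rfl
  | succ k => exact Nat.choose_le_choose k h

open Classical in
/-- The number of `k`-element subsets disjoint from a given set. -/
lemma sum_disjoint (S : Finset (Fin (m + 1))) :
    ∑ J : Set.powersetCard (Fin (m + 1)) k, (if Disjoint J.val S then (1 : ℤ) else 0) =
      (m + 1 - S.card).choose k := by
  rw [Finset.sum_boole, ← Finset.card_map (Function.Embedding.subtype _)]
  have : ((Finset.univ.filter fun J : Set.powersetCard (Fin (m + 1)) k => Disjoint J.val S).map
      (Function.Embedding.subtype _)) = Sᶜ.powersetCard k := by
    ext J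
    simp only [Finset.mem_map, Finset.mem_filter, Finset.mem_univ, true_and,
      Function.Embedding.subtype_apply, Subtype.exists, Finset.mem_powersetCard,
      Finset.subset_compl_iff_disjoint_right, exists_and_left, exists_prop, exists_eq_right_right,
      Set.powersetCard.mem_iff]
  rw [this, Finset.card_powersetCard, Finset.card_compl, Fintype.card_fin]

open Classical in
/-- The contribution of a fixed `J` to the sum of the exponents, in terms of indicator functions that
`sum_disjoint` sums up. -/
lemma sum_frameExponent_apply {T : Finset (Fin (m + 1))} {e d : ℕ} (he : 0 < e)
    (hd : d ≤ 1) (J : Set.powersetCard (Fin (m + 1)) k) :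
    ((∑ i, frameExponent T e d (J, i) : ℕ) : ℤ) =
      e * (1 - (if Disjoint J.val {0} then 1 else 0) - (if Disjoint J.val T then 1 else 0) +
        (if Disjoint J.val (insert 0 T) then 1 else 0)) +
      (if Disjoint J.val {0} then 1 else 0) +
      (e * (1 - d)) * ((if Disjoint J.val {0} then 1 else 0) -
        (if Disjoint J.val (insert 0 T) then 1 else 0)) +
      m * ((1 - (if Disjoint J.val {0} then 1 else 0)) * (e - 1) +
        e * ((if Disjoint J.val {0} then 1 else 0) -
          (if Disjoint J.val (insert 0 T) then 1 else 0))) := by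
  rw [Fin.sum_univ_succ]
  simp only [frameExponent, if_true, Fin.succ_ne_zero, if_false, Finset.disjoint_singleton_right,
    Finset.disjoint_insert_right]
  by_cases hJ : 0 ∈ J.val <;> by_cases hT : Disjoint J.val T <;>
    simp only [hJ, hT, not_true, not_false_eq_true, and_true, and_false, if_true, if_false,
      Finset.sum_const, Finset.card_univ, Fintype.card_fin, smul_eq_mul] <;>
    push_cast [Nat.cast_sub hd, Nat.cast_sub he] <;> ring

/-- The exponent of the linear form of `H` in the determinant of a basis of invariants. -/
def exponent (G : Subgroup (V ≃ₗ[F] V)) (H : Submodule F V) (k : ℕ) : ℕ :=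
  (finrank F V - 1).choose k +
    (eNum G H - 1) * (finrank F V - 1) * choosePred (finrank F V - 1) k + eNum G H * aNum G H k

lemma sum_frameExponent {G : Subgroup (V ≃ₗ[F] V)} {H : Submodule F V} {T : Finset (Fin (m + 1))}
    (hV : finrank F V = m + 1) (h0 : 0 ∉ T) (hT : T.card = bNum G H) (he : 0 < eNum G H) (k : ℕ) :
    ∑ j : Set.powersetCard (Fin (m + 1)) k × Fin (m + 1),
      frameExponent T (eNum G H) (deltaNum G H) j = exponent G H k := by
  classical
  have hd : deltaNum G H ≤ 1 := by
    rw [deltaNum]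
    split_ifs <;> omega
  -- This bound and the ones below keep the subtractions in `aNum` from truncating.
  have hb : bNum G H ≤ m := by
    have h1 := Finset.card_le_univ (insert 0 T)
    rw [Finset.card_insert_of_notMem h0, Fintype.card_fin] at h1
    omega
  have hle : m - bNum G H ≤ m := Nat.sub_le _ _
  have htot : ∑ J : Set.powersetCard (Fin (m + 1)) k, (1 : ℤ) = (m + 1).choose k := by
    have := sum_disjoint (k := k) (∅ : Finset (Fin (m + 1)))
    simpa using this
  have hX := sum_disjoint (k := k) ({0} : Finset (Fin (m + 1)))
  have hZ := sum_disjoint (k := k) T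
  have hW := sum_disjoint (k := k) (insert 0 T)
  rw [Finset.card_singleton, Nat.add_sub_cancel] at hX
  rw [hT, show m + 1 - bNum G H = m - bNum G H + 1 by omega, choose_succ_eq] at hZ
  rw [Finset.card_insert_of_notMem h0, hT, Nat.add_sub_add_right] at hW
  rw [choose_succ_eq] at htot
  rw [Fintype.sum_prod_type]
  zify
  have h1 := Finset.sum_congr rfl fun J (_ : J ∈ Finset.univ) =>
    sum_frameExponent_apply (k := k) (T := T) he hd J
  push_cast at h1
  rw [h1]
  simp only [Finset.sum_add_distrib, ← Finset.mul_sum, Finset.sum_sub_distrib, ← Finset.sum_mul,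
    hX, hZ, hW, htot]
  rw [exponent, aNum, hV]
  have e1 : m + 1 - bNum G H - 1 = m - bNum G H := by omega
  rw [e1, Nat.add_sub_cancel]
  push_cast [Nat.cast_sub (show deltaNum G H ≤ m + 1 by omega), Nat.cast_sub he,
    Nat.cast_sub (Nat.choose_le_choose k hle), Nat.cast_sub (choosePred_le hle k)]
  ring

/-- The `S`-span of the invariants of the pointwise stabilizer of a reflecting hyperplane is free, with
a basis consisting of multiples of constant elements by powers of the linear form. -/
theorem exists_local_basis [FiniteDimensional F V] (G : Subgroup (V ≃ₗ[F] V)) [Finite G]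
    {H : Submodule F V} (hH : H ∈ reflectingHyperplanes G) {ξ : Dual F V}
    (hξ : LinearMap.ker ξ = H) (k : ℕ) {N : ℕ} (hN : N = finrank F V * (finrank F V).choose k) :
    ∃ (w : Basis (Fin N) F (FormVec F V k)) (m : Fin N → ℕ), ∑ j, m j = exponent G H k ∧
      (∀ η ∈ invariants (pointwiseStabilizer G H) k, ∀ j, linForm F V ξ ^ m j ∣
        (Algebra.TensorProduct.basis (Poly F V) w).repr η j) ∧
      ∀ j, (linForm F V ξ ^ m j) ⊗ₜ[F] w j ∈ Submodule.span (Poly F V)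
        (invariants (pointwiseStabilizer G H) k : Set (DiffDerivation F V k)) := by
  obtain ⟨m, v, T, s, c, rfl, hT, hv⟩ := exists_frame G hξ (ker_ne_zero hH hξ)
  have hV : finrank F V = m + 1 := by rw [finrank_eq_card_basis v, Fintype.card_fin]
  have hcard : Fintype.card (Set.powersetCard (Fin (m + 1)) k × Fin (m + 1)) = N := by
    rw [Fintype.card_prod, Fintype.card_fin, ← Nat.card_eq_fintype_card, Set.powersetCard.card,
      Nat.card_fin, hN, hV, mul_comm]
  let f := Fintype.equivFinOfCardEq hcard
  have hI : ∃ g ∈ pointwiseStabilizer G H, g ≠ 1 := by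
    obtain ⟨g, hg, hg1, -, hgH⟩ := hH
    exact ⟨g, mem_pointwiseStabilizer.2 ⟨hg, hgH⟩, hg1⟩
  refine ⟨(adaptedBasis k v).reindex f,
    fun j => frameExponent T (eNum G H) (deltaNum G H) (f.symm j), ?_, ?_, ?_⟩
  · rw [Equiv.sum_comp f.symm]
    exact sum_frameExponent hV hv.zero_notMem hT hv.pos k
  · intro η hη j
    have h := hv.pow_frameExponent_dvd_repr hη hI
      (fun h t ht ht1 hdet => exists_ne_of_deltaNum_eq_zero hv h ht ht1 hdet) (f.symm j)
    rw [basis_repr_eq_extendScalars] at h ⊢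
    have h1 : ((adaptedBasis k v).reindex f).coord j = (adaptedBasis k v).coord (f.symm j) :=
      LinearMap.ext fun x => by
        rw [Basis.coord_apply, Basis.coord_apply, Basis.repr_reindex_apply]
    rwa [h1]
  · intro j
    rw [Basis.reindex_apply]
    exact hv.pow_frameExponent_tmul_mem (exists_unique_of_deltaNum_ne_zero hv) _

end LocalBasis

section Criterion

variable {F : Type*} [Field F] {V : Type*} [AddCommGroup V] [Module F V]

/-! ### The discriminant and the criterion -/

/-- The expected determinant of a basis of invariants, up to a constant. -/
def discr (G : Subgroup (V ≃ₗ[F] V)) [Finite G] (ℓ : Submodule F V → Dual F V) (k : ℕ) :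
    Poly F V := ∏ H ∈ arrangement G, linForm F V (ℓ H) ^ exponent G H k

lemma discr_eq (G : Subgroup (V ≃ₗ[F] V)) [Finite G] (ℓ : Submodule F V → Dual F V) (k : ℕ) :
    Q G ℓ ^ (finrank F V - 1).choose k *
      Qdet G ℓ ^ ((finrank F V - 1) * choosePred (finrank F V - 1) k) * Qk G ℓ k =
      discr G ℓ k := by
  rw [Q, Qdet, Qk, discr, ← Finset.prod_pow, ← Finset.prod_pow, ← Finset.prod_mul_distrib,
    ← Finset.prod_mul_distrib]
  refine Finset.prod_congr rfl fun H _ => ?_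
  rw [← pow_mul, ← pow_add, ← pow_add, exponent, mul_assoc]

variable {G : Subgroup (V ≃ₗ[F] V)} [Finite G] {ℓ : Submodule F V → Dual F V}

lemma mem_arrangement {H : Submodule F V} : H ∈ arrangement G ↔ H ∈ reflectingHyperplanes G := by
  simp [arrangement]

lemma discr_ne_zero (hℓ : ∀ H ∈ arrangement G, LinearMap.ker (ℓ H) = H) (k : ℕ) :
    discr G ℓ k ≠ 0 :=
  Finset.prod_ne_zero_iff.2 fun H hH =>
    pow_ne_zero _ (linForm_ne_zero (ker_ne_zero (mem_arrangement.1 hH) (hℓ H hH)))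

lemma discr_mem_polyDegree (k : ℕ) :
    discr G ℓ k ∈ polyDegree F V (∑ H ∈ arrangement G, exponent G H k) :=
  prod_mem_polyDegree _ _ _ fun _ _ => linForm_pow_mem _ _

variable {k N : ℕ}

omit [Finite G] in
lemma mem_span_of_eq_sum {B : Fin N → invariants G k} {η : invariants G k}
    (r : Fin N → polyInvariants G)
    (h : (η : DiffDerivation F V k) = ∑ i, (r i : Poly F V) • (B i : DiffDerivation F V k)) :
    η ∈ Submodule.span (polyInvariants G) (Set.range B) := by
  let _ : Module (polyInvariants G) (invariants G k) := (invariants G k).module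
  let _ : SMul (polyInvariants G) (invariants G k) := (invariants G k).module.toSMul
  have h5 : η = ∑ i, r i • B i := by
    refine Subtype.ext (Eq.trans h ?_)
    rw [AddSubmonoidClass.coe_finsetSum]
    rfl
  rw [h5]
  exact sum_mem fun i _ => Submodule.smul_mem _ _ (Submodule.subset_span ⟨i, rfl⟩)

omit [Finite G] in
lemma subset_span_of_basis {B : Fin N → invariants G k}
    (h : ∃ β : Basis (Fin N) (polyInvariants G) (invariants G k), ∀ i, β i = B i) :
    (invariants G k : Set (DiffDerivation F V k)) ⊆
      Submodule.span (Poly F V) (Set.range fun i => (B i : DiffDerivation F V k)) := by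
  obtain ⟨β, hβ⟩ := h
  intro η hη
  have h := congrArg Subtype.val (β.sum_repr ⟨η, hη⟩)
  rw [← show _ = η from h, AddSubmonoidClass.coe_finsetSum]
  refine sum_mem fun i _ => ?_
  rw [hβ]
  exact Submodule.smul_mem _ ((β.repr ⟨η, hη⟩ i : polyInvariants G) : Poly F V)
    (Submodule.subset_span ⟨i, rfl⟩)

variable [FiniteDimensional F V]

/-- The powers of the different linear forms are relatively prime, and each divides the determinant
by `exists_local_basis`. -/
lemma discr_dvd_det (hN : N = finrank F V * (finrank F V).choose k)
    (hℓ : ∀ H ∈ arrangement G, LinearMap.ker (ℓ H) = H)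
    (b : Basis (Fin N) (Poly F V) (DiffDerivation F V k))
    {η : Fin N → DiffDerivation F V k} (hη : ∀ i, η i ∈ invariants G k) :
    discr G ℓ k ∣ b.det η := by
  have := uniqueFactorizationMonoid_poly F V
  refine Finset.prod_dvd_of_isRelPrime (fun H hH H' hH' hne => ?_) fun H hH => ?_
  · have h0 := ker_ne_zero (mem_arrangement.1 hH) (hℓ H hH)
    refine IsRelPrime.pow ((prime_linForm h0).irreducible.isRelPrime_iff_not_dvd.2 fun h => hne ?_)
    obtain ⟨c, hc⟩ := eq_smul_of_linForm_dvd h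
    have hc0 : c ≠ 0 := by
      rintro rfl
      exact ker_ne_zero (mem_arrangement.1 hH') (hℓ H' hH') (by rw [hc, zero_smul])
    rw [← hℓ H hH, ← hℓ H' hH', hc, LinearMap.ker_smul _ _ hc0]
  · obtain ⟨w, m, hm, h1, -⟩ := exists_local_basis G (mem_arrangement.1 hH) (hℓ H hH) k hN
    have h2 := pow_sum_dvd_det (Algebra.TensorProduct.basis (Poly F V) w) m η fun i j =>
      h1 _ (fun g hg => hη i g hg.1) j
    rw [hm] at h2
    rw [det_eq_det_mul_det b (Algebra.TensorProduct.basis (Poly F V) w)]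
    exact h2.mul_left _

/-- A family spanning the invariants has the expected determinant: by transfer from the inertia
groups, no prime divides it more often than required. -/
lemma exists_det_eq_of_span (hV : 1 ≤ finrank F V)
    (hN : N = finrank F V * (finrank F V).choose k)
    (hℓ : ∀ H ∈ arrangement G, LinearMap.ker (ℓ H) = H)
    (z : Basis (Fin N) F (FormVec F V k)) {B : Fin N → DiffDerivation F V k}
    (hB : ∀ i, B i ∈ invariants G k)
    (hspan : (invariants G k : Set (DiffDerivation F V k)) ⊆
      Submodule.span (Poly F V) (Set.range B)) :
    ∃ c : F, c ≠ 0 ∧ (Algebra.TensorProduct.basis (Poly F V) z).det B = c • discr G ℓ k := by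
  have hufm := uniqueFactorizationMonoid_poly F V
  obtain ⟨r, hr⟩ := discr_dvd_det hN hℓ (Algebra.TensorProduct.basis (Poly F V) z) hB
  suffices IsUnit r by
    obtain ⟨c, hc, rfl⟩ := eq_algebraMap_of_isUnit this
    exact ⟨c, hc, by rw [hr, Algebra.smul_def, mul_comm]⟩
  by_contra hru
  obtain ⟨q, hq, hqr⟩ : ∃ q : Poly F V, Prime q ∧ q ∣ r := by
    by_cases h0 : r = 0
    -- If the determinant vanishes, any prime of `S` will do.
    · have : Nontrivial V := Module.nontrivial_of_finrank_pos (R := F) hV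
      obtain ⟨ξ, hξ⟩ := exists_ne (0 : Dual F V)
      exact ⟨_, prime_linForm hξ, h0 ▸ dvd_zero _⟩
    · obtain ⟨q, hq, h⟩ := WfDvdMonoid.exists_irreducible_factor hru h0
      exact ⟨q, hq.prime, h⟩
  by_cases h : ∃ H ∈ arrangement G, Associated q (linForm F V (ℓ H))
  · obtain ⟨H, hH, hqH⟩ := h
    obtain ⟨w, m, hm, -, h1⟩ := exists_local_basis G (mem_arrangement.1 hH) (hℓ H hH) k hN
    have hp := prime_linForm (ker_ne_zero (mem_arrangement.1 hH) (hℓ H hH))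
    refine not_pow_dvd_det G hp hspan w m (by rwa [inertia_linForm, hℓ H hH]) ?_
    rw [det_eq_det_mul_det _ (Algebra.TensorProduct.basis (Poly F V) z), hr, hm, pow_succ]
    exact (mul_dvd_mul (Finset.dvd_prod_of_mem _ hH) (hqH.symm.dvd.trans hqr)).mul_left _
  · push Not at h
    have hI := inertia_eq_bot G (fun H hH => hℓ H (mem_arrangement.2 hH)) hq
      fun H hH => h H (mem_arrangement.2 hH)
    refine not_pow_dvd_det G hq hspan z 0 (fun j => Submodule.subset_span ?_) ?_
    · rw [hI]
      rintro g rfl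
      rw [diffDerAct_one]
      rfl
    · rw [hr]
      simpa using hqr.mul_left _

/-- Cramer's rule expresses an invariant through a family of invariants with the expected
determinant: all the minors involved are divisible by the expected determinant. -/
lemma mem_span_of_det (hN : N = finrank F V * (finrank F V).choose k)
    (hℓ : ∀ H ∈ arrangement G, LinearMap.ker (ℓ H) = H)
    (b : Basis (Fin N) (Poly F V) (DiffDerivation F V k)) (B : Fin N → DiffDerivation F V k)
    (hB : ∀ i, B i ∈ invariants G k) {c : F} (hc : c ≠ 0) (hdet : b.det B = c • discr G ℓ k)
    {η : DiffDerivation F V k} (hη : η ∈ invariants G k) :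
    ∃ r : Fin N → polyInvariants G, η = ∑ i, (r i : Poly F V) • B i := by
  have hD := discr_ne_zero hℓ k
  have hli : LinearIndependent (Poly F V) B := linearIndependent_of_det_ne_zero b (by
    rw [hdet]
    exact smul_ne_zero hc hD)
  have hdvd (i : Fin N) : discr G ℓ k ∣ b.det (Function.update B i η) := by
    refine discr_dvd_det hN hℓ b fun j => ?_
    by_cases hji : j = i
    · subst hji
      rwa [Function.update_self]
    · rw [Function.update_of_ne hji]
      exact hB j
  choose r hr using hdvd
  have h2 : η = ∑ i, (c⁻¹ • r i) • B i := by
    refine smul_right_injective _ hD ?_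
    have h3 := congrArg (fun x => c⁻¹ • x) (det_smul_eq_sum b B η)
    simp only [hdet, smul_assoc, inv_smul_smul₀ hc, Finset.smul_sum] at h3
    simp only [h3, Finset.smul_sum]
    refine Finset.sum_congr rfl fun i _ => ?_
    rw [hr, mul_smul, smul_assoc, smul_comm c⁻¹]
  -- The coefficients are invariant because they are unique.
  have h4 (i : Fin N) : c⁻¹ • r i ∈ polyInvariants G := by
    intro g hg
    have h5 : ∑ i, (polyAct g (c⁻¹ • r i) - c⁻¹ • r i) • B i = 0 := by
      rw [Finset.sum_congr rfl fun i _ => sub_smul _ _ (B i), Finset.sum_sub_distrib, ← h2,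
        sub_eq_zero]
      conv_rhs => rw [← hη g hg, h2, map_sum]
      refine Finset.sum_congr rfl fun i _ => ?_
      rw [diffDerAct_smul, hB i g hg]
    exact sub_eq_zero.1 (Fintype.linearIndependent_iff.1 hli _ h5 i)
  exact ⟨fun i => ⟨_, h4 i⟩, h2⟩

lemma exists_basis_of_det (hN : N = finrank F V * (finrank F V).choose k)
    (hℓ : ∀ H ∈ arrangement G, LinearMap.ker (ℓ H) = H)
    (b : Basis (Fin N) (Poly F V) (DiffDerivation F V k)) (B : Fin N → invariants G k) {c : F}
    (hc : c ≠ 0) (hdet : b.det (fun i => (B i : DiffDerivation F V k)) = c • discr G ℓ k) :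
    ∃ β : Basis (Fin N) (polyInvariants G) (invariants G k), ∀ i, β i = B i := by
  have hli : LinearIndependent (Poly F V) fun i => (B i : DiffDerivation F V k) :=
    linearIndependent_of_det_ne_zero b (by
      rw [hdet]
      exact smul_ne_zero hc (discr_ne_zero hℓ k))
  have hli' : LinearIndependent (polyInvariants G) B :=
    LinearIndependent.of_comp (invariants G k).subtype
      (hli.restrict_scalars (R := polyInvariants G) fun a b h => Subtype.ext (by
        simpa [Subalgebra.smul_def] using h))
  have hspan : ⊤ ≤ Submodule.span (polyInvariants G) (Set.range B) := fun η _ => by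
    obtain ⟨r, hr⟩ := mem_span_of_det hN hℓ b _ (fun i => (B i).2) hc hdet η.2
    exact mem_span_of_eq_sum r hr
  exact ⟨Basis.mk hli' hspan, fun i => by rw [Basis.mk_apply]⟩

/-- The determinant is the expected one as soon as it is nonzero of the expected degree. -/
lemma exists_det_eq_iff (hN : N = finrank F V * (finrank F V).choose k)
    (hℓ : ∀ H ∈ arrangement G, LinearMap.ker (ℓ H) = H)
    (b : Basis (Fin N) (Poly F V) (DiffDerivation F V k))
    {η : Fin N → DiffDerivation F V k} (hη : ∀ i, η i ∈ invariants G k) {d : ℕ}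
    (hd : b.det η ∈ polyDegree F V d) :
    (∃ c : F, c ≠ 0 ∧ b.det η = c • discr G ℓ k) ↔
      b.det η ≠ 0 ∧ d = ∑ H ∈ arrangement G, exponent G H k := by
  constructor
  · rintro ⟨c, hc, h⟩
    have h0 := smul_ne_zero hc (discr_ne_zero hℓ k)
    rw [h] at hd ⊢
    exact ⟨h0, degree_unique hd (Submodule.smul_mem _ c (discr_mem_polyDegree k)) h0⟩
  · rintro ⟨h0, rfl⟩
    obtain ⟨r, hr⟩ := discr_dvd_det hN hℓ b hη
    rw [hr] at hd h0
    obtain ⟨c, hc⟩ := eq_algebraMap_of_mul_mem (discr_mem_polyDegree k) hd h0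
    refine ⟨c, fun h => h0 ?_, by rw [hr, hc, Algebra.smul_def, mul_comm]⟩
    rw [hc, h, map_zero, mul_zero]

end Criterion

end DiffDer

end

open scoped TensorProduct in
theorem mainTheorem1 {F : Type*} [Field F] {V : Type*} [AddCommGroup V] [Module F V]
    [FiniteDimensional F V] {n : ℕ} (hn : Module.finrank F V = n) (hn_pos : 1 ≤ n)
    (G : Subgroup (V ≃ₗ[F] V)) [Finite G]
    (ℓ : Submodule F V → Module.Dual F V)
    (hℓ : ∀ H ∈ DiffDer.arrangement G, LinearMap.ker (ℓ H) = H)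
    (k : ℕ)
    (z : Module.Basis (Fin (n * n.choose k)) F (DiffDer.FormVec F V k))
    (B : Fin (n * n.choose k) → DiffDer.invariants G k)
    (deg : Fin (n * n.choose k) → ℕ)
    (hdeg : ∀ i, DiffDer.IsHomogeneousOfDegree F V (deg i) (B i : DiffDer.DiffDerivation F V k)) :
    [(∃ β : Module.Basis (Fin (n * n.choose k)) (DiffDer.polyInvariants G)
        (DiffDer.invariants G k), ∀ i, β i = B i),
      (∃ c : F, c ≠ 0 ∧
        (DiffDer.coef z fun i => (B i : DiffDer.DiffDerivation F V k)).det =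
          c • (DiffDer.Q G ℓ ^ (n - 1).choose k *
            DiffDer.Qdet G ℓ ^ ((n - 1) * DiffDer.choosePred (n - 1) k) *
            DiffDer.Qk G ℓ k)),
      (DiffDer.FracIndependent (fun i => (B i : DiffDer.DiffDerivation F V k)) ∧
        ∑ i, deg i = ∑ H ∈ DiffDer.arrangement G,
          ((n - 1).choose k +
            (DiffDer.eNum G H - 1) * (n - 1) * DiffDer.choosePred (n - 1) k +
            DiffDer.eNum G H * DiffDer.aNum G H k))].TFAE := by
  open DiffDer in
  subst hn
  have hdegdet := det_coef_mem_polyDegree z (fun i => (B i : DiffDerivation F V k)) deg hdeg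
  rw [det_coef] at hdegdet
  have hexp : (∑ H ∈ arrangement G, ((Module.finrank F V - 1).choose k +
      (eNum G H - 1) * (Module.finrank F V - 1) * choosePred (Module.finrank F V - 1) k +
      eNum G H * aNum G H k)) = ∑ H ∈ arrangement G, exponent G H k := rfl
  rw [discr_eq, hexp, FracIndependent,
    linearIndependent_fractionRing_iff (Algebra.TensorProduct.basis (Poly F V) z), det_coef]
  tfae_have 1 → 2 := fun h =>
    exists_det_eq_of_span hn_pos rfl hℓ z (fun i => (B i).2) (subset_span_of_basis h)
  tfae_have 2 → 1 := fun ⟨_, hc, h⟩ => exists_basis_of_det rfl hℓ _ B hc h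
  tfae_have 2 ↔ 3 := exists_det_eq_iff rfl hℓ _ (fun i => (B i).2) hdegdet
  tfae_finish
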